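/- Let $Y$ be a closed (compact, without boundary) connected smooth 3-manifold, let $\lambda$ be a contact form on $Y$ (a smooth 1-form with $\lambda\wedge d\lambda$ nowhere zero), and let $R$ be its Reeb vector field ($\lambda(R)=1$, $d\lambda(R,\cdot)=0$). Let $\{R,X_1,X_2\}$ be a contact canonical frame: $X_1,X_2$ are smooth vector fields with values in $\ker\lambda$ such that $R,X_1,X_2$ are everywhere linearly independent, and there are smooth functions $I,J,K:Y\to\mathbb{R}$ with $$[X_2,R]=X_1,\qquad [X_1,X_2]=R+IX_1+JX_2,\qquad [R,X_1]=KX_2 .$$ Suppose that $K\equiv 0$. Then: (i) $J\equiv 0$. (ii) $Y$ is a $T^2$-bundle over $S^1$: there is a smooth, locally trivial fibre bundle $p:Y\to S^1=\{z\in\mathbb{C}:|z|=1\}$ with fibre $T^2=S^1\times S^1$. Moreover $p$ can be chosen such that $R$ and $X_1$ are tangent to the fibres and, for some constant $c>0$, $dp(X_2)=c\,\partial_\theta$, where $\theta$ is the angular coordinate on $S^1$. (iii) For this $p$, the function $I$ descends to the base: there is a smooth function $\tilde I:S^1\to\mathbb{R}$ with $I=\tilde I\circ p$, and $$\int_{S^1}\tilde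 I\,d\theta=\int_0^{2\pi}\tilde I(e^{i\theta})\,d\theta=0 .$$ -/

import Mathlib

open Set Bundle
open scoped Manifold ContDiff

noncomputable section

/-- A (not necessarily smooth) differential 1-form on a 3-manifold. -/
abbrev OneForm (Y : Type*) [TopologicalSpace Y] [ChartedSpace (EuclideanSpace ℝ (Fin 3)) Y] :=
  Π y : Y, TangentSpace (𝓡 3) y →L[ℝ] ℝ

/-- A (not necessarily smooth) vector field on a 3-manifold. -/
abbrev VField (Y : Type*) [TopologicalSpace Y] [ChartedSpace (EuclideanSpace ℝ (Fin 3)) Y] :=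
  Π y : Y, TangentSpace (𝓡 3) y

section Contact

variable {Y : Type*} [TopologicalSpace Y] [ChartedSpace (EuclideanSpace ℝ (Fin 3)) Y]

/-- Smoothness of a vector field, as a section of the tangent bundle. -/
def SmoothVField [IsManifold (𝓡 3) ∞ Y] (V : VField Y) : Prop :=
  ContMDiff (𝓡 3) (𝓡 3).tangent ∞ (fun y => (⟨y, V y⟩ : TangentBundle (𝓡 3) Y))

/-- The 1-form `lam` read in the preferred chart at `y`: its pullback under the inverse chart. -/
def OneForm.inChart [IsManifold (𝓡 3) ∞ Y] (lam : OneForm Y) (y : Y) :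
    EuclideanSpace ℝ (Fin 3) → (EuclideanSpace ℝ (Fin 3) →L[ℝ] ℝ) :=
  fun u => (lam ((extChartAt (𝓡 3) y).symm u)).comp
    (mfderiv (𝓡 3) (𝓡 3) (extChartAt (𝓡 3) y).symm u)

/-- The exterior derivative `(dλ)_y (v, w)` of a 1-form, computed in the preferred chart at `y`:
if the form is `∑ aᵢ dxᵢ` there, this is `∑ (∂ⱼ aᵢ) (vⱼ wᵢ - wⱼ vᵢ)`. -/
def OneForm.d [IsManifold (𝓡 3) ∞ Y] (lam : OneForm Y) (y : Y)
    (v w : TangentSpace (𝓡 3) y) : ℝ :=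
  let D := mfderiv (𝓡 3) (𝓡 3) (extChartAt (𝓡 3) y) y
  let A := fderiv ℝ (lam.inChart y) (extChartAt (𝓡 3) y y)
  A (D v) (D w) - A (D w) (D v)

/-- A contact form on a 3-manifold: a smooth 1-form `λ` such that the 3-form `λ ∧ dλ` vanishes at
no point. -/
structure IsContactForm [IsManifold (𝓡 3) ∞ Y] (lam : OneForm Y) : Prop where
  smooth : ContMDiff (𝓡 3) ((𝓡 3).prod 𝓘(ℝ, EuclideanSpace ℝ (Fin 3) →L[ℝ] ℝ)) ∞
    (fun y => TotalSpace.mk' (EuclideanSpace ℝ (Fin 3) →L[ℝ] ℝ)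
      (E := fun y : Y => TangentSpace (𝓡 3) y →L[ℝ] ℝ) y (lam y))
  wedge_ne_zero : ∀ y : Y, ∃ u v w : TangentSpace (𝓡 3) y,
    lam y u * lam.d y v w + lam y v * lam.d y w u + lam y w * lam.d y u v ≠ 0

/-- `R` is the Reeb vector field of `lam`. -/
structure IsReebField [IsManifold (𝓡 3) ∞ Y] (lam : OneForm Y) (R : VField Y) : Prop where
  smooth : SmoothVField R
  apply_eq_one : ∀ y, lam y (R y) = 1
  d_eq_zero : ∀ y (v : TangentSpace (𝓡 3) y), lam.d y (R y) v = 0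

/-- `{R, X₁, X₂}` is a contact canonical frame for the contact form `lam`, with structure
functions `I`, `J`, `K`. -/
structure IsContactCanonicalFrame [IsManifold (𝓡 3) ∞ Y] (lam : OneForm Y) (R X₁ X₂ : VField Y)
    (I J K : Y → ℝ) : Prop where
  contact : IsContactForm lam
  reeb : IsReebField lam R
  smooth_X₁ : SmoothVField X₁
  smooth_X₂ : SmoothVField X₂
  smooth_I : ContMDiff (𝓡 3) 𝓘(ℝ, ℝ) ∞ I
  smooth_J : ContMDiff (𝓡 3) 𝓘(ℝ, ℝ) ∞ J
  smooth_K : ContMDiff (𝓡 3) 𝓘(ℝ, ℝ) ∞ K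
  ker_X₁ : ∀ y, lam y (X₁ y) = 0
  ker_X₂ : ∀ y, lam y (X₂ y) = 0
  linearIndependent : ∀ y, LinearIndependent ℝ ![R y, X₁ y, X₂ y]
  bracket_X₂_R : ∀ y, VectorField.mlieBracket (𝓡 3) X₂ R y = X₁ y
  bracket_X₁_X₂ : ∀ y, VectorField.mlieBracket (𝓡 3) X₁ X₂ y = R y + I y • X₁ y + J y • X₂ y
  bracket_R_X₁ : ∀ y, VectorField.mlieBracket (𝓡 3) R X₁ y = K y • X₂ y

/-- `p : Y → S¹` is a smooth, locally trivial fibre bundle with fibre the 2-torus `S¹ × S¹`. -/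
def IsSmoothTorusBundle (p : Y → Circle) : Prop :=
  ∀ b : Circle, ∃ e : Trivialization (Circle × Circle) p, b ∈ e.baseSet ∧
    ContMDiffOn (𝓡 3) ((𝓡 1).prod ((𝓡 1).prod (𝓡 1))) ∞ e e.source ∧
    ContMDiffOn ((𝓡 1).prod ((𝓡 1).prod (𝓡 1))) (𝓡 3) ∞ e.toOpenPartialHomeomorph.symm e.target

end Contact

end

/-! Two consequences of the Jacobi identity start the proof: with `K = 0` it gives `R I = J` and `R
J = 0`. On a compact manifold a function `g = V u` with `V g = 0` must vanish
(`eq_zero_of_derivative_along`), so `J = 0` and `R I = 0`. Commuting derivatives then gives `R (X₂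
I) = -X₁ I` and `R (X₁ I) = 0`, hence `X₁ I = 0` by the same principle. So `V₁ = R`, `V₂ = X₁`, `V₃
= X₂` commute up to a linear ODE whose only coefficient `h = I` is constant along `V₁` and `V₂`
(`IsSolvFrame`).

Locally (`exists_normal_form`) the 1-form dual to `V₃` is closed, hence `df`, and `h = k(f)`.
Twisting the other two dual forms by a fundamental solution of the ODE makes them closed as well. In
the resulting coordinates `V₃` is a coordinate field and `V₁, V₂` span the complementary plane, with
coefficients depending only on the last coordinate.

Globally, `V₁, V₂` integrate to an action `Φ` of the plane, and the flow `ψ` of `V₃` carries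
`Φ`-orbits to `Φ`-orbits, conjugating `Φ` by a linear cocycle `monodromy` with `M' = M ∘
frameGenerator h`. By connectedness, `ψ` and `Φ` together reach every point from any other. The
times at which `ψ` returns to the `Φ`-orbit of `z` form a subgroup of `ℝ`. It is nonzero by
compactness (`periods_ne_bot`). It is not dense (`periods_not_dense`), since `frameGenerator` is
invertible and a small return therefore acts on the orbit as an affine map with a unique fixed
point. So it is `lℤ`, and time modulo `l` is the projection to the circle, with the `Φ`-orbits as
fibres.

A fibre is compact, so the stabilizer of a point under `Φ` is a lattice (`span_stabilizer`), the
fibre is a torus, and flowing by `ψ` trivializes the bundle. The monodromy of one full turn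
preserves the lattice, and its determinant is `exp (-∫ h)`. This is a positive invertible integer,
hence `1`, so the integral vanishes (`integral_eq_zero`). -/

noncomputable section

open Filter Topology VectorField

section

variable {Y : Type*} [TopologicalSpace Y] [ChartedSpace (EuclideanSpace ℝ (Fin 3)) Y]

/-- If `γ` is an integral curve of `V` then `u ∘ γ` has derivative `du(V)`. -/
lemma hasDerivAt_comp_integralCurve {γ : ℝ → Y} {V : VField Y} {u : Y → ℝ} {t : ℝ}
    (hγ : HasMFDerivAt 𝓘(ℝ, ℝ) (𝓡 3) γ t ((1 : ℝ →L[ℝ] ℝ).smulRight (V (γ t))))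
    (hu : MDifferentiableAt (𝓡 3) 𝓘(ℝ, ℝ) u (γ t)) :
    HasDerivAt (u ∘ γ) (mfderiv (𝓡 3) 𝓘(ℝ, ℝ) u (γ t) (V (γ t)) : ℝ) t := by
  have h := HasFDerivAt.hasDerivAt (𝕜 := ℝ) (F := ℝ) (hu.hasMFDerivAt.comp t hγ).hasFDerivAt
  have e : mfderiv (𝓡 3) 𝓘(ℝ, ℝ) u (γ t) ((1 : ℝ) • V (γ t))
      = mfderiv (𝓡 3) 𝓘(ℝ, ℝ) u (γ t) (V (γ t)) := by rw [one_smul]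
  exact e ▸ h

end

/-! ### A maximum principle along a vector field -/

section MaxPrinciple

variable {Y : Type*} [TopologicalSpace Y] [ChartedSpace (EuclideanSpace ℝ (Fin 3)) Y]
  [IsManifold (𝓡 3) ∞ Y] [CompactSpace Y]

/-- Maximize `u` over the compact set where `g` attains its maximum. An integral curve of `V`
through the maximizer stays in that set, because `g` is constant along it. Hence `u` has a local
maximum along the curve, and its derivative there, which is `max g`, vanishes. -/
lemma nonpos_of_derivative_along {V : VField Y} (hV : SmoothVField V) {u g : Y → ℝ}
    (hu : ContMDiff (𝓡 3) 𝓘(ℝ, ℝ) ∞ u) (hg : ContMDiff (𝓡 3) 𝓘(ℝ, ℝ) ∞ g)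
    (hug : ∀ y, (mfderiv (𝓡 3) 𝓘(ℝ, ℝ) u y (V y) : ℝ) = g y)
    (hg0 : ∀ y, (mfderiv (𝓡 3) 𝓘(ℝ, ℝ) g y (V y) : ℝ) = 0) (y : Y) : g y ≤ 0 := by
  have : IsManifold (𝓡 3) 1 Y := IsManifold.of_le (n := ∞) (by simp)
  obtain ⟨y₀, -, hy₀⟩ := isCompact_univ.exists_isMaxOn ⟨y, mem_univ y⟩ hg.continuous.continuousOn
  have hMc : IsCompact {x | g x = g y₀} :=
    (isClosed_eq hg.continuous continuous_const).isCompact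
  obtain ⟨y₁, hy₁, hmax⟩ := hMc.exists_isMaxOn ⟨y₀, rfl⟩ hu.continuous.continuousOn
  obtain ⟨γ, hγ0, hγ⟩ := exists_isMIntegralCurveAt_of_contMDiffAt_boundaryless (t₀ := 0)
    (I := 𝓡 3) (v := V) (x₀ := y₁) ((hV y₁).of_le (by simp))
  obtain ⟨ε, hε, hball⟩ := Metric.eventually_nhds_iff_ball.mp hγ
  have hd : ∀ t ∈ Metric.ball (0 : ℝ) ε, HasDerivAt (g ∘ γ) 0 t := fun t ht => by
    have := hasDerivAt_comp_integralCurve (hball t ht)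
      ((hg (γ t)).mdifferentiableAt (by simp))
    rwa [hg0] at this
  have hconst : ∀ t ∈ Metric.ball (0 : ℝ) ε, (g ∘ γ) t = (g ∘ γ) 0 := fun t ht =>
    (convex_ball (0 : ℝ) ε).is_const_of_fderivWithin_eq_zero
      (fun s hs => (hd s hs).differentiableAt.differentiableWithinAt)
      (fun s hs => by
        rw [fderivWithin_of_isOpen Metric.isOpen_ball hs, (hd s hs).hasFDerivAt.fderiv]
        ext; simp) ht (Metric.mem_ball_self hε)
  have hu0 := hasDerivAt_comp_integralCurve (hball 0 (Metric.mem_ball_self hε))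
      ((hu (γ 0)).mdifferentiableAt (by simp))
  have hloc : IsLocalMax (u ∘ γ) 0 := by
    filter_upwards [Metric.ball_mem_nhds (0 : ℝ) hε] with t ht
    have : γ t ∈ {x | g x = g y₀} := by
      have := hconst t ht
      simp only [Function.comp, hγ0] at this
      exact this.trans hy₁
    simpa [hγ0] using hmax this
  have h0 := hloc.hasDerivAt_eq_zero hu0
  rw [hug, hγ0] at h0
  calc g y ≤ g y₀ := hy₀ (mem_univ y)
    _ = g y₁ := hy₁.symm
    _ = 0 := h0
    _ ≤ 0 := le_rfl

/-- The hypotheses are invariant under `(u, g) ↦ (-u, -g)`, so the one-sided bound applies twice. -/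
lemma eq_zero_of_derivative_along {V : VField Y} (hV : SmoothVField V) {u g : Y → ℝ}
    (hu : ContMDiff (𝓡 3) 𝓘(ℝ, ℝ) ∞ u) (hg : ContMDiff (𝓡 3) 𝓘(ℝ, ℝ) ∞ g)
    (hug : ∀ y, (mfderiv (𝓡 3) 𝓘(ℝ, ℝ) u y (V y) : ℝ) = g y)
    (hg0 : ∀ y, (mfderiv (𝓡 3) 𝓘(ℝ, ℝ) g y (V y) : ℝ) = 0) (y : Y) : g y = 0 := by
  refine le_antisymm (nonpos_of_derivative_along hV hu hg hug hg0 y) ?_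
  have key (w : Y → ℝ) (hw : ContMDiff (𝓡 3) 𝓘(ℝ, ℝ) ∞ w) (x : Y) :
      (mfderiv (𝓡 3) 𝓘(ℝ, ℝ) (fun a => - w a) x (V x) : ℝ)
        = - (mfderiv (𝓡 3) 𝓘(ℝ, ℝ) w x (V x) : ℝ) := by
    have := ((hw x).mdifferentiableAt (by simp)).hasMFDerivAt.neg.mfderiv
    erw [this]
    rfl
  have := nonpos_of_derivative_along hV (u := fun a => - u a) (g := fun a => - g a) hu.neg hg.neg
    (fun x => (key u hu x).trans (congrArg _ (hug x)))
    (fun x => (key g hg x).trans ((congrArg _ (hg0 x)).trans neg_zero)) y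
  linarith

end MaxPrinciple

/-! ### Vector fields, brackets and functions read in a chart -/

section Charts

lemma mlieBracket_vectorSpace_apply {E : Type*} [NormedAddCommGroup E] [NormedSpace ℝ E]
    (A B : Π x : E, TangentSpace 𝓘(ℝ, E) x) (x : E) :
    mlieBracket 𝓘(ℝ, E) A B x = lieBracket ℝ (E := E) A B x := by
  rw [← mlieBracketWithin_univ, mlieBracketWithin_eq_lieBracketWithin]
  exact congrFun (lieBracketWithin_univ (E := E) (V := A) (W := B)) x

variable {Y : Type*} [TopologicalSpace Y] [ChartedSpace (EuclideanSpace ℝ (Fin 3)) Y]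
  [IsManifold (𝓡 3) ∞ Y]

/-- The vector field `V` read in the preferred chart at `z`. -/
def VField.inChart (V : VField Y) (z : Y) : EuclideanSpace ℝ (Fin 3) → EuclideanSpace ℝ (Fin 3) :=
  mpullback 𝓘(ℝ, EuclideanSpace ℝ (Fin 3)) (𝓡 3) (extChartAt (𝓡 3) z).symm V

variable {z : Y} {x : EuclideanSpace ℝ (Fin 3)}

lemma contMDiffAt_extChartAt_symm_of_mem (hx : x ∈ (extChartAt (𝓡 3) z).target) :
    ContMDiffAt 𝓘(ℝ, EuclideanSpace ℝ (Fin 3)) (𝓡 3) ∞ (extChartAt (𝓡 3) z).symm x :=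
  (contMDiffOn_extChartAt_symm z).contMDiffAt ((isOpen_extChartAt_target z).mem_nhds hx)

lemma isInvertible_mfderiv_extChartAt_symm_of_mem (hx : x ∈ (extChartAt (𝓡 3) z).target) :
    (mfderiv 𝓘(ℝ, EuclideanSpace ℝ (Fin 3)) (𝓡 3) (extChartAt (𝓡 3) z).symm x).IsInvertible := by
  have : IsManifold (𝓡 3) 1 Y := IsManifold.of_le (n := ∞) (by simp)
  have := isInvertible_mfderivWithin_extChartAt_symm (I := 𝓡 3) hx
  simpa using this

lemma mfderiv_symm_inChart (V : VField Y) (hx : x ∈ (extChartAt (𝓡 3) z).target) :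
    mfderiv 𝓘(ℝ, EuclideanSpace ℝ (Fin 3)) (𝓡 3) (extChartAt (𝓡 3) z).symm x (V.inChart z x)
      = V ((extChartAt (𝓡 3) z).symm x) := by
  obtain ⟨e, he⟩ := isInvertible_mfderiv_extChartAt_symm_of_mem hx
  rw [VField.inChart, mpullback_apply, ← he, ContinuousLinearMap.inverse_equiv]
  exact e.apply_symm_apply _

lemma SmoothVField.contDiffAt_inChart {V : VField Y} (hV : SmoothVField V)
    (hx : x ∈ (extChartAt (𝓡 3) z).target) : ContDiffAt ℝ ∞ (V.inChart z) x := by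
  have : IsManifold (𝓡 3) 1 Y := IsManifold.of_le (n := ∞) (by simp)
  exact contMDiffAt_vectorSpace_iff_contDiffAt.mp
    (ContMDiffAt.mpullback_vectorField_preimage (hV _) (contMDiffAt_extChartAt_symm_of_mem hx)
      (isInvertible_mfderiv_extChartAt_symm_of_mem hx) (by simp))

lemma lieBracket_inChart {V W : VField Y} (hV : SmoothVField V) (hW : SmoothVField W)
    (hx : x ∈ (extChartAt (𝓡 3) z).target) :
    lieBracket ℝ (V.inChart z) (W.inChart z) x
      = VField.inChart (fun y => mlieBracket (𝓡 3) V W y) z x := by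
  have : IsManifold (𝓡 3) (minSmoothness ℝ 3) Y :=
    IsManifold.of_le (n := ∞) (by simpa using ENat.LEInfty.out)
  have h := mpullback_mlieBracket (I := 𝓘(ℝ, EuclideanSpace ℝ (Fin 3))) (n := ∞) (I' := 𝓡 3)
    ((hV _).mdifferentiableAt (by simp)) ((hW _).mdifferentiableAt (by simp))
    (contMDiffAt_extChartAt_symm_of_mem hx) (by simpa using ENat.LEInfty.out)
  exact (h.trans (mlieBracket_vectorSpace_apply _ _ _)).symm

lemma contDiffAt_function_inChart {u : Y → ℝ} (hu : ContMDiff (𝓡 3) 𝓘(ℝ, ℝ) ∞ u)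
    (hx : x ∈ (extChartAt (𝓡 3) z).target) :
    ContDiffAt ℝ ∞ (u ∘ (extChartAt (𝓡 3) z).symm) x :=
  ((hu _).comp x (contMDiffAt_extChartAt_symm_of_mem hx)).contDiffAt

lemma fderiv_function_inChart {u : Y → ℝ} (hu : ContMDiff (𝓡 3) 𝓘(ℝ, ℝ) ∞ u) (V : VField Y)
    (hx : x ∈ (extChartAt (𝓡 3) z).target) :
    fderiv ℝ (u ∘ (extChartAt (𝓡 3) z).symm) x (V.inChart z x)
      = (mfderiv (𝓡 3) 𝓘(ℝ, ℝ) u ((extChartAt (𝓡 3) z).symm x)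
          (V ((extChartAt (𝓡 3) z).symm x)) : ℝ) := by
  rw [← mfderiv_eq_fderiv, mfderiv_comp x ((hu _).mdifferentiableAt (by simp))
    ((contMDiffAt_extChartAt_symm_of_mem hx).mdifferentiableAt (by simp))]
  rw [← mfderiv_symm_inChart V hx]
  rfl

end Charts

/-! ### Consequences of the Jacobi identity in a vector space -/

section Jacobi

variable {E : Type*} [NormedAddCommGroup E] [NormedSpace ℝ E]

/-- The Jacobi identity for a frame with `[V₃,V₁] = V₂`, `[V₂,V₃] = V₁ + h V₂ + k V₃` and
`[V₁,V₂] = 0` forces `V₁ h = k` and `V₁ k = 0`. -/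
lemma fderiv_structureFunctions_of_jacobi {V₁ V₂ V₃ : E → E} {h k : E → ℝ} {x : E}
    (hV₁ : ContDiffAt ℝ ∞ V₁ x) (hV₂ : ContDiffAt ℝ ∞ V₂ x) (hV₃ : ContDiffAt ℝ ∞ V₃ x)
    (hh : ContDiffAt ℝ ∞ h x) (hk : ContDiffAt ℝ ∞ k x)
    (h31 : ∀ᶠ y in 𝓝 x, lieBracket ℝ V₃ V₁ y = V₂ y)
    (h23 : ∀ᶠ y in 𝓝 x, lieBracket ℝ V₂ V₃ y = V₁ y + h y • V₂ y + k y • V₃ y)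
    (h12 : ∀ᶠ y in 𝓝 x, lieBracket ℝ V₁ V₂ y = 0)
    (hli : LinearIndependent ℝ ![V₁ x, V₂ x, V₃ x]) :
    fderiv ℝ h x (V₁ x) = k x ∧ fderiv ℝ k x (V₁ x) = 0 := by
  have d1 := hV₁.differentiableAt (by simp)
  have d2 := hV₂.differentiableAt (by simp)
  have d3 := hV₃.differentiableAt (by simp)
  have dh := hh.differentiableAt (by simp)
  have dk := hk.differentiableAt (by simp)
  have h31x := h31.self_of_nhds
  have h12x := h12.self_of_nhds
  have h13 : ∀ᶠ y in 𝓝 x, lieBracket ℝ V₁ V₃ y = ((-1 : ℝ) • V₂) y := by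
    filter_upwards [h31] with y hy
    rw [lieBracket_swap, hy]; simp
  have J := leibniz_identity_lieBracket (𝕜 := ℝ) (n := ∞)
    (by simpa using ENat.LEInfty.out) hV₁ hV₂ hV₃
  have L1 : lieBracket ℝ V₁ (lieBracket ℝ V₂ V₃) x
      = lieBracket ℝ V₁ (V₁ + h • V₂ + k • V₃) x :=
    Filter.EventuallyEq.lieBracket_vectorField_eq (EventuallyEq.refl _ _) (h23)
  have L2 : lieBracket ℝ (lieBracket ℝ V₁ V₂) V₃ x = lieBracket ℝ (0 : E → E) V₃ x :=
    Filter.EventuallyEq.lieBracket_vectorField_eq (h12) (EventuallyEq.refl _ _)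
  have L3 : lieBracket ℝ V₂ (lieBracket ℝ V₁ V₃) x = lieBracket ℝ V₂ ((-1 : ℝ) • V₂) x :=
    Filter.EventuallyEq.lieBracket_vectorField_eq (EventuallyEq.refl _ _) h13
  have M1 : lieBracket ℝ V₁ (h • V₂) x
      = fderiv ℝ h x (V₁ x) • V₂ x + h x • lieBracket ℝ V₁ V₂ x := lieBracket_smul_right dh d2
  have M2 : lieBracket ℝ V₁ (k • V₃) x
      = fderiv ℝ k x (V₁ x) • V₃ x + k x • lieBracket ℝ V₁ V₃ x := lieBracket_smul_right dk d3
  rw [L1, L2, L3, lieBracket_const_smul_right d2, lieBracket_add_right (d1.add (dh.smul d2)) (dk.smul d3),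
    lieBracket_add_right d1 (dh.smul d2), M1, M2,
    h13.self_of_nhds, h12x] at J
  simp only [lieBracket_self, Pi.zero_apply, lieBracket_zero_left, smul_zero, add_zero,
    zero_add, Pi.smul_apply] at J
  have key := LinearIndependent.pair_iff (R := ℝ) (x := V₂ x) (y := V₃ x) |>.mp (by
    have := hli.comp ![1, 2] (by decide)
    have e : ![V₁ x, V₂ x, V₃ x] ∘ ![1, 2] = ![V₂ x, V₃ x] := by
      funext i; fin_cases i <;> rfl
    rwa [e] at this)
  -- The Jacobi identity has become `(V₁ h - k) V₂ + (V₁ k) V₃ = 0`; the `-k V₂` comes from `k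
  -- [V₁,V₃]`.
  have := key (fderiv ℝ h x (V₁ x) - k x) (fderiv ℝ k x (V₁ x)) (by
    rw [← J]; module)
  exact ⟨sub_eq_zero.mp this.1, this.2⟩

/-- If `V₁ u = 0` then `V₁ (V₃ u) = -V₂ u` and `V₁ (V₂ u) = 0`. -/
lemma fderiv_fderiv_of_bracket {V₁ V₂ V₃ : E → E} {u : E → ℝ} {x : E}
    (hV₁ : ContDiffAt ℝ ∞ V₁ x) (hV₂ : ContDiffAt ℝ ∞ V₂ x) (hV₃ : ContDiffAt ℝ ∞ V₃ x)
    (hu : ContDiffAt ℝ ∞ u x) (h31 : lieBracket ℝ V₃ V₁ x = V₂ x)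
    (h12 : lieBracket ℝ V₁ V₂ x = 0) (hu1 : ∀ᶠ y in 𝓝 x, fderiv ℝ u y (V₁ y) = 0) :
    fderiv ℝ (fun y => fderiv ℝ u y (V₃ y)) x (V₁ x) = - fderiv ℝ u x (V₂ x) ∧
      fderiv ℝ (fun y => fderiv ℝ u y (V₂ y)) x (V₁ x) = 0 := by
  have d1 := hV₁.differentiableAt (by simp)
  have d2 := hV₂.differentiableAt (by simp)
  have d3 := hV₃.differentiableAt (by simp)
  have z : fderiv ℝ (fun y => fderiv ℝ u y (V₁ y)) x = 0 := by
    have : (fun y => fderiv ℝ u y (V₁ y)) =ᶠ[𝓝 x] fun _ => (0 : ℝ) := hu1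
    rw [this.fderiv_eq]; simp
  -- Both brackets, `[V₃,V₁]` and `[V₁,V₂]`, act on `u` as commutators of derivations; the terms
  -- that differentiate `V₁ u` drop out.
  have e1 := fderiv_apply_lieBracket (𝕜 := ℝ) (n := ∞) hu (by simpa using ENat.LEInfty.out) d1 d3
  have e2 := fderiv_apply_lieBracket (𝕜 := ℝ) (n := ∞) hu (by simpa using ENat.LEInfty.out) d2 d1
  rw [h31, z] at e1
  rw [h12, z] at e2
  simp only [map_zero, zero_apply, sub_zero, zero_sub] at e1 e2
  exact ⟨by rw [e1, neg_neg], e2.symm⟩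

end Jacobi

/-! ### Reduction of the contact frame to a frame with one structure function -/

section Frame

variable {Y : Type*} [TopologicalSpace Y] [ChartedSpace (EuclideanSpace ℝ (Fin 3)) Y]

/-- The derivative of the function `u` along the vector field `V`. -/
def VField.deriv (V : VField Y) (u : Y → ℝ) (y : Y) : ℝ :=
  (mfderiv (𝓡 3) 𝓘(ℝ, ℝ) u y (V y) : ℝ)

variable [IsManifold (𝓡 3) ∞ Y] {z : Y} {x : EuclideanSpace ℝ (Fin 3)}

lemma VField.deriv_inChart {u : Y → ℝ} (hu : ContMDiff (𝓡 3) 𝓘(ℝ, ℝ) ∞ u) (V : VField Y)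
    (hx : x ∈ (extChartAt (𝓡 3) z).target) :
    V.deriv u ((extChartAt (𝓡 3) z).symm x)
      = fderiv ℝ (u ∘ (extChartAt (𝓡 3) z).symm) x (V.inChart z x) :=
  (fderiv_function_inChart hu V hx).symm

lemma contMDiff_deriv {u : Y → ℝ} (hu : ContMDiff (𝓡 3) 𝓘(ℝ, ℝ) ∞ u) {V : VField Y}
    (hV : SmoothVField V) : ContMDiff (𝓡 3) 𝓘(ℝ, ℝ) ∞ (V.deriv u) := by
  intro z
  have hz : extChartAt (𝓡 3) z z ∈ (extChartAt (𝓡 3) z).target := mem_extChartAt_target z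
  have h1 : ContDiffAt ℝ ∞ (fun x => fderiv ℝ (u ∘ (extChartAt (𝓡 3) z).symm) x (V.inChart z x))
      (extChartAt (𝓡 3) z z) :=
    ((contDiffAt_function_inChart hu hz).fderiv_right (by simp)).clm_apply (hV.contDiffAt_inChart hz)
  have h2 := h1.contMDiffAt.comp z (contMDiffAt_extChartAt (I := 𝓡 3) (n := ∞) (x := z))
  refine h2.congr_of_eventuallyEq ?_
  filter_upwards [extChartAt_source_mem_nhds (I := 𝓡 3) z] with y hy
  rw [Function.comp, ← V.deriv_inChart hu ((extChartAt (𝓡 3) z).map_source hy),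
    (extChartAt (𝓡 3) z).left_inv hy]

lemma deriv_deriv_inChart {u : Y → ℝ} (hu : ContMDiff (𝓡 3) 𝓘(ℝ, ℝ) ∞ u) {V W : VField Y}
    (hV : SmoothVField V) (hx : x ∈ (extChartAt (𝓡 3) z).target) :
    W.deriv (V.deriv u) ((extChartAt (𝓡 3) z).symm x)
      = fderiv ℝ (fun a => fderiv ℝ (u ∘ (extChartAt (𝓡 3) z).symm) a (V.inChart z a)) x
          (W.inChart z x) := by
  rw [W.deriv_inChart (contMDiff_deriv hu hV) hx]
  congr 1
  apply Filter.EventuallyEq.fderiv_eq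
  filter_upwards [(isOpen_extChartAt_target z).mem_nhds hx] with a ha
  exact V.deriv_inChart hu ha

/-- The data of a frame `V₁, V₂, V₃` with `[V₃,V₁] = V₂`, `[V₂,V₃] = V₁ + h V₂` and `[V₁,V₂] = 0`,
where `V₁ h = V₂ h = 0`. -/
structure IsSolvFrame (V₁ V₂ V₃ : VField Y) (h : Y → ℝ) : Prop where
  smooth₁ : SmoothVField V₁
  smooth₂ : SmoothVField V₂
  smooth₃ : SmoothVField V₃
  smooth_h : ContMDiff (𝓡 3) 𝓘(ℝ, ℝ) ∞ h
  linearIndependent : ∀ y, LinearIndependent ℝ ![V₁ y, V₂ y, V₃ y]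
  bracket₃₁ : ∀ y, mlieBracket (𝓡 3) V₃ V₁ y = V₂ y
  bracket₂₃ : ∀ y, mlieBracket (𝓡 3) V₂ V₃ y = V₁ y + h y • V₂ y
  bracket₁₂ : ∀ y, mlieBracket (𝓡 3) V₁ V₂ y = 0
  deriv₁ : ∀ y, V₁.deriv h y = 0
  deriv₂ : ∀ y, V₂.deriv h y = 0

lemma linearIndependent_inChart {V₁ V₂ V₃ : VField Y}
    (hli : ∀ y, LinearIndependent ℝ ![V₁ y, V₂ y, V₃ y])
    (hx : x ∈ (extChartAt (𝓡 3) z).target) :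
    LinearIndependent ℝ ![V₁.inChart z x, V₂.inChart z x, V₃.inChart z x] := by
  refine LinearIndependent.of_comp
    (mfderiv 𝓘(ℝ, EuclideanSpace ℝ (Fin 3)) (𝓡 3) (extChartAt (𝓡 3) z).symm x).toLinearMap ?_
  convert hli ((extChartAt (𝓡 3) z).symm x) using 1
  funext i
  fin_cases i
  exacts [mfderiv_symm_inChart V₁ hx, mfderiv_symm_inChart V₂ hx, mfderiv_symm_inChart V₃ hx]

variable [CompactSpace Y]

/-- The maximum principle along `R` is used twice: for `(u, g) = (I, J)`, and, once `R I = 0` is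
known, for `(-X₂ I, X₁ I)`. Only the frame and its brackets enter, not the contact condition. -/
lemma IsContactCanonicalFrame.structure_functions {lam : OneForm Y} {R X₁ X₂ : VField Y}
    {I J K : Y → ℝ} (hf : IsContactCanonicalFrame lam R X₁ X₂ I J K) (hK : ∀ y, K y = 0) :
    (∀ y, J y = 0) ∧ IsSolvFrame R X₁ X₂ I := by
  have b12 (y : Y) : mlieBracket (𝓡 3) R X₁ y = 0 := by
    rw [hf.bracket_R_X₁, hK, zero_smul]
  have hch (z : Y) {x : EuclideanSpace ℝ (Fin 3)} (hx : x ∈ (extChartAt (𝓡 3) z).target) :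
      lieBracket ℝ (X₂.inChart z) (R.inChart z) x = X₁.inChart z x ∧
      lieBracket ℝ (X₁.inChart z) (X₂.inChart z) x = R.inChart z x
        + (I ∘ (extChartAt (𝓡 3) z).symm) x • X₁.inChart z x
        + (J ∘ (extChartAt (𝓡 3) z).symm) x • X₂.inChart z x ∧
      lieBracket ℝ (R.inChart z) (X₁.inChart z) x = 0 := by
    refine ⟨?_, ?_, ?_⟩
    · rw [lieBracket_inChart hf.smooth_X₂ hf.reeb.smooth hx]
      simp only [hf.bracket_X₂_R]
    · rw [lieBracket_inChart hf.smooth_X₁ hf.smooth_X₂ hx]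
      simp only [hf.bracket_X₁_X₂, VField.inChart, mpullback_apply, map_add, map_smul]
      rfl
    · rw [lieBracket_inChart hf.reeb.smooth hf.smooth_X₁ hx]
      simp only [b12, VField.inChart, mpullback_apply, map_zero]
      rfl
  have hRI : (∀ y, R.deriv I y = J y) ∧ (∀ y, R.deriv J y = 0) := by
    rw [← forall_and]
    intro z
    have hz := mem_extChartAt_target (I := 𝓡 3) z
    have hn := (isOpen_extChartAt_target (I := 𝓡 3) z).mem_nhds hz
    have := fderiv_structureFunctions_of_jacobi (hf.reeb.smooth.contDiffAt_inChart hz)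
      (hf.smooth_X₁.contDiffAt_inChart hz) (hf.smooth_X₂.contDiffAt_inChart hz)
      (contDiffAt_function_inChart hf.smooth_I hz) (contDiffAt_function_inChart hf.smooth_J hz)
      (by filter_upwards [hn] with y hy using (hch z hy).1)
      (by filter_upwards [hn] with y hy using (hch z hy).2.1)
      (by filter_upwards [hn] with y hy using (hch z hy).2.2)
      (linearIndependent_inChart hf.linearIndependent hz)
    rw [← R.deriv_inChart hf.smooth_I hz, ← R.deriv_inChart hf.smooth_J hz] at this
    simpa only [Function.comp, extChartAt_to_inv] using this
  have hJ : ∀ y, J y = 0 := eq_zero_of_derivative_along hf.reeb.smooth hf.smooth_I hf.smooth_J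
    hRI.1 hRI.2
  have hI2 : (∀ y, R.deriv (X₂.deriv I) y = - X₁.deriv I y) ∧
      (∀ y, R.deriv (X₁.deriv I) y = 0) := by
    rw [← forall_and]
    intro z
    have hz := mem_extChartAt_target (I := 𝓡 3) z
    have hn := (isOpen_extChartAt_target (I := 𝓡 3) z).mem_nhds hz
    have := fderiv_fderiv_of_bracket (hf.reeb.smooth.contDiffAt_inChart hz)
      (hf.smooth_X₁.contDiffAt_inChart hz) (hf.smooth_X₂.contDiffAt_inChart hz)
      (contDiffAt_function_inChart hf.smooth_I hz) (hch z hz).1 (hch z hz).2.2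
      (by
        filter_upwards [hn] with y hy
        rw [← R.deriv_inChart hf.smooth_I hy, hRI.1, hJ])
    rw [← X₁.deriv_inChart hf.smooth_I hz, ← deriv_deriv_inChart hf.smooth_I hf.smooth_X₁ hz,
      ← deriv_deriv_inChart hf.smooth_I hf.smooth_X₂ hz] at this
    simpa only [extChartAt_to_inv] using this
  have hXI : ∀ y, X₁.deriv I y = 0 := by
    have s1 := contMDiff_deriv hf.smooth_I hf.smooth_X₁
    have s2 := contMDiff_deriv hf.smooth_I hf.smooth_X₂
    refine eq_zero_of_derivative_along hf.reeb.smooth (u := fun y => - X₂.deriv I y) s2.neg s1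
      (fun y => ?_) hI2.2
    have := ((s2 y).mdifferentiableAt (by simp)).hasMFDerivAt.neg.mfderiv
    have e : (mfderiv (𝓡 3) 𝓘(ℝ, ℝ) (fun y => - X₂.deriv I y) y (R y) : ℝ)
        = - R.deriv (X₂.deriv I) y := by
      erw [this]
      rfl
    refine e.trans ?_
    rw [hI2.1, neg_neg]
  refine ⟨hJ, ⟨hf.reeb.smooth, hf.smooth_X₁, hf.smooth_X₂, hf.smooth_I, hf.linearIndependent,
    hf.bracket_X₂_R, fun y => ?_, b12, fun y => ?_, hXI⟩⟩
  · rw [hf.bracket_X₁_X₂, hJ, zero_smul, add_zero]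
  · rw [hRI.1, hJ]

end Frame

/-! ### Inverse function theorem -/

section InverseFunction

variable {E F : Type*} [NormedAddCommGroup E] [NormedSpace ℝ E] [CompleteSpace E]
  [NormedAddCommGroup F] [NormedSpace ℝ F]

/-- The inverse function theorem, with smoothness of the inverse on the whole target. -/
lemma exists_openPartialHomeomorph_of_contDiffAt {f : E → F} {U : Set E} (hU : IsOpen U)
    (hf : ∀ x ∈ U, ContDiffAt ℝ ∞ f x) {c : E} (hc : c ∈ U) (hinv : (fderiv ℝ f c).IsInvertible) :
    ∃ Φ : OpenPartialHomeomorph E F, (Φ : E → F) = f ∧ c ∈ Φ.source ∧ Φ.source ⊆ U ∧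
      ∀ q ∈ Φ.target, ContDiffAt ℝ ∞ Φ.symm q := by
  -- Restricting to the open set where the derivative stays invertible makes the inverse smooth at
  -- every point of the target, not only at `f c`.
  have hopen : IsOpen (U ∩ fderiv ℝ f ⁻¹' range ((↑) : (E ≃L[ℝ] F) → E →L[ℝ] F)) := by
    refine ContinuousOn.isOpen_inter_preimage (fun x hx => ?_) hU ContinuousLinearEquiv.isOpen
    exact ((hf x hx).fderiv_right (m := 0) (by simp)).continuousAt.continuousWithinAt
  obtain ⟨e, he⟩ := hinv
  have hd : HasFDerivAt f (e : E →L[ℝ] F) c :=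
    he ▸ ((hf c hc).differentiableAt (by simp)).hasFDerivAt
  let Φ₀ := (hf c hc).toOpenPartialHomeomorph f hd (by simp)
  have hΦ₀ : (Φ₀ : E → F) = f := rfl
  have hc₀ : c ∈ Φ₀.source := (hf c hc).mem_toOpenPartialHomeomorph_source hd (by simp)
  refine ⟨Φ₀.restrOpen _ hopen, hΦ₀, ⟨hc₀, hc, e, he⟩, fun x hx => hx.2.1, fun q hq => ?_⟩
  have hq' := (Φ₀.restrOpen _ hopen).map_target hq
  obtain ⟨-, hxU, e', he'⟩ := hq'
  refine OpenPartialHomeomorph.contDiffAt_symm _ hq (f₀' := e') ?_ (hf _ hxU)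
  have := ((hf _ hxU).differentiableAt (by simp)).hasFDerivAt
  rw [← he'] at this
  exact this

end InverseFunction

/-! ### Fundamental solutions of the linear ODE -/

section LinearODE

lemma HasDerivAt.fst' {E F : Type*} [NormedAddCommGroup E] [NormedSpace ℝ E]
    [NormedAddCommGroup F] [NormedSpace ℝ F] {f : ℝ → E × F} {f' : E × F} {t : ℝ}
    (h : HasDerivAt f f' t) : HasDerivAt (fun s => (f s).1) f'.1 t :=
  (ContinuousLinearMap.fst ℝ E F).hasFDerivAt.comp_hasDerivAt t h

lemma HasDerivAt.snd' {E F : Type*} [NormedAddCommGroup E] [NormedSpace ℝ E]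
    [NormedAddCommGroup F] [NormedSpace ℝ F] {f : ℝ → E × F} {f' : E × F} {t : ℝ}
    (h : HasDerivAt f f' t) : HasDerivAt (fun s => (f s).2) f'.2 t :=
  (ContinuousLinearMap.snd ℝ E F).hasFDerivAt.comp_hasDerivAt t h

/-- The vectors `a t` and `b t` are the columns of the matrix solving `A' = A ∘ frameGenerator k`,
`A 0 = id`. They will be the coefficients that close the dual forms of `V₁` and `V₂`. -/
lemma exists_fundamental_solution {k : ℝ → ℝ} {δ : ℝ} (hδ : 0 < δ)
    (hk : ∀ t ∈ Ioo (-δ) δ, ContDiffAt ℝ ∞ k t) :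
    ∃ ε > 0, ε ≤ δ ∧ ∃ a b : ℝ → ℝ × ℝ, a 0 = (1, 0) ∧ b 0 = (0, 1) ∧
      ∀ t ∈ Ioo (-ε) ε, HasDerivAt a (b t) t ∧ HasDerivAt b (-a t - k t • b t) t ∧
        ContDiffAt ℝ ∞ a t ∧ ContDiffAt ℝ ∞ b t := by
  have h0 : (0 : ℝ) ∈ Ioo (-δ) δ := ⟨by linarith, hδ⟩
  -- Time is added as a first coordinate so that the system becomes autonomous; `htime` recovers it.
  let v : ℝ × (ℝ × ℝ) × (ℝ × ℝ) → ℝ × (ℝ × ℝ) × (ℝ × ℝ) :=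
    fun x => (1, x.2.2, -x.2.1 - k x.1 • x.2.2)
  have hv : ContDiffAt ℝ 1 v ((0 : ℝ), ((1 : ℝ), (0 : ℝ)), ((0 : ℝ), (1 : ℝ))) := by
    have : ContDiffAt ℝ 1 (fun x : ℝ × (ℝ × ℝ) × (ℝ × ℝ) => k x.1) (0, (1, 0), (0, 1)) :=
      ContDiffAt.comp (g := k) _ ((hk 0 h0).of_le (by simp)) contDiffAt_fst
    exact contDiffAt_const.prodMk (contDiffAt_snd.snd.prodMk
      (contDiffAt_snd.fst.neg.sub (this.smul contDiffAt_snd.snd)))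
  obtain ⟨α, hα0, ε₁, hε₁, hα⟩ :=
    hv.exists_forall_mem_closedBall_exists_eq_forall_mem_Ioo_hasDerivAt₀ (0 : ℝ)
  simp only [zero_sub, zero_add] at hα
  have htime : ∀ t ∈ Ioo (-ε₁) ε₁, (α t).1 = t := by
    intro t ht
    have hd : ∀ s ∈ Ioo (-ε₁) ε₁, HasDerivAt (fun s => (α s).1 - s) 0 s := fun s hs => by
      have := (hα s hs).fst'.sub (hasDerivAt_id' s)
      rw [show (v (α s)).1 - 1 = 0 from sub_self _] at this
      exact this
    have := (convex_Ioo (-ε₁) ε₁).is_const_of_fderivWithin_eq_zero (𝕜 := ℝ)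
      (fun s hs => (hd s hs).differentiableAt.differentiableWithinAt)
      (fun s hs => by
        rw [fderivWithin_of_isOpen isOpen_Ioo hs, (hd s hs).hasFDerivAt.fderiv]
        ext; simp) ht (⟨by linarith, hε₁⟩ : (0 : ℝ) ∈ Ioo (-ε₁) ε₁)
    simp only [hα0, sub_zero] at this
    linarith
  -- Halving puts the closed interval `[-ε, ε]` inside both open intervals, as the smoothness
  -- theorem for solutions needs.
  set ε := min ε₁ δ / 2 with hε
  have hεpos : 0 < ε := by positivity
  have hε1 : ε < ε₁ := by have := min_le_left ε₁ δ; have := lt_min hε₁ hδ; linarith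
  have hε2 : ε < δ := by have := min_le_right ε₁ δ; have := lt_min hε₁ hδ; linarith
  have hsub : ∀ t ∈ Icc (-ε) ε, t ∈ Ioo (-ε₁) ε₁ := fun t ht => ⟨by linarith [ht.1], by linarith [ht.2]⟩
  have hsub' : ∀ t ∈ Icc (-ε) ε, t ∈ Ioo (-δ) δ := fun t ht => ⟨by linarith [ht.1], by linarith [ht.2]⟩
  have hsol : ∀ t ∈ Icc (-ε) ε, HasDerivAt (fun t => (α t).2)
      ((α t).2.2, -(α t).2.1 - k t • (α t).2.2) t := by
    intro t ht
    have := (hα t (hsub t ht)).snd'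
    simpa [v, htime t (hsub t ht)] using this
  have hsmooth : ContDiffOn ℝ ∞ (fun t => (α t).2) (Icc (-ε) ε) := by
    have := ODE.contDiffOn_enat_Icc_of_hasDerivWithinAt (n := ⊤) (u := univ)
      (f := fun t (y : (ℝ × ℝ) × (ℝ × ℝ)) => (y.2, -y.1 - k t • y.2)) (tmin := -ε) (tmax := ε)
      (α := fun t => (α t).2) ?_ (fun t ht => (hsol t ht).hasDerivWithinAt) (mapsTo_univ _ _)
    · exact this
    · rintro ⟨t, y⟩ ⟨ht, -⟩
      have : ContDiffAt ℝ ∞ (fun x : ℝ × (ℝ × ℝ) × (ℝ × ℝ) => k x.1) (t, y) :=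
        (hk t (hsub' t ht)).comp _ contDiffAt_fst
      exact (contDiffAt_snd.snd.prodMk
        (contDiffAt_snd.fst.neg.sub (this.smul contDiffAt_snd.snd))).contDiffWithinAt
  refine ⟨ε, hεpos, hε2.le, fun t => (α t).2.1, fun t => (α t).2.2, by simp [hα0], by simp [hα0],
    fun t ht => ?_⟩
  have ht' := Ioo_subset_Icc_self ht
  have hs : ContDiffAt ℝ ∞ (fun t => (α t).2) t :=
    (hsmooth t ht').contDiffAt (Icc_mem_nhds ht.1 ht.2)
  exact ⟨(hsol t ht').fst', (hsol t ht').snd',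
    hs.fst, hs.snd⟩

end LinearODE

/-! ### Frames, dual forms and closedness -/

section Coframe

variable {E F : Type*} [NormedAddCommGroup E] [NormedSpace ℝ E]
  [NormedAddCommGroup F] [NormedSpace ℝ F]

/-- Cartan's formula for the exterior derivative of a 1-form on two vector fields. -/
lemma fderiv_oneForm_sub_swap {η : E → E →L[ℝ] F} {V W : E → E} {x : E}
    (hη : DifferentiableAt ℝ η x) (hV : DifferentiableAt ℝ V x) (hW : DifferentiableAt ℝ W x) :
    fderiv ℝ η x (V x) (W x) - fderiv ℝ η x (W x) (V x)
      = fderiv ℝ (fun y => η y (W y)) x (V x) - fderiv ℝ (fun y => η y (V y)) x (W x)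
        - η x (lieBracket ℝ V W x) := by
  rw [(hη.hasFDerivAt.clm_apply hW.hasFDerivAt).fderiv,
    (hη.hasFDerivAt.clm_apply hV.hasFDerivAt).fderiv, lieBracket_eq]
  simp
  abel

/-- The linear map `((p, q), r) ↦ p u + q v + r w`. -/
def frameMap (u v w : E) : (ℝ × ℝ) × ℝ →L[ℝ] E :=
  ((ContinuousLinearMap.fst ℝ ℝ ℝ).comp (ContinuousLinearMap.fst ℝ (ℝ × ℝ) ℝ)).smulRight u
    + ((ContinuousLinearMap.snd ℝ ℝ ℝ).comp (ContinuousLinearMap.fst ℝ (ℝ × ℝ) ℝ)).smulRight v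
    + (ContinuousLinearMap.snd ℝ (ℝ × ℝ) ℝ).smulRight w

@[simp] lemma frameMap_apply (u v w : E) (c : (ℝ × ℝ) × ℝ) :
    frameMap u v w c = c.1.1 • u + c.1.2 • v + c.2 • w := rfl

lemma ContDiffAt.frameMap {u v w : E → E} {x : E} (hu : ContDiffAt ℝ ∞ u x)
    (hv : ContDiffAt ℝ ∞ v x) (hw : ContDiffAt ℝ ∞ w x) :
    ContDiffAt ℝ ∞ (fun y => _root_.frameMap (u y) (v y) (w y)) x :=
  ((contDiffAt_const.smulRight hu).add (contDiffAt_const.smulRight hv)).add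
    (contDiffAt_const.smulRight hw)

lemma isInvertible_frameMap [FiniteDimensional ℝ E] (hE : Module.finrank ℝ E = 3) {u v w : E}
    (h : LinearIndependent ℝ ![u, v, w]) : (frameMap u v w).IsInvertible := by
  have hinj : Function.Injective (frameMap u v w : (ℝ × ℝ) × ℝ →ₗ[ℝ] E) := by
    rw [← LinearMap.ker_eq_bot, LinearMap.ker_eq_bot']
    rintro ⟨⟨p, q⟩, r⟩ hc
    have := Fintype.linearIndependent_iff.mp h ![p, q, r]
      (by simpa [Fin.sum_univ_three] using hc)
    have h0 := this 0
    have h1 := this 1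
    have h2 := this 2
    simp at h0 h1 h2
    simp [h0, h1, h2]
  have hdim : Module.finrank ℝ ((ℝ × ℝ) × ℝ) = Module.finrank ℝ E := by simp [hE]
  refine ⟨(LinearEquiv.ofInjectiveOfFinrankEq (frameMap u v w : (ℝ × ℝ) × ℝ →ₗ[ℝ] E) hinj
    hdim).toContinuousLinearEquiv, ?_⟩
  exact ContinuousLinearMap.ext fun x => rfl

/-- A 1-form is closed as soon as its exterior derivative vanishes on pairs from a frame. -/
lemma symmetric_of_frame {B : E →L[ℝ] E →L[ℝ] F} {u v w : E}
    (hinv : (frameMap u v w).IsInvertible) (h1 : B u v = B v u) (h2 : B w u = B u w)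
    (h3 : B v w = B w v) (x y : E) : B x y = B y x := by
  obtain ⟨e, he⟩ := hinv
  have hx (x : E) : ∃ c, frameMap u v w c = x := ⟨e.symm x, by rw [← he]; simp⟩
  obtain ⟨c, rfl⟩ := hx x
  obtain ⟨d, rfl⟩ := hx y
  simp only [frameMap_apply, map_add, map_smul, add_apply, smul_apply, h1, h2, h3]
  module

end Coframe

/-! ### Local normal form of the frame -/

section LocalModel

variable {E F : Type*} [NormedAddCommGroup E] [NormedSpace ℝ E]
  [NormedAddCommGroup F] [NormedSpace ℝ F]

/-- The Poincaré lemma on a convex ball. The primitive is smooth because its derivative is the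
smooth form `η`. -/
lemma exists_smooth_primitive [CompleteSpace F] {η : E → E →L[ℝ] F} {c : E} {r : ℝ}
    (hη : ∀ x ∈ Metric.ball c r, ContDiffAt ℝ ∞ η x)
    (hs : ∀ x ∈ Metric.ball c r, ∀ u v, fderiv ℝ η x u v = fderiv ℝ η x v u) :
    ∃ f : E → F, f c = 0 ∧ ∀ x ∈ Metric.ball c r, HasFDerivAt f (η x) x ∧ ContDiffAt ℝ ∞ f x := by
  obtain ⟨f, hf⟩ := (convex_ball c r).exists_forall_hasFDerivAt_of_fderiv_symmetric
    Metric.isOpen_ball (fun x hx => ((hη x hx).differentiableAt (by simp)).differentiableWithinAt) hs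
  have hf' : ∀ x ∈ Metric.ball c r, HasFDerivAt (fun y => f y - f c) (η x) x :=
    fun x hx => (hf x hx).sub_const _
  have hsm : ContDiffOn ℝ ∞ (fun y => f y - f c) (Metric.ball c r) := by
    rw [contDiffOn_infty_iff_fderiv_of_isOpen Metric.isOpen_ball]
    refine ⟨fun x hx => (hf' x hx).differentiableAt.differentiableWithinAt, ?_⟩
    exact ContDiffOn.congr (fun x hx => (hη x hx).contDiffWithinAt) fun x hx => (hf' x hx).fderiv
  exact ⟨fun y => f y - f c, sub_self _, fun x hx =>
    ⟨hf' x hx, hsm.contDiffAt (Metric.isOpen_ball.mem_nhds hx)⟩⟩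

/-- The generator of the linear ODE satisfied by the frame `V₁, V₂` along `V₃`. -/
def frameGenerator (i : ℝ) : ℝ × ℝ →L[ℝ] ℝ × ℝ :=
  (-ContinuousLinearMap.snd ℝ ℝ ℝ).prod
    (ContinuousLinearMap.fst ℝ ℝ ℝ - i • ContinuousLinearMap.snd ℝ ℝ ℝ)

@[simp] lemma frameGenerator_apply (i : ℝ) (u : ℝ × ℝ) :
    frameGenerator i u = (-u.2, u.1 - i * u.2) := rfl

variable [FiniteDimensional ℝ E] {V₁ V₂ V₃ : E → E} {h : E → ℝ} {U : Set E}

/-- A function annihilated by `V₁, V₂` is locally a function of a primitive of the dual form of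
`V₃`. -/
lemma exists_factorization_through_primitive (hE : Module.finrank ℝ E = 3)
    {c : E} {r : ℝ} (hr : 0 < r) {f : E → ℝ} (hfc : f c = 0)
    (hf : ∀ x ∈ Metric.ball c r, ContDiffAt ℝ ∞ f x)
    (hf₁ : ∀ x ∈ Metric.ball c r, fderiv ℝ f x (V₁ x) = 0)
    (hf₂ : ∀ x ∈ Metric.ball c r, fderiv ℝ f x (V₂ x) = 0)
    (hf₃ : ∀ x ∈ Metric.ball c r, fderiv ℝ f x (V₃ x) = 1)
    (hh : ∀ x ∈ Metric.ball c r, ContDiffAt ℝ ∞ h x)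
    (hh₁ : ∀ x ∈ Metric.ball c r, fderiv ℝ h x (V₁ x) = 0)
    (hh₂ : ∀ x ∈ Metric.ball c r, fderiv ℝ h x (V₂ x) = 0)
    (hli : ∀ x ∈ Metric.ball c r, LinearIndependent ℝ ![V₁ x, V₂ x, V₃ x]) :
    ∃ δ > 0, ∃ k : ℝ → ℝ, (∀ t ∈ Ioo (-δ) δ, ContDiffAt ℝ ∞ k t) ∧
      ∀ᶠ x in 𝓝 c, f x ∈ Ioo (-δ) δ ∧ h x = k (f x) := by
  have hcB : c ∈ Metric.ball c r := Metric.mem_ball_self hr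
  obtain ⟨e, he⟩ := isInvertible_frameMap hE (hli c hcB)
  -- Coordinates with `f` last; the first two come from the coframe frozen at `c`, so that the
  -- derivative of `H` at `c` is exactly `e.symm`.
  let H : E → (ℝ × ℝ) × ℝ := fun x => ((e.symm (x - c)).1, f x)
  have hH : ∀ x ∈ Metric.ball c r, ContDiffAt ℝ ∞ H x := fun x hx =>
    ContDiffAt.prodMk (contDiff_fst.contDiffAt.comp x
      (e.symm.contDiff.contDiffAt.comp x (contDiffAt_id.sub contDiffAt_const))) (hf x hx)
  have hHd : ∀ x ∈ Metric.ball c r, ∀ v, fderiv ℝ H x v = ((e.symm v).1, fderiv ℝ f x v) := by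
    intro x hx v
    have h1 : HasFDerivAt (fun x => (e.symm (x - c)).1)
        ((ContinuousLinearMap.fst ℝ (ℝ × ℝ) ℝ).comp (e.symm : E →L[ℝ] (ℝ × ℝ) × ℝ)) x :=
      ((ContinuousLinearMap.fst ℝ (ℝ × ℝ) ℝ).comp
        (e.symm : E →L[ℝ] (ℝ × ℝ) × ℝ)).hasFDerivAt.comp x ((hasFDerivAt_id x).sub_const c)
    rw [(h1.prodMk ((hf x hx).differentiableAt (by simp)).hasFDerivAt).fderiv]
    rfl
  have hHc : fderiv ℝ H c = e.symm := by
    ext1 v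
    rw [hHd c hcB]
    obtain ⟨w, rfl⟩ := e.surjective v
    have : e w = frameMap (V₁ c) (V₂ c) (V₃ c) w := by rw [← he]; rfl
    ext : 1
    · simp
    · simp only [ContinuousLinearEquiv.coe_coe, ContinuousLinearEquiv.symm_apply_apply]
      rw [this, frameMap_apply]
      simp [hf₁ c hcB, hf₂ c hcB, hf₃ c hcB]
  obtain ⟨Φ, hΦ, hcΦ, hΦB, hΦs⟩ := exists_openPartialHomeomorph_of_contDiffAt Metric.isOpen_ball hH
    hcB ⟨e.symm, hHc.symm⟩
  have hΦc : Φ c = 0 := by rw [hΦ]; simp [H, hfc]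
  obtain ⟨δ, hδ, hball⟩ := Metric.isOpen_iff.mp Φ.open_target 0 (hΦc ▸ Φ.map_source hcΦ)
  have hmem (w : ℝ × ℝ) (t : ℝ) : (w, t) ∈ Metric.ball (0 : (ℝ × ℝ) × ℝ) δ ↔
      w ∈ Metric.ball (0 : ℝ × ℝ) δ ∧ t ∈ Ioo (-δ) δ := by
    simp [Prod.norm_def, abs_lt]
  -- A direction tangent to a level set of `f` is a combination of `V₁` and `V₂`, and both
  -- annihilate `h`.
  have hd : ∀ q ∈ Φ.target, ∀ w : ℝ × ℝ, fderiv ℝ (h ∘ Φ.symm) q (w, 0) = 0 := by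
    intro q hq w
    have hx : Φ.symm q ∈ Φ.source := Φ.map_target hq
    have hxB := hΦB hx
    rw [fderiv_comp q ((hh _ hxB).differentiableAt (by simp)) ((hΦs q hq).differentiableAt (by simp))]
    set v := fderiv ℝ Φ.symm q (w, 0) with hv
    have hHv : fderiv ℝ H (Φ.symm q) v = (w, 0) := by
      have hid : (H ∘ Φ.symm) =ᶠ[𝓝 q] (id : (ℝ × ℝ) × ℝ → (ℝ × ℝ) × ℝ) := by
        filter_upwards [Φ.open_target.mem_nhds hq] with p hp
        rw [← hΦ]; exact Φ.right_inv hp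
      have := hid.fderiv_eq (𝕜 := ℝ)
      rw [fderiv_comp q ((hH _ hxB).differentiableAt (by simp))
        ((hΦs q hq).differentiableAt (by simp)), fderiv_id] at this
      exact DFunLike.congr_fun this (w, 0)
    rw [hHd _ hxB] at hHv
    have hfv : fderiv ℝ f (Φ.symm q) v = 0 := (Prod.ext_iff.mp hHv).2
    obtain ⟨e', he'⟩ := isInvertible_frameMap hE (hli _ hxB)
    obtain ⟨d, hd⟩ : ∃ d : (ℝ × ℝ) × ℝ, frameMap (V₁ (Φ.symm q)) (V₂ (Φ.symm q)) (V₃ (Φ.symm q)) d = v :=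
      ⟨e'.symm v, by rw [← he']; simp⟩
    rw [← hd, frameMap_apply] at hfv
    simp only [map_add, map_smul, hf₁ _ hxB, hf₂ _ hxB, hf₃ _ hxB, smul_eq_mul, mul_zero, zero_add,
      mul_one] at hfv
    show fderiv ℝ h (Φ.symm q) v = 0
    rw [← hd, frameMap_apply]
    simp [hh₁ _ hxB, hh₂ _ hxB, hfv]
  refine ⟨δ, hδ, fun t => h (Φ.symm (0, t)), fun t ht => ?_, ?_⟩
  · have hq : ((0 : ℝ × ℝ), t) ∈ Φ.target := hball ((hmem _ _).mpr ⟨Metric.mem_ball_self hδ, ht⟩)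
    exact (hh _ (hΦB (Φ.map_target hq))).comp t ((hΦs _ hq).comp t
      (contDiffAt_const.prodMk contDiffAt_id))
  · have hn : Φ.source ∩ Φ ⁻¹' Metric.ball 0 δ ∈ 𝓝 c :=
      (Φ.isOpen_inter_preimage Metric.isOpen_ball).mem_nhds
        ⟨hcΦ, by rw [mem_preimage, hΦc]; exact Metric.mem_ball_self hδ⟩
    filter_upwards [hn] with x hx
    have hΦx : Φ x = ((e.symm (x - c)).1, f x) := by rw [hΦ]
    have hb := hx.2
    rw [mem_preimage, hΦx, hmem] at hb
    refine ⟨hb.2, ?_⟩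
    have hconst := (convex_ball (0 : ℝ × ℝ) δ).is_const_of_fderivWithin_eq_zero (𝕜 := ℝ)
      (f := fun w => h (Φ.symm (w, f x))) (x := (e.symm (x - c)).1) (y := 0)
      (fun w hw => ?_) (fun w hw => ?_) hb.1 (Metric.mem_ball_self hδ)
    · rw [← hconst, ← hΦx, Φ.left_inv hx.1]
    · have hq := hball ((hmem w (f x)).mpr ⟨hw, hb.2⟩)
      exact (((hh _ (hΦB (Φ.map_target hq))).comp w ((hΦs _ hq).comp w
        (contDiffAt_id.prodMk contDiffAt_const))).differentiableAt (by simp)).differentiableWithinAt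
    · have hq := hball ((hmem w (f x)).mpr ⟨hw, hb.2⟩)
      rw [fderivWithin_of_isOpen Metric.isOpen_ball hw]
      have h1 : HasFDerivAt (h ∘ Φ.symm) (fderiv ℝ (h ∘ Φ.symm) (w, f x)) (w, f x) :=
        (((hh _ (hΦB (Φ.map_target hq))).comp _ (hΦs _ hq)).differentiableAt (by simp)).hasFDerivAt
      have h2 := HasFDerivAt.comp (f := fun w => (w, f x)) w h1 (hasFDerivAt_prodMk_left w (f x))
      rw [show (fun w => h (Φ.symm (w, f x))) = (h ∘ Φ.symm) ∘ fun w => (w, f x) from rfl, h2.fderiv]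
      exact ContinuousLinearMap.ext fun v => hd _ hq v

/-- Local normal form of a frame with `[V₃,V₁] = V₂`, `[V₂,V₃] = V₁ + h V₂`, `[V₁,V₂] = 0` and
`V₁ h = V₂ h = 0`. -/
lemma exists_normal_form (hE : Module.finrank ℝ E = 3) (hU : IsOpen U)
    (hV₁ : ∀ x ∈ U, ContDiffAt ℝ ∞ V₁ x) (hV₂ : ∀ x ∈ U, ContDiffAt ℝ ∞ V₂ x)
    (hV₃ : ∀ x ∈ U, ContDiffAt ℝ ∞ V₃ x) (hh : ∀ x ∈ U, ContDiffAt ℝ ∞ h x)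
    (h31 : ∀ x ∈ U, lieBracket ℝ V₃ V₁ x = V₂ x)
    (h23 : ∀ x ∈ U, lieBracket ℝ V₂ V₃ x = V₁ x + h x • V₂ x)
    (h12 : ∀ x ∈ U, lieBracket ℝ V₁ V₂ x = 0)
    (hh₁ : ∀ x ∈ U, fderiv ℝ h x (V₁ x) = 0) (hh₂ : ∀ x ∈ U, fderiv ℝ h x (V₂ x) = 0)
    (hli : ∀ x ∈ U, LinearIndependent ℝ ![V₁ x, V₂ x, V₃ x]) {c : E} (hc : c ∈ U) :
    ∃ (Ψ : OpenPartialHomeomorph E ((ℝ × ℝ) × ℝ)) (A : ℝ → (ℝ × ℝ →L[ℝ] ℝ × ℝ)),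
      c ∈ Ψ.source ∧ Ψ.source ⊆ U ∧ Ψ c = 0 ∧ (∀ x ∈ Ψ.source, ContDiffAt ℝ ∞ Ψ x) ∧
      (∀ q ∈ Ψ.target, ContDiffAt ℝ ∞ Ψ.symm q) ∧ A 0 = ContinuousLinearMap.id ℝ _ ∧
      HasDerivAt A (frameGenerator (h c)) 0 ∧
      ∀ x ∈ Ψ.source, (∀ u : ℝ × ℝ, fderiv ℝ Ψ x (u.1 • V₁ x + u.2 • V₂ x) = (A (Ψ x).2 u, 0)) ∧
        fderiv ℝ Ψ x (V₃ x) = (0, 1) := by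
  obtain ⟨r, hr, hrU⟩ := Metric.isOpen_iff.mp hU c hc
  let ϑ : E → E →L[ℝ] (ℝ × ℝ) × ℝ := fun x => (frameMap (V₁ x) (V₂ x) (V₃ x)).inverse
  have hinv : ∀ x ∈ U, (frameMap (V₁ x) (V₂ x) (V₃ x)).IsInvertible :=
    fun x hx => isInvertible_frameMap hE (hli x hx)
  have hϑs : ∀ x ∈ U, ContDiffAt ℝ ∞ ϑ x := by
    intro x hx
    obtain ⟨e, he⟩ := hinv x hx
    have h1 := contDiffAt_map_inverse (𝕜 := ℝ) (n := ∞) e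
    rw [he] at h1
    exact h1.comp x ((hV₁ x hx).frameMap (hV₂ x hx) (hV₃ x hx))
  have hϑ : ∀ x ∈ U, ∀ d, ϑ x (d.1.1 • V₁ x + d.1.2 • V₂ x + d.2 • V₃ x) = d := by
    intro x hx d
    obtain ⟨e, he⟩ := hinv x hx
    have : ϑ x = e.symm := by
      simp only [ϑ, ← he, ContinuousLinearMap.inverse_equiv]
    rw [this, ← frameMap_apply, ← he]
    exact e.symm_apply_apply d
  have hϑ₁ : ∀ x ∈ U, ϑ x (V₁ x) = ((1, 0), 0) := fun x hx => by
    simpa using hϑ x hx ((1, 0), 0)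
  have hϑ₂ : ∀ x ∈ U, ϑ x (V₂ x) = ((0, 1), 0) := fun x hx => by
    simpa using hϑ x hx ((0, 1), 0)
  have hϑ₃ : ∀ x ∈ U, ϑ x (V₃ x) = ((0, 0), 1) := fun x hx => by
    simpa using hϑ x hx ((0, 0), 1)
  -- Closedness of a form tested on the three pairs of frame fields through Cartan's formula, with
  -- the brackets already inserted.
  have closed {G : Type} [NormedAddCommGroup G] [NormedSpace ℝ G] {η : E → E →L[ℝ] G} {x : E}
      (hx : x ∈ U) (hη : DifferentiableAt ℝ η x)
      (e12 : fderiv ℝ (fun y => η y (V₂ y)) x (V₁ x) = fderiv ℝ (fun y => η y (V₁ y)) x (V₂ x))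
      (e31 : fderiv ℝ (fun y => η y (V₁ y)) x (V₃ x) - fderiv ℝ (fun y => η y (V₃ y)) x (V₁ x)
        = η x (V₂ x))
      (e23 : fderiv ℝ (fun y => η y (V₃ y)) x (V₂ x) - fderiv ℝ (fun y => η y (V₂ y)) x (V₃ x)
        = η x (V₁ x + h x • V₂ x)) (u v : E) :
      fderiv ℝ η x u v = fderiv ℝ η x v u := by
    have d1 := (hV₁ x hx).differentiableAt (by simp)
    have d2 := (hV₂ x hx).differentiableAt (by simp)
    have d3 := (hV₃ x hx).differentiableAt (by simp)
    refine symmetric_of_frame (hinv x hx) ?_ ?_ ?_ u v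
    · rw [← sub_eq_zero, fderiv_oneForm_sub_swap hη d1 d2, h12 x hx, e12]; simp
    · rw [← sub_eq_zero, fderiv_oneForm_sub_swap hη d3 d1, h31 x hx, e31, sub_self]
    · rw [← sub_eq_zero, fderiv_oneForm_sub_swap hη d2 d3, h23 x hx, e23, sub_self]
  have fconst {G : Type} [NormedAddCommGroup G] [NormedSpace ℝ G] {g : E → G} {b : G} {x : E}
      (hx : x ∈ U) (hg : ∀ y ∈ U, g y = b) : fderiv ℝ g x = 0 := by
    have : g =ᶠ[𝓝 x] fun _ => b := by
      filter_upwards [hU.mem_nhds hx] with y hy using hg y hy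
    rw [this.fderiv_eq]; simp
  let β : E → E →L[ℝ] ℝ := fun x => (ContinuousLinearMap.snd ℝ (ℝ × ℝ) ℝ).comp (ϑ x)
  have hβs : ∀ x ∈ U, ContDiffAt ℝ ∞ β x := fun x hx => contDiffAt_const.clm_comp (hϑs x hx)
  have hβ₁ : ∀ x ∈ U, β x (V₁ x) = 0 := fun x hx => by simp [β, hϑ₁ x hx]
  have hβ₂ : ∀ x ∈ U, β x (V₂ x) = 0 := fun x hx => by simp [β, hϑ₂ x hx]
  have hβ₃ : ∀ x ∈ U, β x (V₃ x) = 1 := fun x hx => by simp [β, hϑ₃ x hx]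
  -- `β` is closed because it is constant on the frame and no bracket has a `V₃`-component.
  obtain ⟨f, hfc, hf⟩ := exists_smooth_primitive (fun x hx => hβs x (hrU hx)) fun x hx =>
    closed (hrU hx) ((hβs x (hrU hx)).differentiableAt (by simp))
      (by rw [fconst (hrU hx) hβ₂, fconst (hrU hx) hβ₁]; simp)
      (by rw [fconst (hrU hx) hβ₁, fconst (hrU hx) hβ₃, hβ₂ x (hrU hx)]; simp)
      (by rw [fconst (hrU hx) hβ₃, fconst (hrU hx) hβ₂, map_add, map_smul, hβ₁ x (hrU hx),
        hβ₂ x (hrU hx)]; simp)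
  obtain ⟨δ, hδ, k, hk, hhk⟩ := exists_factorization_through_primitive (V₁ := V₁) (V₂ := V₂)
    (V₃ := V₃) (h := h) hE hr hfc (fun x hx => (hf x hx).2)
    (fun x hx => by rw [(hf x hx).1.fderiv, hβ₁ x (hrU hx)])
    (fun x hx => by rw [(hf x hx).1.fderiv, hβ₂ x (hrU hx)])
    (fun x hx => by rw [(hf x hx).1.fderiv, hβ₃ x (hrU hx)])
    (fun x hx => hh x (hrU hx)) (fun x hx => hh₁ x (hrU hx)) (fun x hx => hh₂ x (hrU hx))
    (fun x hx => hli x (hrU hx))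
  obtain ⟨ε, hε, hεδ, a, b, ha0, hb0, hab⟩ := exists_fundamental_solution hδ hk
  let A : ℝ → (ℝ × ℝ →L[ℝ] ℝ × ℝ) := fun t =>
    (ContinuousLinearMap.fst ℝ ℝ ℝ).smulRight (a t) + (ContinuousLinearMap.snd ℝ ℝ ℝ).smulRight (b t)
  have hAu (t : ℝ) (u : ℝ × ℝ) : A t u = u.1 • a t + u.2 • b t := rfl
  have hAs : ∀ t ∈ Ioo (-ε) ε, ContDiffAt ℝ ∞ A t := fun t ht =>
    (contDiffAt_const.smulRight (hab t ht).2.2.1).add (contDiffAt_const.smulRight (hab t ht).2.2.2)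
  have hfn : ∀ᶠ x in 𝓝 c, f x ∈ Ioo (-ε) ε := by
    have hcont : ContinuousAt f c := (hf c (Metric.mem_ball_self hr)).2.continuousAt
    refine hcont.eventually ?_
    rw [hfc]
    exact Ioo_mem_nhds (by linarith) hε
  obtain ⟨r', hr', hball⟩ := Metric.eventually_nhds_iff_ball.mp
    ((hfn.and hhk).and (Metric.ball_mem_nhds c hr))
  -- A plane-valued form, equal to `a(f)` on `V₁`, `b(f)` on `V₂` and `0` on `V₃`.
  let ξ : E → E →L[ℝ] ℝ × ℝ := fun x =>
    (A (f x)).comp ((ContinuousLinearMap.fst ℝ (ℝ × ℝ) ℝ).comp (ϑ x))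
  have hξs : ∀ x ∈ Metric.ball c r', ContDiffAt ℝ ∞ ξ x := fun x hx =>
    ((hAs _ (hball x hx).1.1).comp x (hf x (hball x hx).2).2).clm_comp
      (contDiffAt_const.clm_comp (hϑs x (hrU (hball x hx).2)))
  have hξ₁ : ∀ x ∈ U, ξ x (V₁ x) = a (f x) := fun x hx => by simp [ξ, hϑ₁ x hx, hAu]
  have hξ₂ : ∀ x ∈ U, ξ x (V₂ x) = b (f x) := fun x hx => by simp [ξ, hϑ₂ x hx, hAu]
  have hξ₃ : ∀ x ∈ U, ξ x (V₃ x) = 0 := fun x hx => by simp [ξ, hϑ₃ x hx, hAu]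
  have dcomp {g : ℝ → ℝ × ℝ} {g' : ℝ × ℝ} {x v : E} (hx : x ∈ Metric.ball c r')
      (hg : HasDerivAt g g' (f x)) {q : E → ℝ × ℝ} (hq : ∀ y ∈ U, q y = g (f y)) :
      fderiv ℝ q x v = β x v • g' := by
    have e : q =ᶠ[𝓝 x] g ∘ f := by
      filter_upwards [hU.mem_nhds (hrU (hball x hx).2)] with y hy using hq y hy
    rw [e.fderiv_eq, (hg.hasFDerivAt.comp x (hf x (hball x hx).2).1).fderiv]
    simp
  -- Closedness of `ξ` is the ODE: on `(V₃, V₁)` it says `a' = b`, and on `(V₂, V₃)` it says `-b' =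
  -- a + k b`. On `(V₁, V₂)` it holds because `f` is constant along both fields.
  obtain ⟨g, hgc, hg⟩ := exists_smooth_primitive hξs fun x hx =>
    closed (hrU (hball x hx).2) ((hξs x hx).differentiableAt (by simp))
      (by
        have hxU := hrU (hball x hx).2
        have hd := hab _ (hball x hx).1.1
        rw [dcomp hx hd.2.1 hξ₂, dcomp hx hd.1 hξ₁, hβ₁ x hxU, hβ₂ x hxU, zero_smul, zero_smul])
      (by
        have hxU := hrU (hball x hx).2
        have hd := hab _ (hball x hx).1.1
        rw [dcomp hx hd.1 hξ₁, fconst hxU hξ₃, hβ₃ x hxU, hξ₂ x hxU]; simp)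
      (by
        have hxU := hrU (hball x hx).2
        have hd := hab _ (hball x hx).1.1
        rw [dcomp hx hd.2.1 hξ₂, fconst hxU hξ₃, hβ₃ x hxU, map_add, map_smul, hξ₁ x hxU,
          hξ₂ x hxU, (hball x hx).1.2.2]
        simp only [zero_apply, one_smul]
        abel)
  let Ψ₀ : E → (ℝ × ℝ) × ℝ := fun x => (g x, f x)
  have hA0 : A 0 = ContinuousLinearMap.id ℝ _ := by
    refine ContinuousLinearMap.ext fun u => ?_
    simp [hAu, ha0, hb0]
  have hΨ₀s : ∀ x ∈ Metric.ball c r', ContDiffAt ℝ ∞ Ψ₀ x := fun x hx =>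
    (hg x hx).2.prodMk (hf x (hball x hx).2).2
  have hΨ₀d : ∀ x ∈ Metric.ball c r', ∀ v, fderiv ℝ Ψ₀ x v = (A (f x) (ϑ x v).1, (ϑ x v).2) := by
    intro x hx v
    rw [((hg x hx).1.prodMk (hf x (hball x hx).2).1).fderiv]
    rfl
  have hcr' : c ∈ Metric.ball c r' := Metric.mem_ball_self hr'
  obtain ⟨Ψ, hΨ, hcΨ, hΨB, hΨs⟩ := exists_openPartialHomeomorph_of_contDiffAt Metric.isOpen_ball
    hΨ₀s hcr' (by
      obtain ⟨e, he⟩ := hinv c hc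
      refine ⟨e.symm, ?_⟩
      ext1 v
      rw [hΨ₀d c hcr', hfc, hA0]
      simp only [ϑ, ← he, ContinuousLinearMap.inverse_equiv]
      rfl)
  have hcB : c ∈ Metric.ball c r := Metric.mem_ball_self hr
  refine ⟨Ψ, A, hcΨ, fun x hx => hrU (hball x (hΨB hx)).2, by rw [hΨ]; simp [Ψ₀, hgc, hfc],
    fun x hx => by rw [hΨ]; exact hΨ₀s x (hΨB hx), hΨs, hA0, ?_, fun x hx => ⟨fun u => ?_, ?_⟩⟩
  · have h0 : (0 : ℝ) ∈ Ioo (-ε) ε := ⟨by linarith, hε⟩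
    have hA' : HasDerivAt A ((ContinuousLinearMap.fst ℝ ℝ ℝ).smulRight (b 0)
        + (ContinuousLinearMap.snd ℝ ℝ ℝ).smulRight (-a 0 - k 0 • b 0)) 0 :=
      ((ContinuousLinearMap.smulRightL ℝ (ℝ × ℝ) (ℝ × ℝ)
          (ContinuousLinearMap.fst ℝ ℝ ℝ)).hasFDerivAt.comp_hasDerivAt 0 (hab 0 h0).1).add
        ((ContinuousLinearMap.smulRightL ℝ (ℝ × ℝ) (ℝ × ℝ)
          (ContinuousLinearMap.snd ℝ ℝ ℝ)).hasFDerivAt.comp_hasDerivAt 0 (hab 0 h0).2.1)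
    convert hA' using 1
    have hk0 : h c = k 0 := by rw [(hball c hcr').1.2.2, hfc]
    refine ContinuousLinearMap.ext fun u => ?_
    simp [ha0, hb0, hk0]
    ring
  · rw [hΨ, hΨ₀d x (hΨB hx)]
    have := hϑ x (hrU (hball x (hΨB hx)).2) (u, 0)
    simp only [zero_smul, add_zero] at this
    rw [this]
  · rw [hΨ, hΨ₀d x (hΨB hx), hϑ₃ x (hrU (hball x (hΨB hx)).2)]
    ext : 1
    · exact map_zero (A (f x))
    · rfl

end LocalModel

/-! ### The normal form transported to the manifold -/

section ModelChart

variable {Y : Type*} [TopologicalSpace Y] [ChartedSpace (EuclideanSpace ℝ (Fin 3)) Y]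
  [IsManifold (𝓡 3) ∞ Y]

/-- The constant coefficient combination of two vector fields. -/
def VField.comb (V₁ V₂ : VField Y) (u : ℝ × ℝ) : VField Y := fun y => u.1 • V₁ y + u.2 • V₂ y

lemma SmoothVField.comb {V₁ V₂ : VField Y} (h₁ : SmoothVField V₁) (h₂ : SmoothVField V₂)
    (u : ℝ × ℝ) : SmoothVField (V₁.comb V₂ u) :=
  (ContMDiff.const_smul_section h₁).add_section (ContMDiff.const_smul_section h₂)

/-- Around every point there are coordinates in which the frame takes the normal form. -/
lemma IsSolvFrame.exists_model_chart {V₁ V₂ V₃ : VField Y} {h : Y → ℝ}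
    (hf : IsSolvFrame V₁ V₂ V₃ h) (z : Y) :
    ∃ (σ : OpenPartialHomeomorph ((ℝ × ℝ) × ℝ) Y) (A : ℝ → (ℝ × ℝ →L[ℝ] ℝ × ℝ)) (ε : ℝ),
      0 < ε ∧ σ.source = Metric.ball 0 ε ∧ σ 0 = z ∧
      ContMDiffOn 𝓘(ℝ, (ℝ × ℝ) × ℝ) (𝓡 3) ∞ σ σ.source ∧
      ContMDiffOn (𝓡 3) 𝓘(ℝ, (ℝ × ℝ) × ℝ) ∞ σ.symm σ.target ∧
      A 0 = ContinuousLinearMap.id ℝ _ ∧ HasDerivAt A (frameGenerator (h z)) 0 ∧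
      (∀ t ∈ Ioo (-ε) ε, (A t).IsInvertible ∧ ‖A t‖ ≤ 2) ∧
      ∀ q ∈ σ.source, (∀ u : ℝ × ℝ,
        mfderiv 𝓘(ℝ, (ℝ × ℝ) × ℝ) (𝓡 3) σ q (A q.2 u, (0 : ℝ)) = V₁.comb V₂ u (σ q)) ∧
        mfderiv 𝓘(ℝ, (ℝ × ℝ) × ℝ) (𝓡 3) σ q ((0 : ℝ × ℝ), (1 : ℝ)) = V₃ (σ q) := by
  set φ := extChartAt (𝓡 3) z with hφ
  obtain ⟨Ψ, A, hcΨ, hΨU, hΨc, hΨ, hΨs, hA0, hAd, hfr⟩ := exists_normal_form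
    (V₁ := V₁.inChart z) (V₂ := V₂.inChart z) (V₃ := V₃.inChart z) (h := h ∘ φ.symm)
    (U := φ.target) (c := φ z) (by simp) (isOpen_extChartAt_target z)
    (fun x hx => hf.smooth₁.contDiffAt_inChart hx) (fun x hx => hf.smooth₂.contDiffAt_inChart hx)
    (fun x hx => hf.smooth₃.contDiffAt_inChart hx)
    (fun x hx => contDiffAt_function_inChart hf.smooth_h hx)
    (fun x hx => by
      rw [lieBracket_inChart hf.smooth₃ hf.smooth₁ hx]; simp only [hf.bracket₃₁])
    (fun x hx => by
      rw [lieBracket_inChart hf.smooth₂ hf.smooth₃ hx]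
      simp only [hf.bracket₂₃, VField.inChart, mpullback_apply, map_add, map_smul]
      rfl)
    (fun x hx => by
      rw [lieBracket_inChart hf.smooth₁ hf.smooth₂ hx]
      simp only [hf.bracket₁₂, VField.inChart, mpullback_apply, map_zero]
      rfl)
    (fun x hx => by rw [hφ, ← V₁.deriv_inChart hf.smooth_h hx, hf.deriv₁])
    (fun x hx => by rw [hφ, ← V₂.deriv_inChart hf.smooth_h hx, hf.deriv₂])
    (fun x hx => linearIndependent_inChart hf.linearIndependent hx) (mem_extChartAt_target z)
  have hφs : ∀ x, φ.symm x = (chartAt (EuclideanSpace ℝ (Fin 3)) z).symm x := fun x => by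
    simp [hφ, mfld_simps]
  have hφt : φ.target = (chartAt (EuclideanSpace ℝ (Fin 3)) z).target := by
    simp [hφ, mfld_simps]
  have hφf : ∀ y, φ y = chartAt (EuclideanSpace ℝ (Fin 3)) z y := fun y => by
    simp [hφ, mfld_simps]
  let σ₀ := ((chartAt (EuclideanSpace ℝ (Fin 3)) z).trans Ψ).symm
  have hσ₀ (q : (ℝ × ℝ) × ℝ) : σ₀ q = φ.symm (Ψ.symm q) := (hφs _).symm
  have hσ₀s (y : Y) : σ₀.symm y = Ψ (φ y) := by rw [hφf]; rfl
  have hsrc : σ₀.source = Ψ.target := by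
    simp only [σ₀, OpenPartialHomeomorph.symm_source, OpenPartialHomeomorph.trans_target]
    refine inter_eq_left.mpr fun q hq => ?_
    rw [mem_preimage, ← hφt]
    exact hΨU (Ψ.map_target hq)
  have h0 : (0 : (ℝ × ℝ) × ℝ) ∈ σ₀.source := by
    rw [hsrc, ← hΨc]; exact Ψ.map_source hcΨ
  -- Both conditions are open at `A 0 = id`; any bound larger than `1` would do.
  have e1 : ∀ᶠ t in 𝓝 (0 : ℝ), (A t).IsInvertible ∧ ‖A t‖ ≤ 2 := by
    have hc : ContinuousAt A 0 := hAd.continuousAt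
    refine Eventually.and ?_ ?_
    · have : A 0 ∈ range ((↑) : ((ℝ × ℝ) ≃L[ℝ] (ℝ × ℝ)) → ((ℝ × ℝ) →L[ℝ] (ℝ × ℝ))) :=
        ⟨ContinuousLinearEquiv.refl ℝ _, by rw [hA0]; rfl⟩
      exact hc.eventually (ContinuousLinearEquiv.isOpen.mem_nhds this)
    · have : ‖A 0‖ < 2 := by
        rw [hA0]
        exact lt_of_le_of_lt ContinuousLinearMap.norm_id_le (by norm_num)
      exact (hc.norm.eventually (gt_mem_nhds this)).mono fun t ht => ht.le
  obtain ⟨ε₁, hε₁, hb₁⟩ := Metric.eventually_nhds_iff_ball.mp e1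
  obtain ⟨ε₂, hε₂, hb₂⟩ := Metric.isOpen_iff.mp σ₀.open_source 0 h0
  set ε := min ε₁ ε₂ with hε
  have hball : Metric.ball (0 : (ℝ × ℝ) × ℝ) ε ⊆ σ₀.source :=
    (Metric.ball_subset_ball (min_le_right _ _)).trans hb₂
  let σ := σ₀.restrOpen (Metric.ball 0 ε) Metric.isOpen_ball
  have hσsrc : σ.source = Metric.ball 0 ε := by
    simp only [σ, OpenPartialHomeomorph.restrOpen_source]
    exact inter_eq_right.mpr hball
  have hσq (q : (ℝ × ℝ) × ℝ) : σ q = φ.symm (Ψ.symm q) := hσ₀ q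
  have hsΨ : ∀ q ∈ σ.source, q ∈ Ψ.target := fun q hq => hsrc ▸ hball (hσsrc ▸ hq)
  have hsU : ∀ q ∈ σ.source, Ψ.symm q ∈ φ.target := fun q hq => hΨU (Ψ.map_target (hsΨ q hq))
  have hcont : ∀ q ∈ σ.source, ContMDiffAt 𝓘(ℝ, (ℝ × ℝ) × ℝ) 𝓘(ℝ, EuclideanSpace ℝ (Fin 3)) ∞
      Ψ.symm q := fun q hq => (hΨs q (hsΨ q hq)).contMDiffAt
  refine ⟨σ, A, ε, lt_min hε₁ hε₂, hσsrc, ?_, ?_, ?_, hA0, ?_, ?_, ?_⟩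
  · rw [hσq, ← hΨc, Ψ.left_inv hcΨ]
    exact extChartAt_to_inv z
  · intro q hq
    exact (ContMDiffAt.comp q (contMDiffAt_extChartAt_symm_of_mem (hsU q hq))
      (hcont q hq)).contMDiffWithinAt.congr (fun p _ => hσq p) (hσq q)
  · intro y hy
    have hq := σ.map_target hy
    have hyq : σ (σ.symm y) = y := σ.right_inv hy
    have hys : y ∈ φ.source := by
      rw [← hyq, hσq]
      exact φ.map_target (hsU _ hq)
    have hyΨ : φ y ∈ Ψ.source := by
      rw [← hyq, hσq, φ.right_inv (hsU _ hq)]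
      exact Ψ.map_target (hsΨ _ hq)
    have h1 : ContMDiffAt (𝓡 3) 𝓘(ℝ, EuclideanSpace ℝ (Fin 3)) ∞ φ y :=
      contMDiffAt_extChartAt' (by simpa [hφ, mfld_simps] using hys)
    exact ((hΨ _ hyΨ).contMDiffAt.comp y h1).contMDiffWithinAt.congr (fun p _ => hσ₀s p) (hσ₀s y)
  · simpa [hφ] using hAd
  · intro t ht
    refine hb₁ t ?_
    rw [Real.ball_eq_Ioo, zero_sub, zero_add]
    exact ⟨lt_of_le_of_lt (neg_le_neg (min_le_left _ _)) ht.1, ht.2.trans_le (min_le_left _ _)⟩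
  · intro q hq
    have hx : Ψ.symm q ∈ Ψ.source := Ψ.map_target (hsΨ q hq)
    have hright : Ψ (Ψ.symm q) = q := Ψ.right_inv (hsΨ q hq)
    have key (v : EuclideanSpace ℝ (Fin 3)) :
        mfderiv 𝓘(ℝ, (ℝ × ℝ) × ℝ) (𝓡 3) σ q (fderiv ℝ Ψ (Ψ.symm q) v)
          = mfderiv 𝓘(ℝ, EuclideanSpace ℝ (Fin 3)) (𝓡 3) φ.symm (Ψ.symm q) v := by
      have e : mfderiv 𝓘(ℝ, (ℝ × ℝ) × ℝ) (𝓡 3) σ q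
          = (mfderiv 𝓘(ℝ, EuclideanSpace ℝ (Fin 3)) (𝓡 3) φ.symm (Ψ.symm q)).comp
            (mfderiv 𝓘(ℝ, (ℝ × ℝ) × ℝ) 𝓘(ℝ, EuclideanSpace ℝ (Fin 3)) Ψ.symm q) :=
        mfderiv_comp q ((contMDiffAt_extChartAt_symm_of_mem (hsU q hq)).mdifferentiableAt (by simp))
          ((hcont q hq).mdifferentiableAt (by simp))
      rw [e, mfderiv_eq_fderiv]
      have hid : (Ψ.symm ∘ Ψ) =ᶠ[𝓝 (Ψ.symm q)]
          (id : EuclideanSpace ℝ (Fin 3) → EuclideanSpace ℝ (Fin 3)) := by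
        filter_upwards [Ψ.open_source.mem_nhds hx] with p hp using Ψ.left_inv hp
      have h2 := hid.fderiv_eq (𝕜 := ℝ)
      rw [fderiv_comp _ (by rw [hright]; exact (hΨs q (hsΨ q hq)).differentiableAt (by simp))
        ((hΨ _ hx).differentiableAt (by simp)), fderiv_id, hright] at h2
      have h3 := DFunLike.congr_fun h2 v
      exact congrArg (mfderiv 𝓘(ℝ, EuclideanSpace ℝ (Fin 3)) (𝓡 3) φ.symm (Ψ.symm q)) h3
    refine ⟨fun u => ?_, ?_⟩
    · have := (hfr _ hx).1 u
      rw [hright] at this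
      rw [← this]
      refine (key _).trans ?_
      let D := mfderiv 𝓘(ℝ, EuclideanSpace ℝ (Fin 3)) (𝓡 3) φ.symm (Ψ.symm q)
      exact (D.map_add _ _).trans (congrArg₂ (· + ·)
        ((D.map_smul _ _).trans (congrArg (u.1 • ·) (mfderiv_symm_inChart V₁ (hsU q hq))))
        ((D.map_smul _ _).trans (congrArg (u.2 • ·) (mfderiv_symm_inChart V₂ (hsU q hq)))))
    · have := (hfr _ hx).2
      rw [← this]
      exact (key _).trans (mfderiv_symm_inChart V₃ (hsU q hq))

end ModelChart

/-! ### Uniform constants from compactness -/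

section Uniform

lemma exists_uniform_of_compact {Y : Type*} [TopologicalSpace Y] [CompactSpace Y]
    {P : ℝ → Y → Prop} (hmono : ∀ y ε ε', 0 < ε' → ε' ≤ ε → P ε y → P ε' y)
    (h : ∀ z, ∃ ε > 0, ∀ᶠ y in 𝓝 z, P ε y) : ∃ ε > 0, ∀ y, P ε y := by
  obtain ⟨ε, hε, hP⟩ := isCompact_univ.induction_on (p := fun s : Set Y => ∃ ε > 0, ∀ y ∈ s, P ε y)
    ⟨1, one_pos, by simp⟩ (fun s t hst ⟨ε, hε, ht⟩ => ⟨ε, hε, fun y hy => ht y (hst hy)⟩)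
    (fun s t ⟨ε, hε, hs⟩ ⟨ε', hε', ht⟩ => ⟨min ε ε', lt_min hε hε', fun y hy => by
      rcases hy with hy | hy
      · exact hmono y ε _ (lt_min hε hε') (min_le_left _ _) (hs y hy)
      · exact hmono y ε' _ (lt_min hε hε') (min_le_right _ _) (ht y hy)⟩)
    (fun z _ => by
      obtain ⟨ε, hε, hz⟩ := h z
      exact ⟨_, mem_nhdsWithin_of_mem_nhds hz, ε, hε, fun y hy => hy⟩)
  exact ⟨ε, hε, fun y => hP y (mem_univ y)⟩

lemma exists_Ioo_subset_of_Icc_subset {O : Set ℝ} (hO : IsOpen O) {a b : ℝ} (h : Icc a b ⊆ O)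
    (hab : a ≤ b) : ∃ η > 0, Ioo (a - η) (b + η) ⊆ O := by
  obtain ⟨η₁, h₁, hb₁⟩ := Metric.isOpen_iff.mp hO a (h ⟨le_rfl, hab⟩)
  obtain ⟨η₂, h₂, hb₂⟩ := Metric.isOpen_iff.mp hO b (h ⟨hab, le_rfl⟩)
  refine ⟨min η₁ η₂, lt_min h₁ h₂, fun t ht => ?_⟩
  have hl := min_le_left η₁ η₂
  have hr := min_le_right η₁ η₂
  by_cases h1 : t < a
  · refine hb₁ ?_
    rw [Real.ball_eq_Ioo]
    exact ⟨by linarith [ht.1], by linarith⟩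
  by_cases h2 : b < t
  · refine hb₂ ?_
    rw [Real.ball_eq_Ioo]
    exact ⟨by linarith, by linarith [ht.2]⟩
  exact h ⟨not_lt.mp h1, not_lt.mp h2⟩

end Uniform

/-! ### Flows of complete vector fields -/

section Flow

variable {Y : Type*} [TopologicalSpace Y] [ChartedSpace (EuclideanSpace ℝ (Fin 3)) Y]

/-- Every point lies on a global integral curve of `V`. -/
def VField.Complete (V : VField Y) : Prop :=
  ∀ y, ∃ γ : ℝ → Y, γ 0 = y ∧ IsMIntegralCurve (I := 𝓡 3) γ V

/-- The flow of a complete vector field. -/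
def VField.Complete.flow {V : VField Y} (hV : V.Complete) (t : ℝ) (y : Y) : Y := (hV y).choose t

lemma VField.Complete.flow_zero {V : VField Y} (hV : V.Complete) (y : Y) : hV.flow 0 y = y :=
  (hV y).choose_spec.1

lemma VField.Complete.isMIntegralCurve {V : VField Y} (hV : V.Complete) (y : Y) :
    IsMIntegralCurve (I := 𝓡 3) (fun t => hV.flow t y) V :=
  (hV y).choose_spec.2

variable [IsManifold (𝓡 3) ∞ Y] [T2Space Y]

lemma VField.Complete.flow_eq {V : VField Y} (hV : V.Complete) (hs : SmoothVField V) {a b : ℝ}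
    (h0 : (0 : ℝ) ∈ Ioo a b) {γ : ℝ → Y} (hγ : IsMIntegralCurveOn (I := 𝓡 3) γ V (Ioo a b))
    {t : ℝ} (ht : t ∈ Ioo a b) : hV.flow t (γ 0) = γ t := by
  have : IsManifold (𝓡 3) 1 Y := IsManifold.of_le (n := ∞) (by simp)
  exact isMIntegralCurveOn_Ioo_eqOn_of_contMDiff_boundaryless (I := 𝓡 3) h0 (hs.of_le (by simp))
    ((hV.isMIntegralCurve (γ 0)).isMIntegralCurveOn _) hγ (hV.flow_zero _) ht

lemma VField.Complete.flow_eq_of_global {V : VField Y} (hV : V.Complete) (hs : SmoothVField V)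
    {γ : ℝ → Y} (hγ : IsMIntegralCurve (I := 𝓡 3) γ V) (t : ℝ) : hV.flow t (γ 0) = γ t := by
  refine hV.flow_eq (a := -(|t| + 1)) (b := |t| + 1) hs ⟨by linarith [abs_nonneg t], by positivity⟩
    (hγ.isMIntegralCurveOn _) ⟨?_, ?_⟩
  · linarith [neg_abs_le t]
  · linarith [le_abs_self t]

lemma VField.Complete.flow_add {V : VField Y} (hV : V.Complete) (hs : SmoothVField V) (s t : ℝ)
    (y : Y) : hV.flow (s + t) y = hV.flow s (hV.flow t y) := by
  have h := hV.flow_eq_of_global hs ((hV.isMIntegralCurve y).comp_add t) s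
  simp only [Function.comp, zero_add] at h
  exact h.symm

end Flow

/-! ### Completeness and the flows of the frame -/

section LocalModel

variable {Y : Type*} [TopologicalSpace Y] [ChartedSpace (EuclideanSpace ℝ (Fin 3)) Y]

/-- Coordinates `σ` around `z` in which the action `Φ` translates the first coordinate (by an amount
depending linearly on the group element and on the second coordinate) and the flow `ψ` translates
the second one. -/
structure LocalModel (Φ : ℝ × ℝ → Y → Y) (ψ : ℝ → Y → Y) (h : Y → ℝ) (z : Y) where
  σ : OpenPartialHomeomorph ((ℝ × ℝ) × ℝ) Y
  A : ℝ → (ℝ × ℝ →L[ℝ] ℝ × ℝ)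
  ε : ℝ
  ε_pos : 0 < ε
  source_eq : σ.source = Metric.ball 0 ε
  map_zero : σ 0 = z
  smooth : ContMDiffOn 𝓘(ℝ, (ℝ × ℝ) × ℝ) (𝓡 3) ∞ σ σ.source
  smooth_symm : ContMDiffOn (𝓡 3) 𝓘(ℝ, (ℝ × ℝ) × ℝ) ∞ σ.symm σ.target
  A_zero : A 0 = ContinuousLinearMap.id ℝ _
  A_deriv : HasDerivAt A (frameGenerator (h z)) 0
  A_inv : ∀ t ∈ Ioo (-ε) ε, (A t).IsInvertible
  norm_A_le : ∀ t ∈ Ioo (-ε) ε, ‖A t‖ ≤ 2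
  map_Φ : ∀ w t u, (w, t) ∈ σ.source → (w + A t u, t) ∈ σ.source →
    Φ u (σ (w, t)) = σ (w + A t u, t)
  map_ψ : ∀ w t s, (w, t) ∈ σ.source → (w, t + s) ∈ σ.source → ψ s (σ (w, t)) = σ (w, t + s)

/-- The flows `Φ` (with two parameters) and `ψ` of a frame in normal form. -/
structure FrameFlow (Φ : ℝ × ℝ → Y → Y) (ψ : ℝ → Y → Y) (h : Y → ℝ) : Prop where
  Φ_zero : ∀ y, Φ 0 y = y
  ψ_zero : ∀ y, ψ 0 y = y
  Φ_add_smul : ∀ (s t : ℝ) u y, Φ ((s + t) • u) y = Φ (s • u) (Φ (t • u) y)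
  ψ_add : ∀ s t y, ψ (s + t) y = ψ s (ψ t y)
  smooth_h : ContMDiff (𝓡 3) 𝓘(ℝ, ℝ) ∞ h
  h_Φ : ∀ u y, h (Φ u y) = h y
  exists_localModel : ∀ z, Nonempty (LocalModel Φ ψ h z)

lemma mem_ball_iff_of_prod (w : ℝ × ℝ) (t ε : ℝ) : (w, t) ∈ Metric.ball (0 : (ℝ × ℝ) × ℝ) ε ↔
    ‖w‖ < ε ∧ t ∈ Ioo (-ε) ε := by
  rw [mem_ball_zero_iff, Prod.norm_mk, max_lt_iff, Real.norm_eq_abs, abs_lt, mem_Ioo]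

/-- Lines in a model chart are integral curves. -/
lemma isMIntegralCurveOn_line {σ : OpenPartialHomeomorph ((ℝ × ℝ) × ℝ) Y}
    (hσ : ContMDiffOn 𝓘(ℝ, (ℝ × ℝ) × ℝ) (𝓡 3) ∞ σ σ.source) {V : VField Y}
    {q v : (ℝ × ℝ) × ℝ} {s : Set ℝ} (hs : ∀ t ∈ s, q + t • v ∈ σ.source)
    (hv : ∀ t ∈ s, mfderiv 𝓘(ℝ, (ℝ × ℝ) × ℝ) (𝓡 3) σ (q + t • v) v = V (σ (q + t • v))) :
    IsMIntegralCurveOn (I := 𝓡 3) (fun t : ℝ => σ (q + t • v)) V s := by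
  intro t ht
  have h1 : HasMFDerivAt 𝓘(ℝ, ℝ) 𝓘(ℝ, (ℝ × ℝ) × ℝ) (fun t : ℝ => q + t • v) t
      ((1 : ℝ →L[ℝ] ℝ).smulRight v) := by
    have : HasDerivAt (fun t : ℝ => q + t • v) v t := by
      simpa using ((hasDerivAt_id t).smul_const v).const_add q
    exact this.hasFDerivAt.hasMFDerivAt
  have h2 : HasMFDerivAt 𝓘(ℝ, (ℝ × ℝ) × ℝ) (𝓡 3) σ (q + t • v)
      (mfderiv 𝓘(ℝ, (ℝ × ℝ) × ℝ) (𝓡 3) σ (q + t • v)) :=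
    ((hσ.contMDiffAt (σ.open_source.mem_nhds (hs t ht))).mdifferentiableAt (by simp)).hasMFDerivAt
  have h3 := (h2.comp t h1).hasMFDerivWithinAt (s := s)
  have e : (mfderiv 𝓘(ℝ, (ℝ × ℝ) × ℝ) (𝓡 3) σ (q + t • v)).comp ((1 : ℝ →L[ℝ] ℝ).smulRight v)
      = (1 : ℝ →L[ℝ] ℝ).smulRight (V (σ (q + t • v))) := by
    rw [← hv t ht]
    refine ContinuousLinearMap.ext fun r => ?_
    exact (mfderiv 𝓘(ℝ, (ℝ × ℝ) × ℝ) (𝓡 3) σ (q + t • v)).map_smul r v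
  rw [← e]
  exact h3

variable [IsManifold (𝓡 3) ∞ Y] [T2Space Y] [CompactSpace Y]

/-- In a model chart the integral curves of `V₃` and of constant combinations of `V₁, V₂` are
straight lines, so their existence time is bounded below near each point. -/
lemma IsSolvFrame.complete {V₁ V₂ V₃ : VField Y} {h : Y → ℝ} (hf : IsSolvFrame V₁ V₂ V₃ h) :
    (∀ u, (V₁.comb V₂ u).Complete) ∧ V₃.Complete := by
  have hM : IsManifold (𝓡 3) 1 Y := IsManifold.of_le (n := ∞) (by simp)
  -- it suffices to find local integral curves with a locally uniform existence time
  have main {V : VField Y} (hV : SmoothVField V) (hloc : ∀ z, ∃ δ > 0, ∀ᶠ y in 𝓝 z,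
      ∃ γ : ℝ → Y, γ 0 = y ∧ IsMIntegralCurveOn (I := 𝓡 3) γ V (Ioo (-δ) δ)) : V.Complete := by
    obtain ⟨δ, hδ, hall⟩ := exists_uniform_of_compact
      (P := fun δ y => ∃ γ : ℝ → Y, γ 0 = y ∧ IsMIntegralCurveOn (I := 𝓡 3) γ V (Ioo (-δ) δ))
      (fun y ε ε' _ hle ⟨γ, h0, hγ⟩ => ⟨γ, h0, hγ.mono (Ioo_subset_Ioo (by linarith) hle)⟩) hloc
    exact fun y => exists_isMIntegralCurve_of_isMIntegralCurveOn (I := 𝓡 3) (hV.of_le (by simp))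
      hδ hall y
  have small (σ : OpenPartialHomeomorph ((ℝ × ℝ) × ℝ) Y) {ε : ℝ} (hε : 0 < ε)
      (hsrc : σ.source = Metric.ball 0 ε) {z : Y} (hz : σ 0 = z) :
      ∀ᶠ y in 𝓝 z, ∃ q ∈ Metric.ball (0 : (ℝ × ℝ) × ℝ) (ε / 2), σ q = y := by
    have hsub : Metric.ball (0 : (ℝ × ℝ) × ℝ) (ε / 2) ⊆ σ.source := by
      rw [hsrc]; exact Metric.ball_subset_ball (by linarith)
    have h0 : (0 : (ℝ × ℝ) × ℝ) ∈ Metric.ball (0 : (ℝ × ℝ) × ℝ) (ε / 2) :=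
      Metric.mem_ball_self (by linarith)
    have := (σ.isOpen_image_iff_of_subset_source hsub).mpr Metric.isOpen_ball
    filter_upwards [this.mem_nhds ⟨0, h0, hz⟩] with y hy using hy
  refine ⟨fun u => main (hf.smooth₁.comb hf.smooth₂ u) fun z => ?_, main hf.smooth₃ fun z => ?_⟩
  · obtain ⟨σ, A, ε, hε, hsrc, hz, hσ, -, -, -, hA, hfr⟩ := hf.exists_model_chart z
    -- The speed is at most `2 (‖u‖ + 1)`, so within this time a line starting in the ball of radius
    -- `ε / 2` moves by at most `ε / 2`.
    refine ⟨ε / (4 * (‖u‖ + 1)), by positivity, ?_⟩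
    filter_upwards [small σ hε hsrc hz] with y hy
    obtain ⟨⟨w, τ⟩, hq, hqy⟩ := hy
    rw [mem_ball_iff_of_prod] at hq
    have hτ : τ ∈ Ioo (-ε) ε := ⟨by linarith [hq.2.1], by linarith [hq.2.2]⟩
    have hmem : ∀ t ∈ Ioo (-(ε / (4 * (‖u‖ + 1)))) (ε / (4 * (‖u‖ + 1))),
        (w, τ) + t • (A τ u, (0 : ℝ)) ∈ σ.source := by
      intro t ht
      have ht' : |t| < ε / (4 * (‖u‖ + 1)) := abs_lt.mpr ht
      have e : (w, τ) + t • (A τ u, (0 : ℝ)) = (w + t • A τ u, τ) := by simp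
      rw [hsrc, e, mem_ball_iff_of_prod]
      refine ⟨?_, hτ⟩
      have h1 : ‖A τ u‖ ≤ 2 * (‖u‖ + 1) := by
        refine ((A τ).le_opNorm u).trans ?_
        have := (hA τ hτ).2
        have := norm_nonneg u
        have := norm_nonneg (A τ)
        nlinarith
      have h2 : ‖t • A τ u‖ ≤ ε / 2 := by
        rw [norm_smul, Real.norm_eq_abs]
        calc |t| * ‖A τ u‖ ≤ ε / (4 * (‖u‖ + 1)) * (2 * (‖u‖ + 1)) := by gcongr
          _ = ε / 2 := by field_simp; norm_num
      linarith [norm_add_le w (t • A τ u), hq.1]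
    refine ⟨fun t => σ ((w, τ) + t • (A τ u, (0 : ℝ))), by simpa using hqy,
      isMIntegralCurveOn_line hσ hmem fun t ht => ?_⟩
    have := (hfr _ (hmem t ht)).1 u
    simpa using this
  · obtain ⟨σ, A, ε, hε, hsrc, hz, hσ, -, -, -, hA, hfr⟩ := hf.exists_model_chart z
    refine ⟨ε / 2, by positivity, ?_⟩
    filter_upwards [small σ hε hsrc hz] with y hy
    obtain ⟨⟨w, τ⟩, hq, hqy⟩ := hy
    rw [mem_ball_iff_of_prod] at hq
    have hmem : ∀ t ∈ Ioo (-(ε / 2)) (ε / 2), (w, τ) + t • ((0 : ℝ × ℝ), (1 : ℝ)) ∈ σ.source := by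
      intro t ht
      have e : (w, τ) + t • ((0 : ℝ × ℝ), (1 : ℝ)) = (w, τ + t) := by simp
      rw [hsrc, e, mem_ball_iff_of_prod]
      exact ⟨by linarith [hq.1], by linarith [hq.2.1, ht.1], by linarith [hq.2.2, ht.2]⟩
    exact ⟨fun t => σ ((w, τ) + t • ((0 : ℝ × ℝ), (1 : ℝ))), by simpa using hqy,
      isMIntegralCurveOn_line hσ hmem fun t ht => (hfr _ (hmem t ht)).2⟩

/-- The flow on the orbits of `V₁, V₂`. -/
def planeFlow {V₁ V₂ : VField Y} (hc : ∀ u, (V₁.comb V₂ u).Complete) (u : ℝ × ℝ) (y : Y) : Y :=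
  (hc u).flow 1 y

omit [CompactSpace Y] in
-- Rescaling time turns the flow of `u` into that of `t • u`. This links the time-one definition
-- with genuine flow lines.
lemma planeFlow_smul {V₁ V₂ : VField Y} (hc : ∀ u, (V₁.comb V₂ u).Complete)
    (h₁ : SmoothVField V₁) (h₂ : SmoothVField V₂) (t : ℝ) (u : ℝ × ℝ) (y : Y) :
    planeFlow hc (t • u) y = (hc u).flow t y := by
  have h := ((hc u).isMIntegralCurve y).comp_mul t
  have e : (t • V₁.comb V₂ u : VField Y) = V₁.comb V₂ (t • u) := by
    funext y
    simp only [VField.comb, Pi.smul_apply, smul_add, smul_smul, Prod.smul_fst, Prod.smul_snd,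
      smul_eq_mul]
  rw [e] at h
  have := (hc (t • u)).flow_eq_of_global (h₁.comb h₂ _) h 1
  simpa [planeFlow, (hc u).flow_zero] using this

omit [CompactSpace Y] in
lemma IsSolvFrame.frameFlow {V₁ V₂ V₃ : VField Y} {h : Y → ℝ} (hf : IsSolvFrame V₁ V₂ V₃ h)
    (hc : ∀ u, (V₁.comb V₂ u).Complete) (hc₃ : V₃.Complete) :
    FrameFlow (planeFlow hc) hc₃.flow h where
  Φ_zero y := by
    have := planeFlow_smul hc hf.smooth₁ hf.smooth₂ 0 0 y
    rwa [smul_zero, (hc 0).flow_zero] at this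
  ψ_zero := hc₃.flow_zero
  Φ_add_smul s t u y := by
    simp only [planeFlow_smul hc hf.smooth₁ hf.smooth₂]
    exact (hc u).flow_add (hf.smooth₁.comb hf.smooth₂ u) s t y
  ψ_add := hc₃.flow_add hf.smooth₃
  smooth_h := hf.smooth_h
  h_Φ u y := by
    have hd : ∀ t, HasDerivAt (h ∘ fun t => (hc u).flow t y) 0 t := fun t => by
      have := hasDerivAt_comp_integralCurve ((hc u).isMIntegralCurve y t)
        ((hf.smooth_h _).mdifferentiableAt (by simp))
      have e : (mfderiv (𝓡 3) 𝓘(ℝ, ℝ) h ((hc u).flow t y)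
          (V₁.comb V₂ u ((hc u).flow t y)) : ℝ) = 0 := by
        refine ((mfderiv (𝓡 3) 𝓘(ℝ, ℝ) h ((hc u).flow t y)).map_add _ _).trans ?_
        refine (congrArg₂ (· + ·) (((mfderiv (𝓡 3) 𝓘(ℝ, ℝ) h ((hc u).flow t y)).map_smul _ _).trans
          (congrArg (u.1 • ·) (hf.deriv₁ _)))
          (((mfderiv (𝓡 3) 𝓘(ℝ, ℝ) h ((hc u).flow t y)).map_smul _ _).trans
          (congrArg (u.2 • ·) (hf.deriv₂ _)))).trans ?_
        exact (congrArg₂ (· + ·) (smul_zero (A := ℝ) u.1) (smul_zero (A := ℝ) u.2)).trans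
          (add_zero (0 : ℝ))
      rwa [e] at this
    have := is_const_of_deriv_eq_zero (fun t => (hd t).differentiableAt) (fun t => (hd t).deriv) 1 0
    simpa [planeFlow, (hc u).flow_zero] using this
  exists_localModel z := by
    obtain ⟨σ, A, ε, hε, hsrc, hz, hσ, hσs, hA0, hAd, hA, hfr⟩ := hf.exists_model_chart z
    refine ⟨⟨σ, A, ε, hε, hsrc, hz, hσ, hσs, hA0, hAd, fun t ht => (hA t ht).1,
      fun t ht => (hA t ht).2, fun w t u h1 h2 => ?_, fun w t s h1 h2 => ?_⟩⟩
    · have hO : IsOpen ((fun s : ℝ => (w, t) + s • (A t u, (0 : ℝ))) ⁻¹' σ.source) :=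
        σ.open_source.preimage (by fun_prop)
      have hIcc : Icc (0 : ℝ) 1 ⊆ (fun s : ℝ => (w, t) + s • (A t u, (0 : ℝ))) ⁻¹' σ.source := by
        intro s hs
        have e : (w, t) + s • (A t u, (0 : ℝ)) = (w, t) + s • ((w + A t u, t) - (w, t)) := by simp
        rw [mem_preimage, e, hsrc]
        rw [hsrc] at h1 h2
        exact (convex_ball _ _).add_smul_sub_mem h1 h2 hs
      -- The segment lies in the chart because the source is a ball; the slightly larger open
      -- interval is what uniqueness of integral curves requires.
      obtain ⟨η, hη, hsub⟩ := exists_Ioo_subset_of_Icc_subset hO hIcc zero_le_one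
      have := (hc u).flow_eq (hf.smooth₁.comb hf.smooth₂ u) (a := 0 - η) (b := 1 + η)
        ⟨by linarith, by linarith⟩
        (isMIntegralCurveOn_line hσ (q := (w, t)) (v := (A t u, (0 : ℝ))) hsub fun s hs => by
          simpa using (hfr _ (hsub hs)).1 u) (t := 1) ⟨by linarith, by linarith⟩
      simpa [planeFlow] using this
    · have key : ∀ r ∈ Icc (0 : ℝ) 1, (w, t + r * s) ∈ σ.source := by
        intro r hr
        have e : (w, t + r * s) = (w, t) + r • ((w, t + s) - (w, t)) := by simp
        rw [e, hsrc]
        rw [hsrc] at h1 h2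
        exact (convex_ball _ _).add_smul_sub_mem h1 h2 hr
      have hO : IsOpen ((fun r : ℝ => (w, t) + r • ((0 : ℝ × ℝ), (1 : ℝ))) ⁻¹' σ.source) :=
        σ.open_source.preimage (by fun_prop)
      have hIcc : Icc (min 0 s) (max 0 s) ⊆
          (fun r : ℝ => (w, t) + r • ((0 : ℝ × ℝ), (1 : ℝ))) ⁻¹' σ.source := by
        intro r hr
        have hr' : r ∈ segment ℝ 0 s := by rwa [segment_eq_uIcc]
        rw [segment_eq_image'] at hr'
        obtain ⟨θ, hθ, rfl⟩ := hr'
        simpa using key θ hθ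
      obtain ⟨η, hη, hsub⟩ := exists_Ioo_subset_of_Icc_subset hO hIcc min_le_max
      have := hc₃.flow_eq hf.smooth₃ (a := min 0 s - η) (b := max 0 s + η)
        ⟨by linarith [min_le_left 0 s], by linarith [le_max_left 0 s]⟩
        (isMIntegralCurveOn_line hσ (q := (w, t)) (v := ((0 : ℝ × ℝ), (1 : ℝ))) hsub fun r hr =>
          (hfr _ (hsub hr)).2) (t := s)
        ⟨by linarith [min_le_right 0 s], by linarith [le_max_right 0 s]⟩
      simpa using this

end LocalModel

section LocalModel

variable {Y : Type*} [TopologicalSpace Y] [ChartedSpace (EuclideanSpace ℝ (Fin 3)) Y]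
  {Φ : ℝ × ℝ → Y → Y} {ψ : ℝ → Y → Y} {h : Y → ℝ} {z : Y}

lemma LocalModel.mem_source_iff (m : LocalModel Φ ψ h z) (w : ℝ × ℝ) (t : ℝ) :
    (w, t) ∈ m.σ.source ↔ ‖w‖ < m.ε ∧ t ∈ Ioo (-m.ε) m.ε := by
  rw [m.source_eq, mem_ball_iff_of_prod]

lemma LocalModel.zero_mem_source (m : LocalModel Φ ψ h z) : 0 ∈ m.σ.source := by
  rw [m.source_eq]; exact Metric.mem_ball_self m.ε_pos

lemma LocalModel.mem_target (m : LocalModel Φ ψ h z) : z ∈ m.σ.target := by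
  simpa only [m.map_zero] using m.σ.map_source m.zero_mem_source

lemma LocalModel.symm_apply_self (m : LocalModel Φ ψ h z) : m.σ.symm z = 0 := by
  simpa only [m.map_zero] using m.σ.left_inv m.zero_mem_source

lemma LocalModel.apply_eq (m : LocalModel Φ ψ h z) {w : ℝ × ℝ} {t : ℝ}
    (hw : (w, t) ∈ m.σ.source) : m.σ (w, t) = ψ t (Φ w z) := by
  have hw' := (m.mem_source_iff w t).mp hw
  have hw0 : (w, (0 : ℝ)) ∈ m.σ.source :=
    (m.mem_source_iff w 0).mpr ⟨hw'.1, by linarith [m.ε_pos], m.ε_pos⟩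
  have h1 := m.map_Φ 0 0 w m.zero_mem_source (by simpa [m.A_zero] using hw0)
  rw [← Prod.zero_eq_mk, m.map_zero, m.A_zero] at h1
  have h2 := m.map_ψ w 0 t hw0 (by simpa using hw)
  simp only [zero_add, ContinuousLinearMap.coe_id', id] at h1 h2
  rw [← h2, h1]

lemma LocalModel.eventually_exists (m : LocalModel Φ ψ h z) {δ : ℝ} (hδ : 0 < δ) :
    ∀ᶠ y in 𝓝 z, ∃ w t, ‖w‖ < δ ∧ |t| < δ ∧ (w, t) ∈ m.σ.source ∧ m.σ (w, t) = y := by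
  have h1 : ∀ᶠ y in 𝓝 z, m.σ.symm y ∈ Metric.ball (0 : (ℝ × ℝ) × ℝ) δ :=
    (m.σ.continuousAt_symm m.mem_target) (by
      rw [m.symm_apply_self]; exact Metric.ball_mem_nhds _ hδ)
  filter_upwards [h1, m.σ.open_target.mem_nhds m.mem_target] with y hy hyt
  have h2 := (mem_ball_iff_of_prod (m.σ.symm y).1 (m.σ.symm y).2 δ).mp hy
  exact ⟨_, _, h2.1, abs_lt.mpr h2.2, m.σ.map_target hyt, m.σ.right_inv hyt⟩

end LocalModel

/-! ### The plane action and its conjugation by the transverse flow -/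

namespace FrameFlow

variable {Y : Type*} [TopologicalSpace Y] [ChartedSpace (EuclideanSpace ℝ (Fin 3)) Y]
  {Φ : ℝ × ℝ → Y → Y} {ψ : ℝ → Y → Y} {h : Y → ℝ}

lemma ψ_neg_apply (F : FrameFlow Φ ψ h) (t : ℝ) (y : Y) : ψ (-t) (ψ t y) = y := by
  rw [← F.ψ_add, neg_add_cancel, F.ψ_zero]

lemma ψ_apply_neg (F : FrameFlow Φ ψ h) (t : ℝ) (y : Y) : ψ t (ψ (-t) y) = y := by
  rw [← F.ψ_add, add_neg_cancel, F.ψ_zero]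

lemma ψ_injective (F : FrameFlow Φ ψ h) (t : ℝ) : Function.Injective (ψ t) :=
  fun x y hxy => by rw [← F.ψ_neg_apply t x, hxy, F.ψ_neg_apply]

lemma Φ_nsmul (F : FrameFlow Φ ψ h) (n : ℕ) (u : ℝ × ℝ) : Φ ((n : ℝ) • u) = (Φ u)^[n] := by
  induction n with
  | zero => funext y; simp [F.Φ_zero]
  | succ n ih =>
    funext y
    rw [Nat.cast_add, Nat.cast_one, F.Φ_add_smul, one_smul, ih, Function.iterate_succ_apply]

/-- Uniform local structure of the flows. -/
lemma exists_uniform [CompactSpace Y] (F : FrameFlow Φ ψ h) : ∃ ε > 0, ∀ y,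
    (∃ A : ℝ → ((ℝ × ℝ) →L[ℝ] (ℝ × ℝ)), A 0 = ContinuousLinearMap.id ℝ _ ∧
      ∀ t, |t| < ε → (A t).IsInvertible ∧ ∀ u w, ‖u‖ < ε → ‖w‖ < ε →
        Φ u (ψ t (Φ w y)) = ψ t (Φ (w + A t u) y)) ∧
    ∀ v t, ‖v‖ < ε → |t| < ε → ψ t (Φ v y) = y → v = 0 ∧ t = 0 := by
  refine exists_uniform_of_compact (fun y ε ε' _ hle hP => ?_) fun z => ?_
  · obtain ⟨⟨A, h0, hA⟩, hi⟩ := hP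
    exact ⟨⟨A, h0, fun t ht => ⟨(hA t (ht.trans_le hle)).1, fun u w hu hw =>
      (hA t (ht.trans_le hle)).2 u w (hu.trans_le hle) (hw.trans_le hle)⟩⟩,
      fun v t hv ht => hi v t (hv.trans_le hle) (ht.trans_le hle)⟩
  obtain ⟨m⟩ := F.exists_localModel z
  have hε := m.ε_pos
  -- The base point costs at most `ε / 8`, and each of the two vectors, after applying some `A` of
  -- norm at most `2`, at most `ε / 4`. The sum stays below `ε`, inside the chart.
  refine ⟨m.ε / 8, by positivity, ?_⟩
  filter_upwards [m.eventually_exists (δ := m.ε / 8) (by positivity)] with y hy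
  obtain ⟨w₀, t₀, hw₀, ht₀, hsrc, rfl⟩ := hy
  have ht₀' := abs_lt.mp ht₀
  have hI₀ : t₀ ∈ Ioo (-m.ε) m.ε := ⟨by linarith, by linarith⟩
  have nA (t : ℝ) (ht : t ∈ Ioo (-m.ε) m.ε) (v : ℝ × ℝ) (hv : ‖v‖ < m.ε / 8) :
      ‖m.A t v‖ ≤ m.ε / 4 := by
    refine ((m.A t).le_opNorm v).trans ?_
    have := m.norm_A_le t ht
    have := norm_nonneg v
    nlinarith [norm_nonneg (m.A t)]
  obtain ⟨B, hB⟩ := m.A_inv t₀ hI₀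
  have mem (t : ℝ) (ht : |t| < m.ε / 8) (a b : ℝ × ℝ) (ha : ‖a‖ ≤ m.ε / 4) (hb : ‖b‖ ≤ m.ε / 4) :
      (w₀ + a + b, t₀ + t) ∈ m.σ.source := by
    rw [m.mem_source_iff]
    have := abs_lt.mp ht
    refine ⟨?_, by linarith, by linarith⟩
    linarith [norm_add_le (w₀ + a) b, norm_add_le w₀ a]
  have n0 : ‖(0 : ℝ × ℝ)‖ ≤ m.ε / 4 := by rw [norm_zero]; positivity
  have a0 : |(0 : ℝ)| < m.ε / 8 := by rw [abs_zero]; positivity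
  have eΦ (v : ℝ × ℝ) (t : ℝ) (hv : ‖m.A t₀ v‖ ≤ m.ε / 2) (ht : |t| < m.ε / 8) :
      ψ t (Φ v (m.σ (w₀, t₀))) = m.σ (w₀ + m.A t₀ v, t₀ + t) := by
    have := abs_lt.mp ht
    have hm : (w₀ + m.A t₀ v, t₀) ∈ m.σ.source := by
      rw [m.mem_source_iff]
      exact ⟨by linarith [norm_add_le w₀ (m.A t₀ v)], hI₀⟩
    have hm' : (w₀ + m.A t₀ v, t₀ + t) ∈ m.σ.source := by
      rw [m.mem_source_iff]
      exact ⟨by linarith [norm_add_le w₀ (m.A t₀ v)], by linarith, by linarith⟩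
    rw [m.map_Φ _ _ _ hsrc hm, m.map_ψ _ _ _ hm hm']
  -- The matrix of the chart recentred at height `t₀`, with `B = A t₀`, so that it is again the
  -- identity at `t = 0`.
  refine ⟨⟨fun t => (B.symm : (ℝ × ℝ) →L[ℝ] (ℝ × ℝ)).comp (m.A (t₀ + t)), ?_, fun t ht => ⟨?_, ?_⟩⟩,
    ?_⟩
  · simp only [add_zero, ← hB]
    exact ContinuousLinearMap.ext fun u => B.symm_apply_apply u
  · have := abs_lt.mp ht
    obtain ⟨C, hC⟩ := m.A_inv (t₀ + t) ⟨by linarith, by linarith⟩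
    exact ⟨C.trans B.symm, by simp only [← hC]; rfl⟩
  · intro u w hu hw
    have := abs_lt.mp ht
    have hI : t₀ + t ∈ Ioo (-m.ε) m.ε := ⟨by linarith, by linarith⟩
    have e : m.A t₀ (w + (B.symm : (ℝ × ℝ) →L[ℝ] (ℝ × ℝ)).comp (m.A (t₀ + t)) u)
        = m.A t₀ w + m.A (t₀ + t) u := by
      rw [map_add]
      congr 1
      rw [← hB]
      exact B.apply_symm_apply _
    have n1 := nA t₀ hI₀ w hw
    have n2 := nA _ hI u hu
    rw [eΦ w t (by linarith) ht, eΦ _ t (by rw [e]; linarith [norm_add_le (m.A t₀ w) (m.A (t₀ + t) u)]) ht,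
      e, m.map_Φ _ _ _ (by simpa using mem t ht _ 0 n1 n0) (mem t ht _ _ n1 n2), add_assoc]
  · intro v t hv ht hvt
    have n1 := nA t₀ hI₀ v hv
    rw [eΦ v t (by linarith) ht] at hvt
    have := m.σ.injOn (by simpa using mem t ht _ 0 n1 n0) hsrc hvt
    simp only [Prod.mk.injEq, add_eq_left] at this
    refine ⟨?_, this.2⟩
    rw [← hB] at this
    exact (map_eq_zero_iff B B.injective).mp this.1

variable [CompactSpace Y]

lemma exists_free (F : FrameFlow Φ ψ h) : ∃ ε > 0, ∀ y v t,
    ‖v‖ < ε → |t| < ε → ψ t (Φ v y) = y → v = 0 ∧ t = 0 := by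
  obtain ⟨ε, hε, H⟩ := F.exists_uniform
  exact ⟨ε, hε, fun y => (H y).2⟩

lemma exists_nat_div_lt {E : Type*} [SeminormedAddCommGroup E] [NormedSpace ℝ E] (v : E) {ε : ℝ}
    (hε : 0 < ε) : ∃ n : ℕ, 0 < n ∧ ∀ k : ℕ, n ≤ k → ‖(k : ℝ)⁻¹ • v‖ < ε := by
  obtain ⟨n, hn⟩ := exists_nat_gt (‖v‖ / ε)
  have hn0 : 0 < n := by
    have : (0 : ℝ) < n := lt_of_le_of_lt (by positivity) hn
    exact_mod_cast this
  refine ⟨n, hn0, fun k hk => ?_⟩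
  have hk0 : (0 : ℝ) < k := by exact_mod_cast hn0.trans_le hk
  have hk' : (n : ℝ) ≤ k := by exact_mod_cast hk
  rw [norm_smul, norm_inv, Real.norm_natCast, inv_mul_lt_iff₀ hk0]
  rw [div_lt_iff₀ hε] at hn
  nlinarith

/-- For small vectors this is the uniform local structure at `t = 0`. In general both vectors are
divided by a common integer `l`; the small transformations commute, so the `l`-th iterate of their
composite splits. -/
lemma Φ_add (F : FrameFlow Φ ψ h) (u v : ℝ × ℝ) (y : Y) : Φ (u + v) y = Φ u (Φ v y) := by
  obtain ⟨ε, hε, H⟩ := F.exists_uniform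
  have small (u v : ℝ × ℝ) (hu : ‖u‖ < ε) (hv : ‖v‖ < ε) : Φ (u + v) = Φ u ∘ Φ v := by
    funext y
    obtain ⟨A, h0, hA⟩ := (H y).1
    have := (hA 0 (by simpa using hε)).2 u v hu hv
    rw [h0, F.ψ_zero, F.ψ_zero] at this
    rw [add_comm]
    exact this.symm
  obtain ⟨n, hn, hn'⟩ := exists_nat_div_lt u hε
  obtain ⟨k, hk, hk'⟩ := exists_nat_div_lt v hε
  set l := n + k
  have hl : (l : ℝ) ≠ 0 := by exact_mod_cast (by omega : l ≠ 0)
  have hs (x : ℝ × ℝ) : x = (l : ℝ) • ((l : ℝ)⁻¹ • x) := by rw [smul_inv_smul₀ hl]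
  have hu := hn' l (by omega)
  have hv := hk' l (by omega)
  have hcomm : Function.Commute (Φ ((l : ℝ)⁻¹ • u)) (Φ ((l : ℝ)⁻¹ • v)) := fun y => by
    have h1 := congrFun (small _ _ hu hv) y
    have h2 := congrFun (small _ _ hv hu) y
    rw [add_comm] at h2
    exact h1.symm.trans h2
  rw [hs (u + v), F.Φ_nsmul, smul_add, small _ _ hu hv, hcomm.comp_iterate, ← F.Φ_nsmul,
    ← F.Φ_nsmul, ← hs, ← hs]
  rfl

lemma Φ_neg_apply (F : FrameFlow Φ ψ h) (u : ℝ × ℝ) (y : Y) : Φ (-u) (Φ u y) = y := by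
  rw [← F.Φ_add, neg_add_cancel, F.Φ_zero]

lemma Φ_comm (F : FrameFlow Φ ψ h) (u v : ℝ × ℝ) (y : Y) : Φ u (Φ v y) = Φ v (Φ u y) := by
  rw [← F.Φ_add, add_comm, F.Φ_add]

lemma Φ_eq_iff (F : FrameFlow Φ ψ h) (u v : ℝ × ℝ) (y : Y) :
    Φ u y = Φ v y ↔ Φ (u - v) y = y := by
  constructor
  · intro e
    rw [sub_eq_neg_add, F.Φ_add, e, F.Φ_neg_apply]
  · intro e
    nth_rw 2 [← e]
    rw [← F.Φ_add, add_sub_cancel]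

/-- The linear map by which conjugation with the flow `ψ` acts on the group acting through `Φ` is
determined by small group elements. -/
lemma conj_unique (F : FrameFlow Φ ψ h) {t : ℝ} {z : Y} {A B : (ℝ × ℝ) →L[ℝ] (ℝ × ℝ)}
    (hA : ∀ᶠ u in 𝓝 0, Φ u (ψ t z) = ψ t (Φ (A u) z))
    (hB : ∀ᶠ u in 𝓝 0, Φ u (ψ t z) = ψ t (Φ (B u) z)) : A = B := by
  obtain ⟨ε, hε, H⟩ := F.exists_free
  have h1 : ∀ᶠ u in 𝓝 (0 : ℝ × ℝ), ‖(A - B) u‖ < ε :=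
    ((A - B).continuous.norm.tendsto 0).eventually_lt_const (by simpa using hε)
  have h2 : ∀ᶠ u in 𝓝 (0 : ℝ × ℝ), (A - B) u = 0 := by
    filter_upwards [hA, hB, h1] with u ha hb hu
    have e := F.ψ_injective t (ha.symm.trans hb)
    rw [F.Φ_eq_iff] at e
    exact (H z _ 0 hu (by simpa using hε) (by rw [F.ψ_zero]; exact e)).1
  obtain ⟨δ, hδ, hball⟩ := Metric.eventually_nhds_iff_ball.mp h2
  refine sub_eq_zero.mp (ContinuousLinearMap.ext fun u => ?_)
  obtain ⟨n, hn, hn'⟩ := exists_nat_div_lt u hδ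
  have := hball ((n : ℝ)⁻¹ • u) (by rw [mem_ball_zero_iff]; exact hn' n le_rfl)
  rw [map_smul, smul_eq_zero] at this
  exact this.resolve_left (inv_ne_zero (by exact_mod_cast hn.ne'))

/-- `A` describes how conjugation by `ψ t` acts on `Φ`, along the `Φ`-orbit of `z`. -/
def Conj (_F : FrameFlow Φ ψ h) (t : ℝ) (z : Y) (A : (ℝ × ℝ) →L[ℝ] (ℝ × ℝ)) : Prop :=
  A.IsInvertible ∧ ∀ u w, Φ u (ψ t (Φ w z)) = ψ t (Φ (w + A u) z)

/-- The local matrix at time `t` is determined by small vectors, so it does not change under small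
moves along the `Φ`-orbit and is therefore constant on it. A large `u` is then handled by iterating
`u / n`. -/
lemma exists_conj_of_small (F : FrameFlow Φ ψ h) : ∃ ε > 0, ∀ t z, |t| < ε → ∃ A, F.Conj t z A := by
  obtain ⟨ε, hε, H⟩ := F.exists_uniform
  refine ⟨ε, hε, fun t z ht => ?_⟩
  choose A h0 hA using fun y => (H y).1
  have hloc (y : Y) (u : ℝ × ℝ) (hu : ‖u‖ < ε) : Φ u (ψ t y) = ψ t (Φ (A y t u) y) := by
    have := (hA y t ht).2 u 0 hu (by simpa using hε)
    rwa [F.Φ_zero, zero_add] at this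
  have hev (B : ℝ × ℝ → Prop) (hB : ∀ u, ‖u‖ < ε → B u) : ∀ᶠ u in 𝓝 0, B u := by
    filter_upwards [Metric.ball_mem_nhds (0 : ℝ × ℝ) hε] with u hu
    exact hB u (mem_ball_zero_iff.mp hu)
  have step (y : Y) (w : ℝ × ℝ) (hw : ‖w‖ < ε) : A (Φ w y) t = A y t := by
    refine F.conj_unique (t := t) (z := Φ w y) (hev _ (hloc _)) (hev _ fun u hu => ?_)
    rw [(hA y t ht).2 u w hu hw, add_comm, F.Φ_add]
  have const (w : ℝ × ℝ) : A (Φ w z) t = A z t := by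
    obtain ⟨n, hn, hn'⟩ := exists_nat_div_lt w hε
    have hn0 : (n : ℝ) ≠ 0 := by exact_mod_cast hn.ne'
    have key (k : ℕ) : A ((Φ ((n : ℝ)⁻¹ • w))^[k] z) t = A z t := by
      induction k with
      | zero => rfl
      | succ k ih => rw [Function.iterate_succ_apply', step _ _ (hn' n le_rfl), ih]
    have := key n
    rwa [← F.Φ_nsmul, smul_inv_smul₀ hn0] at this
  refine ⟨A z t, (hA z t ht).1, fun u w => ?_⟩
  obtain ⟨n, hn, hn'⟩ := exists_nat_div_lt u hε
  have hn0 : (n : ℝ) ≠ 0 := by exact_mod_cast hn.ne'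
  have key (k : ℕ) : (Φ ((n : ℝ)⁻¹ • u))^[k] (ψ t (Φ w z))
      = ψ t (Φ (w + (k : ℝ) • A z t ((n : ℝ)⁻¹ • u)) z) := by
    induction k with
    | zero => simp
    | succ k ih =>
      rw [Function.iterate_succ_apply', ih, hloc _ _ (hn' n le_rfl), const, ← F.Φ_add]
      congr 2
      push_cast
      module
  have := key n
  rwa [← F.Φ_nsmul, smul_inv_smul₀ hn0, ← map_smul, smul_inv_smul₀ hn0] at this

omit [CompactSpace Y] in
-- Moving `Φ u` past `ψ t` turns `u` into `B u`; moving it past `ψ s` then applies `A`, whence the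
-- order.
lemma Conj.comp {F : FrameFlow Φ ψ h} {s t : ℝ} {z : Y} {A B : (ℝ × ℝ) →L[ℝ] (ℝ × ℝ)}
    (hA : F.Conj s z A) (hB : F.Conj t (ψ s z) B) : F.Conj (s + t) z (A.comp B) := by
  obtain ⟨⟨A', rfl⟩, hA⟩ := hA
  obtain ⟨⟨B', rfl⟩, hB⟩ := hB
  refine ⟨⟨B'.trans A', rfl⟩, fun u w => ?_⟩
  have e (x : ℝ × ℝ) : ψ s (Φ x z) = Φ (A'.symm x) (ψ s z) := by
    have := hA (A'.symm x) 0
    rw [F.Φ_zero] at this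
    rw [this]
    simp
  rw [add_comm s t, F.ψ_add, F.ψ_add, e, hB, e]
  congr 2
  rw [map_add]
  congr 1
  exact (A'.symm_apply_apply _).symm

/-- The time is cut into small steps, whose matrices are composed. -/
lemma exists_conj (F : FrameFlow Φ ψ h) (t : ℝ) (z : Y) : ∃ A, F.Conj t z A := by
  obtain ⟨ε, hε, H⟩ := F.exists_conj_of_small
  obtain ⟨n, hn, hn'⟩ := exists_nat_div_lt t hε
  have hn0 : (n : ℝ) ≠ 0 := by exact_mod_cast hn.ne'
  have key (k : ℕ) : ∃ A, F.Conj ((k : ℝ) * ((n : ℝ)⁻¹ * t)) z A := by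
    induction k with
    | zero => exact H _ _ (by simpa using hε)
    | succ k ih =>
      obtain ⟨A, hA⟩ := ih
      obtain ⟨B, hB⟩ := H ((n : ℝ)⁻¹ * t) (ψ ((k : ℝ) * ((n : ℝ)⁻¹ * t)) z) (hn' n le_rfl)
      have := hA.comp hB
      rw [← add_one_mul, ← Nat.cast_succ] at this
      exact ⟨_, this⟩
  have := key n
  rwa [mul_inv_cancel_left₀ hn0] at this

lemma Conj.eq {F : FrameFlow Φ ψ h} {t : ℝ} {z : Y} {A B : (ℝ × ℝ) →L[ℝ] (ℝ × ℝ)}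
    (hA : F.Conj t z A) (hB : F.Conj t z B) : A = B := by
  refine F.conj_unique (t := t) (z := z) (.of_forall fun u => ?_) (.of_forall fun u => ?_)
  · simpa [F.Φ_zero] using hA.2 u 0
  · simpa [F.Φ_zero] using hB.2 u 0

/-- The action of conjugation by `ψ t` on `Φ`, along the `Φ`-orbit of `z`. -/
def monodromy (F : FrameFlow Φ ψ h) (z : Y) (t : ℝ) : (ℝ × ℝ) →L[ℝ] (ℝ × ℝ) :=
  (F.exists_conj t z).choose

lemma conj_monodromy (F : FrameFlow Φ ψ h) (z : Y) (t : ℝ) : F.Conj t z (F.monodromy z t) :=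
  (F.exists_conj t z).choose_spec

lemma Φ_ψ (F : FrameFlow Φ ψ h) (u : ℝ × ℝ) (t : ℝ) (z : Y) :
    Φ u (ψ t z) = ψ t (Φ (F.monodromy z t u) z) := by
  simpa [F.Φ_zero] using (F.conj_monodromy z t).2 u 0

/-- The inverse of `monodromy`. -/
def monodromyInv (F : FrameFlow Φ ψ h) (z : Y) (t : ℝ) : (ℝ × ℝ) →L[ℝ] (ℝ × ℝ) :=
  ((F.conj_monodromy z t).1.choose.symm : (ℝ × ℝ) →L[ℝ] (ℝ × ℝ))

lemma monodromy_monodromyInv (F : FrameFlow Φ ψ h) (z : Y) (t : ℝ) (u : ℝ × ℝ) :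
    F.monodromy z t (F.monodromyInv z t u) = u := by
  have := (F.conj_monodromy z t).1.choose_spec
  nth_rw 1 [← this]
  exact ContinuousLinearEquiv.apply_symm_apply _ _

lemma ψ_Φ (F : FrameFlow Φ ψ h) (t : ℝ) (u : ℝ × ℝ) (z : Y) :
    ψ t (Φ u z) = Φ (F.monodromyInv z t u) (ψ t z) := by
  rw [F.Φ_ψ, F.monodromy_monodromyInv]

lemma monodromy_add (F : FrameFlow Φ ψ h) (z : Y) (s t : ℝ) :
    F.monodromy z (s + t) = (F.monodromy z s).comp (F.monodromy (ψ s z) t) :=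
  (F.conj_monodromy z (s + t)).eq ((F.conj_monodromy z s).comp (F.conj_monodromy _ t))

lemma monodromy_zero (F : FrameFlow Φ ψ h) (z : Y) :
    F.monodromy z 0 = ContinuousLinearMap.id ℝ _ := by
  refine (F.conj_monodromy z 0).eq ⟨⟨.refl ℝ _, rfl⟩, fun u w => ?_⟩
  rw [F.ψ_zero, F.ψ_zero, add_comm, F.Φ_add]
  rfl

lemma monodromy_Φ (F : FrameFlow Φ ψ h) (v : ℝ × ℝ) (z : Y) (t : ℝ) :
    F.monodromy (Φ v z) t = F.monodromy z t := by
  refine (F.conj_monodromy _ t).eq ⟨(F.conj_monodromy z t).1, fun u w => ?_⟩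
  rw [← F.Φ_add, (F.conj_monodromy z t).2, ← F.Φ_add]
  congr 2
  abel

/-- For small `t` the monodromy is the matrix `A t` of a model chart at `z`, by uniqueness on small
vectors. -/
lemma hasDerivAt_monodromy_zero (F : FrameFlow Φ ψ h) (z : Y) :
    HasDerivAt (F.monodromy z) (frameGenerator (h z)) 0 := by
  obtain ⟨m⟩ := F.exists_localModel z
  refine m.A_deriv.congr_of_eventuallyEq ?_
  filter_upwards [Ioo_mem_nhds (by linarith [m.ε_pos] : -m.ε < 0) m.ε_pos] with t ht
  refine F.conj_unique (t := t) (z := z) (.of_forall fun u => F.Φ_ψ u t z) ?_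
  have hc : ∀ᶠ u in 𝓝 (0 : ℝ × ℝ), ‖m.A t u‖ < m.ε :=
    ((m.A t).continuous.norm.tendsto 0).eventually_lt_const (by simpa using m.ε_pos)
  filter_upwards [hc] with u hu
  have h1 : ((0 : ℝ × ℝ), t) ∈ m.σ.source :=
    (m.mem_source_iff _ _).mpr ⟨by simpa using m.ε_pos, ht⟩
  have h2 : (m.A t u, t) ∈ m.σ.source := (m.mem_source_iff _ _).mpr ⟨hu, ht⟩
  have := m.map_Φ 0 t u h1 (by simpa using h2)
  rwa [zero_add, m.apply_eq h1, m.apply_eq h2, F.Φ_zero] at this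

/-- The cocycle identity reduces the derivative at `t` to the one at `0` for the base point `ψ t z`.
-/
lemma hasDerivAt_monodromy (F : FrameFlow Φ ψ h) (z : Y) (t : ℝ) :
    HasDerivAt (F.monodromy z) ((F.monodromy z t).comp (frameGenerator (h (ψ t z)))) t := by
  have h0 : HasDerivAt (F.monodromy (ψ t z)) (frameGenerator (h (ψ t z))) (t - t) := by
    rw [sub_self]; exact F.hasDerivAt_monodromy_zero _
  have h1 := h0.comp_sub_const t t
  have h2 := (ContinuousLinearMap.compL ℝ (ℝ × ℝ) (ℝ × ℝ) (ℝ × ℝ)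
    (F.monodromy z t)).hasFDerivAt.comp_hasDerivAt t h1
  refine h2.congr_of_eventuallyEq (.of_forall fun s => ?_)
  have := F.monodromy_add z t (s - t)
  rw [add_sub_cancel] at this
  exact this

end FrameFlow

/-! ### Orbits, stabilizers and return times -/

namespace FrameFlow

variable {Y : Type*} [TopologicalSpace Y] [ChartedSpace (EuclideanSpace ℝ (Fin 3)) Y]
  {Φ : ℝ × ℝ → Y → Y} {ψ : ℝ → Y → Y} {h : Y → ℝ}

section Continuity

lemma continuous_ψ (F : FrameFlow Φ ψ h) (z : Y) : Continuous fun t => ψ t z := by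
  refine continuous_iff_continuousAt.mpr fun t => ?_
  obtain ⟨m⟩ := F.exists_localModel (ψ t z)
  have h1 : ContinuousAt (fun s : ℝ => m.σ ((0 : ℝ × ℝ), s - t)) t := by
    refine ContinuousAt.comp (g := m.σ) (f := fun s : ℝ => ((0 : ℝ × ℝ), s - t)) ?_ (by fun_prop)
    rw [sub_self]
    exact m.σ.continuousAt m.zero_mem_source
  refine h1.congr ?_
  have hev : ∀ᶠ s in 𝓝 t, s ∈ Ioo (t - m.ε) (t + m.ε) :=
    Ioo_mem_nhds (by linarith [m.ε_pos]) (by linarith [m.ε_pos])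
  filter_upwards [hev] with s hs
  rw [m.apply_eq ((m.mem_source_iff _ _).mpr
    ⟨by simpa using m.ε_pos, by linarith [hs.1], by linarith [hs.2]⟩), F.Φ_zero, ← F.ψ_add,
    sub_add_cancel]

end Continuity

variable [CompactSpace Y]

/-- The set reached from `z` is invariant under both flows. By the model charts, membership is
locally constant, so the set is clopen. -/
lemma exists_eq_ψ_Φ [ConnectedSpace Y] (F : FrameFlow Φ ψ h) (z y : Y) :
    ∃ t v, y = ψ t (Φ v z) := by
  set s : Set Y := {y | ∃ t v, y = ψ t (Φ v z)}
  have hs (y : Y) (t : ℝ) (v : ℝ × ℝ) : ψ t (Φ v y) ∈ s ↔ y ∈ s := by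
    constructor
    · rintro ⟨t', v', e⟩
      refine ⟨-t + t', F.monodromy z (-t + t') (-v) + v', ?_⟩
      rw [F.Φ_add, ← F.monodromy_Φ v', ← F.Φ_ψ, F.ψ_add, ← e,
        F.ψ_neg_apply, F.Φ_neg_apply]
    · rintro ⟨t', v', rfl⟩
      refine ⟨t + t', F.monodromy z t' v + v', ?_⟩
      rw [F.Φ_ψ, F.monodromy_Φ, F.ψ_add, F.Φ_add]
  have hev (y : Y) : ∀ᶠ y' in 𝓝 y, y' ∈ s ↔ y ∈ s := by
    obtain ⟨m⟩ := F.exists_localModel y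
    filter_upwards [m.eventually_exists m.ε_pos] with y' hy'
    obtain ⟨w, t, -, -, hm, rfl⟩ := hy'
    rw [m.apply_eq hm, hs]
  have hclopen : IsClopen s := by
    constructor
    · rw [← isOpen_compl_iff, isOpen_iff_mem_nhds]
      intro y hy
      filter_upwards [hev y] with y' h' using fun h'' => hy (h'.mp h'')
    · rw [isOpen_iff_mem_nhds]
      intro y hy
      filter_upwards [hev y] with y' h' using h'.mpr hy
  have := hclopen.eq_univ ⟨z, 0, 0, by rw [F.Φ_zero, F.ψ_zero]⟩
  exact (this ▸ mem_univ y : y ∈ s)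

/-- The times at which the `ψ`-orbit of `z` returns to the `Φ`-orbit of `z`. -/
def periods (F : FrameFlow Φ ψ h) (z : Y) : AddSubgroup ℝ where
  carrier := {t | ∃ v, ψ t z = Φ v z}
  zero_mem' := ⟨0, by rw [F.Φ_zero, F.ψ_zero]⟩
  add_mem' := by
    rintro s t ⟨u, hu⟩ ⟨v, hv⟩
    exact ⟨_, by rw [F.ψ_add, hv, F.ψ_Φ, hu, ← F.Φ_add]⟩
  neg_mem' := by
    rintro t ⟨v, hv⟩
    have : z = Φ (F.monodromyInv z (-t) v) (ψ (-t) z) := by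
      rw [← F.ψ_Φ, ← hv, F.ψ_neg_apply]
    refine ⟨-F.monodromyInv z (-t) v, ?_⟩
    nth_rw 3 [this]
    rw [F.Φ_neg_apply]

lemma mem_periods_of_eq (F : FrameFlow Φ ψ h) {z : Y} {t : ℝ} {u v : ℝ × ℝ}
    (e : ψ t (Φ u z) = Φ v z) : t ∈ F.periods z := by
  rw [F.ψ_Φ] at e
  refine ⟨-F.monodromyInv z t u + v, ?_⟩
  rw [F.Φ_add, ← e, F.Φ_neg_apply]

lemma sub_mem_periods (F : FrameFlow Φ ψ h) {z : Y} {s t : ℝ} {u v : ℝ × ℝ}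
    (e : ψ t (Φ u z) = ψ s (Φ v z)) : t - s ∈ F.periods z := by
  refine F.mem_periods_of_eq (u := u) (v := v) ?_
  rw [sub_eq_neg_add, F.ψ_add, e, F.ψ_neg_apply]

/-- Multiplicativity of the monodromy over returns to the same `Φ`-orbit. -/
lemma monodromy_add_of_mem (F : FrameFlow Φ ψ h) {z : Y} {s : ℝ} (hs : s ∈ F.periods z) (t : ℝ) :
    F.monodromy z (s + t) = (F.monodromy z s).comp (F.monodromy z t) := by
  obtain ⟨v, hv⟩ := hs
  rw [F.monodromy_add, hv, F.monodromy_Φ]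

/-- The stabilizer of `z` under the action `Φ`. -/
def stabilizer (F : FrameFlow Φ ψ h) (z : Y) : AddSubgroup (ℝ × ℝ) where
  carrier := {v | Φ v z = z}
  zero_mem' := F.Φ_zero z
  add_mem' := by
    intro u v (hu : Φ u z = z) (hv : Φ v z = z)
    show Φ (u + v) z = z
    rw [F.Φ_add, hv, hu]
  neg_mem' := by
    intro v (hv : Φ v z = z)
    show Φ (-v) z = z
    nth_rw 1 [← hv]
    rw [F.Φ_neg_apply]

lemma Φ_eq_Φ_iff (F : FrameFlow Φ ψ h) {z : Y} {u v : ℝ × ℝ} :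
    Φ u z = Φ v z ↔ u - v ∈ F.stabilizer z := F.Φ_eq_iff u v z

lemma monodromy_mem_stabilizer (F : FrameFlow Φ ψ h) {z : Y} {t : ℝ} (ht : t ∈ F.periods z)
    {v : ℝ × ℝ} (hv : v ∈ F.stabilizer z) : F.monodromy z t v ∈ F.stabilizer z := by
  obtain ⟨u, hu⟩ := ht
  refine F.ψ_injective t ?_
  rw [← F.Φ_ψ, hu, F.Φ_comm, hv]

/-! ### The transverse coordinate -/

section Height

variable [ConnectedSpace Y]

/-- A choice of the time at which the `Φ`-orbit of `z` is moved to that of `y`. -/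
def height (F : FrameFlow Φ ψ h) (z y : Y) : ℝ := (F.exists_eq_ψ_Φ z y).choose

lemma height_spec (F : FrameFlow Φ ψ h) (z y : Y) : ∃ v, y = ψ (F.height z y) (Φ v z) :=
  (F.exists_eq_ψ_Φ z y).choose_spec

lemma height_ψ_Φ (F : FrameFlow Φ ψ h) (z y : Y) (t : ℝ) (v : ℝ × ℝ) :
    F.height z (ψ t (Φ v y)) - (F.height z y + t) ∈ F.periods z := by
  obtain ⟨u, hu⟩ := F.height_spec z y
  obtain ⟨u', hu'⟩ := F.height_spec z (ψ t (Φ v y))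
  refine F.sub_mem_periods (u := u')
    (v := F.monodromy (Φ u z) (F.height z y) v + u) (hu'.symm.trans ?_)
  nth_rw 1 [hu]
  rw [F.Φ_ψ, ← F.ψ_add, add_comm t, F.Φ_add]

lemma height_local (F : FrameFlow Φ ψ h) (z : Y) {y : Y} (m : LocalModel Φ ψ h y) :
    ∀ᶠ y' in 𝓝 y, F.height z y' - (F.height z y + (m.σ.symm y').2) ∈ F.periods z := by
  filter_upwards [m.eventually_exists m.ε_pos] with y' hy'
  obtain ⟨w, t, -, -, hm, rfl⟩ := hy'
  rw [m.σ.left_inv hm, m.apply_eq hm]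
  exact F.height_ψ_Φ z y t w

/-- Without returns the height would be a genuine continuous function on a compact space, yet it
grows by `t` under `ψ t`. -/
lemma periods_ne_bot (F : FrameFlow Φ ψ h) (z : Y) : F.periods z ≠ ⊥ := by
  intro hbot
  have hcont : Continuous (F.height z) := by
    refine continuous_iff_continuousAt.mpr fun y => ?_
    obtain ⟨m⟩ := F.exists_localModel y
    have h1 : ContinuousAt (fun y' => F.height z y + (m.σ.symm y').2) y :=
      continuousAt_const.add (continuousAt_snd.comp (m.σ.continuousAt_symm m.mem_target))
    refine h1.congr ?_
    filter_upwards [F.height_local z m] with y' hy'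
    rw [hbot, AddSubgroup.mem_bot] at hy'
    linarith
  obtain ⟨C, hC⟩ := (isCompact_range hcont).bddAbove
  have h1 := F.height_ψ_Φ z z (C + 1 - F.height z z) 0
  rw [hbot, AddSubgroup.mem_bot, F.Φ_zero] at h1
  have := hC ⟨ψ (C + 1 - F.height z z) z, rfl⟩
  linarith

end Height

/-- Its determinant is `1`, whatever `i` is. Consequently `monodromy z t - id` is injective for all
small `t ≠ 0`. -/
lemma isUnit_frameGenerator (i : ℝ) : IsUnit (frameGenerator i) := by
  refine ContinuousLinearMap.isUnit_iff_bijective.mpr ?_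
  constructor
  · refine (injective_iff_map_eq_zero _).mpr fun u hu => ?_
    rw [frameGenerator_apply] at hu
    obtain ⟨h1, h2⟩ := Prod.mk.injEq .. ▸ hu
    have h3 : u.2 = 0 := by simpa using h1
    exact Prod.ext (by simpa [h3] using h2) h3
  · intro v
    exact ⟨(v.2 - i * v.1, -v.1), by rw [frameGenerator_apply]; ext <;> simp⟩

/-- The times of return are not dense. -/
lemma periods_not_dense (F : FrameFlow Φ ψ h) (z : Y) : ¬ Dense (F.periods z : Set ℝ) := by
  intro hd
  obtain ⟨ε, hε, free⟩ := F.exists_free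
  have hfreq : ∃ᶠ t in 𝓝[≠] (0 : ℝ), t ∈ F.periods z :=
    mem_closure_ne_iff_frequently_within.mp ((hd.sdiff_singleton 0).closure_eq ▸ mem_univ _)
  -- The difference quotients of the monodromy tend to the invertible generator, and invertibility
  -- is open.
  have hinj : ∀ᶠ t in 𝓝[≠] (0 : ℝ), ∀ v, F.monodromy z t v = v → v = 0 := by
    have h1 := (hasDerivAt_iff_tendsto_slope.mp (F.hasDerivAt_monodromy_zero z)).eventually
      (Units.isOpen.mem_nhds (isUnit_frameGenerator (h z)))
    filter_upwards [h1] with t ht v hv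
    have hb := (ContinuousLinearMap.isUnit_iff_bijective.mp ht).1
    refine hb ?_
    rw [map_zero, slope_def_module, F.monodromy_zero]
    simp [hv]
  -- For a small return time `t`, the difference `M v - v` lies in the stabilizer and is short, so
  -- it vanishes by local freeness; `hinj` then gives `v = 0`.
  have hstab : ∀ v ∈ F.stabilizer z, v = 0 := by
    intro v hv
    have hc : ∀ᶠ t in 𝓝[≠] (0 : ℝ), ‖F.monodromy z t v - v‖ < ε := by
      refine Filter.Eventually.filter_mono nhdsWithin_le_nhds ?_
      have hc : ContinuousAt (fun t => ‖F.monodromy z t v - v‖) 0 :=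
        (((F.hasDerivAt_monodromy_zero z).continuousAt.clm_apply continuousAt_const).sub
          continuousAt_const).norm
      exact hc.eventually_lt_const (by simpa [F.monodromy_zero] using hε)
    obtain ⟨t, ht, hti, htc⟩ := (hfreq.and_eventually (hinj.and hc)).exists
    have h1 := (F.stabilizer z).sub_mem (F.monodromy_mem_stabilizer ht hv) hv
    have h2 := (free z _ 0 htc (by simpa using hε) (by rw [F.ψ_zero]; exact h1)).1
    exact hti v (sub_eq_zero.mp h2)
  obtain ⟨c, hc, hci⟩ := (hfreq.and_eventually hinj).exists
  obtain ⟨d, hdm, hde, hd0⟩ : ∃ d, d ∈ F.periods z ∧ |d| < ε ∧ d ≠ 0 := by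
    have h1 : ∀ᶠ t in 𝓝[≠] (0 : ℝ), |t| < ε ∧ t ≠ 0 := by
      refine Filter.Eventually.and ?_ eventually_mem_nhdsWithin
      refine Filter.Eventually.filter_mono nhdsWithin_le_nhds ?_
      exact continuous_abs.continuousAt.eventually_lt_const (by simpa using hε)
    exact (hfreq.and_eventually h1).exists
  obtain ⟨vc, hvc⟩ := hc
  obtain ⟨vd, hvd⟩ := hdm
  -- the transformations `ψ c` and `ψ d` of the orbit commute and `ψ c` has a fixed point
  obtain ⟨w, hw⟩ : ∃ w, F.monodromyInv z c w + vc = w := by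
    have hi : Function.Injective
        (ContinuousLinearMap.id ℝ (ℝ × ℝ) - F.monodromyInv z c).toLinearMap := by
      refine (injective_iff_map_eq_zero _).mpr fun v hv => hci v ?_
      have hv' : v = F.monodromyInv z c v := sub_eq_zero.mp hv
      nth_rw 1 [hv']
      exact F.monodromy_monodromyInv z c v
    obtain ⟨w, hw⟩ := LinearMap.surjective_of_injective hi vc
    refine ⟨w, ?_⟩
    rw [← hw]
    exact add_sub_cancel _ _
  have fixc : ψ c (Φ w z) = Φ w z := by
    rw [F.ψ_Φ, hvc, ← F.Φ_add, hw]
  have hdw : ψ d (Φ w z) = Φ (F.monodromyInv z d w + vd) z := by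
    rw [F.ψ_Φ, hvd, ← F.Φ_add]
  set w' := F.monodromyInv z d w + vd
  have fixc' : ψ c (Φ w' z) = Φ w' z := by
    rw [← hdw, ← F.ψ_add, add_comm, F.ψ_add, fixc]
  -- The fixed point of `ψ c` on the orbit is unique, as the stabilizer is trivial and `M_c` fixes
  -- no nonzero vector. So `ψ d` fixes it too, contradicting local freeness for the small time `d ≠
  -- 0`.
  have huniq : w' - w = 0 := by
    refine hci _ ?_
    have e : ψ c (Φ (w' - w) (Φ w z)) = ψ c (Φ (F.monodromy z c (w' - w)) (Φ w z)) := by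
      rw [← F.Φ_add, sub_add_cancel, fixc', ← F.monodromy_Φ w, ← F.Φ_ψ, fixc, ← F.Φ_add,
        sub_add_cancel]
    have e' := F.ψ_injective c e
    rw [← F.Φ_add, ← F.Φ_add, F.Φ_eq_Φ_iff] at e'
    have := hstab _ e'
    have h3 : (w' - w) - F.monodromy z c (w' - w) = 0 := by rw [← this]; abel
    exact (sub_eq_zero.mp h3).symm
  rw [sub_eq_zero.mp huniq] at hdw
  exact hd0 (free (Φ w z) 0 d (by simpa using hε) hde (by rw [F.Φ_zero, hdw])).2

lemma exists_periods_eq [ConnectedSpace Y] (F : FrameFlow Φ ψ h) (z : Y) :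
    ∃ l : ℝ, 0 < l ∧ F.periods z = AddSubgroup.zmultiples l := by
  rcases (F.periods z).dense_or_cyclic with hd | ⟨a, ha⟩
  · exact (F.periods_not_dense z hd).elim
  rw [← AddSubgroup.zmultiples_eq_closure] at ha
  have ha0 : a ≠ 0 := by
    rintro rfl
    exact F.periods_ne_bot z (by rw [ha, AddSubgroup.zmultiples_zero_eq_bot])
  rcases lt_or_gt_of_ne ha0 with hn | hp
  · exact ⟨-a, by linarith, by rw [ha, AddSubgroup.zmultiples_neg]⟩
  · exact ⟨a, hp, ha⟩

end FrameFlow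

/-! ### Angles on the circle -/

section Circle

/-- The angle of `q` relative to `b`, in `(-π, π]`. -/
def Circle.angleFrom (b q : Circle) : ℝ := Complex.arg ((q / b : Circle) : ℂ)

lemma Circle.exp_angleFrom (b q : Circle) : b * Circle.exp (Circle.angleFrom b q) = q := by
  rw [Circle.angleFrom, Circle.exp_arg, mul_div_cancel]

lemma Circle.angleFrom_mul_exp (b : Circle) {t : ℝ} (h1 : -Real.pi < t) (h2 : t ≤ Real.pi) :
    Circle.angleFrom b (b * Circle.exp t) = t := by
  rw [Circle.angleFrom, mul_div_cancel_left, Circle.arg_exp h1 h2]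

lemma Circle.angleFrom_self (b : Circle) : Circle.angleFrom b b = 0 := by
  rw [Circle.angleFrom, div_self', Circle.coe_one, Complex.arg_one]

lemma Circle.angleFrom_lt {b q : Circle} (h : q ≠ -b) : Circle.angleFrom b q < Real.pi := by
  refine (Complex.arg_le_pi _).lt_of_ne fun e => h ?_
  rw [← Circle.exp_angleFrom b q, show Circle.angleFrom b q = Real.pi from e]
  ext
  simp [Complex.exp_pi_mul_I]

lemma Circle.neg_pi_lt_angleFrom (b q : Circle) : -Real.pi < Circle.angleFrom b q :=
  Complex.neg_pi_lt_arg _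

lemma Circle.contMDiffAt_angleFrom {b q : Circle} (h : q ≠ -b) :
    ContMDiffAt (𝓡 1) 𝓘(ℝ, ℝ) ∞ (Circle.angleFrom b) q := by
  have h1 : ContMDiffAt (𝓡 1) 𝓘(ℝ, ℂ) ∞ (fun q : Circle => (q : ℂ)) q :=
    have := finrank_real_complex_fact'
    (contMDiff_coe_sphere (n := 1) (E := ℂ)).contMDiffAt
  have hs : (q : ℂ) / b ∈ Complex.slitPlane := by
    rw [Complex.mem_slitPlane_iff_arg]
    exact ⟨(Circle.angleFrom_lt h).ne, by simp⟩
  have h2 : ContDiffAt ℝ ∞ (fun z : ℂ => (Complex.log (z / b)).im) (q : ℂ) := by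
    have : ContDiffAt ℂ ∞ (fun z : ℂ => Complex.log (z / b)) (q : ℂ) :=
      (Complex.contDiffAt_log hs).comp (q : ℂ) (contDiffAt_id.div_const _)
    exact Complex.imCLM.contDiff.contDiffAt.comp _ (this.restrict_scalars ℝ)
  exact (h2.contMDiffAt.comp q h1).congr_of_eventuallyEq
    (.of_forall fun r => (Complex.log_im _).symm)

end Circle

/-! ### The projection to the circle -/

section Projection

variable {Y : Type*}

/-- A map to the circle whose fibres are the `Φ`-orbits, and along which `ψ` descends to the
rotation of speed `c`. -/
structure IsOrbitProjection (Φ : ℝ × ℝ → Y → Y) (ψ : ℝ → Y → Y) (p : Y → Circle) (c : ℝ) :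
    Prop where
  c_pos : 0 < c
  map_ψ_Φ : ∀ t v y, p (ψ t (Φ v y)) = p y * Circle.exp (c * t)
  exists_of_eq : ∀ y y', p y = p y' → ∃ v, y' = Φ v y

variable [TopologicalSpace Y] [ChartedSpace (EuclideanSpace ℝ (Fin 3)) Y]
  {Φ : ℝ × ℝ → Y → Y} {ψ : ℝ → Y → Y} {h : Y → ℝ} {p : Y → Circle} {c : ℝ}

/-- The height is well defined modulo the return times `lℤ`, so `exp (2π/l · height)` is independent
of the choices. Its speed along `ψ` is `c = 2π/l`. -/
lemma FrameFlow.exists_isOrbitProjection [CompactSpace Y] [ConnectedSpace Y]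
    (F : FrameFlow Φ ψ h) : ∃ p c, IsOrbitProjection Φ ψ p c := by
  obtain ⟨z⟩ : Nonempty Y := inferInstance
  obtain ⟨l, hl, hper⟩ := F.exists_periods_eq z
  have hexp (s t : ℝ) :
      Circle.exp (2 * Real.pi / l * s) = Circle.exp (2 * Real.pi / l * t) ↔ s - t ∈ F.periods z := by
    rw [Circle.exp_eq_exp, hper, AddSubgroup.mem_zmultiples_iff]
    refine exists_congr fun n => ?_
    have := Real.pi_pos
    rw [zsmul_eq_mul]
    constructor
    · intro e
      field_simp at e
      linarith
    · intro e
      field_simp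
      linarith
  refine ⟨fun y => Circle.exp (2 * Real.pi / l * F.height z y), 2 * Real.pi / l, by positivity,
    fun t v y => ?_, fun y y' e => ?_⟩
  · rw [← Circle.exp_add, ← mul_add, hexp]
    exact F.height_ψ_Φ z y t v
  · rw [hexp] at e
    obtain ⟨u, hu⟩ := F.height_spec z y
    obtain ⟨u', hu'⟩ := F.height_spec z y'
    obtain ⟨w, hw⟩ := e
    generalize F.height z y = a at hu hw
    generalize F.height z y' = a' at hu' hw
    -- `w` records the return `ψ (a - a') z = Φ w z`; the vector `x` rewrites `y'` as a point at
    -- height `a`, where it can be compared with `y`.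
    set x := F.monodromy z (a - a') (u' - w)
    have e2 : Φ u' z = ψ (a - a') (Φ x z) := by
      rw [← F.Φ_ψ, hw, ← F.Φ_add, sub_add_cancel]
    refine ⟨F.monodromyInv (Φ u z) a (x - u), ?_⟩
    rw [hu, ← F.ψ_Φ, ← F.Φ_add, sub_add_cancel, hu', e2, ← F.ψ_add, add_sub_cancel]

namespace IsOrbitProjection

lemma map_Φ (hp : IsOrbitProjection Φ ψ p c) (F : FrameFlow Φ ψ h) (v : ℝ × ℝ) (y : Y) :
    p (Φ v y) = p y := by
  have := hp.map_ψ_Φ 0 v y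
  rwa [F.ψ_zero, mul_zero, Circle.exp_zero, mul_one] at this

lemma map_ψ (hp : IsOrbitProjection Φ ψ p c) (F : FrameFlow Φ ψ h) (t : ℝ) (y : Y) :
    p (ψ t y) = p y * Circle.exp (c * t) := by
  have := hp.map_ψ_Φ t 0 y
  rwa [F.Φ_zero] at this

lemma map_σ (hp : IsOrbitProjection Φ ψ p c) {y : Y} (m : LocalModel Φ ψ h y) {w : ℝ × ℝ} {t : ℝ}
    (hm : (w, t) ∈ m.σ.source) : p (m.σ (w, t)) = p y * Circle.exp (c * t) := by
  rw [m.apply_eq hm, hp.map_ψ_Φ]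

lemma contMDiff (hp : IsOrbitProjection Φ ψ p c) (F : FrameFlow Φ ψ h) :
    ContMDiff (𝓡 3) (𝓡 1) ∞ p := by
  intro y
  obtain ⟨m⟩ := F.exists_localModel y
  have h1 : ContMDiffAt (𝓡 3) 𝓘(ℝ, (ℝ × ℝ) × ℝ) ∞ m.σ.symm y :=
    m.smooth_symm.contMDiffAt (m.σ.open_target.mem_nhds m.mem_target)
  have h2 : ContMDiff 𝓘(ℝ, (ℝ × ℝ) × ℝ) 𝓘(ℝ, ℝ) ∞ (fun q : (ℝ × ℝ) × ℝ => c * q.2) :=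
    (contDiff_const.mul contDiff_snd).contMDiff
  have h3 : ContMDiffAt (𝓡 3) (𝓡 1) ∞ (fun y' => Circle.exp (c * (m.σ.symm y').2)) y :=
    (contMDiff_circleExp.comp h2).contMDiffAt.comp y h1
  have := LieGroup.of_le (I := 𝓡 1) (G := Circle) (m := ∞) (n := ω) (by simp)
  refine ((contMDiffAt_const (c := p y)).mul h3).congr_of_eventuallyEq ?_
  filter_upwards [m.eventually_exists m.ε_pos] with y' hy'
  obtain ⟨w, t, -, -, hm, rfl⟩ := hy'
  rw [Pi.mul_apply, m.σ.left_inv hm, hp.map_σ m hm]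

lemma exists_apply_eq (hp : IsOrbitProjection Φ ψ p c) (F : FrameFlow Φ ψ h) [Nonempty Y]
    (b : Circle) : ∃ y, p y = b := by
  obtain ⟨z⟩ : Nonempty Y := inferInstance
  refine ⟨ψ (Circle.angleFrom (p z) b / c) z, ?_⟩
  rw [hp.map_ψ F, mul_div_cancel₀ _ hp.c_pos.ne', Circle.exp_angleFrom]

/-- A function constant on the `Φ`-orbits descends to the circle. -/
lemma exists_descend [Nonempty Y] (hp : IsOrbitProjection Φ ψ p c) (F : FrameFlow Φ ψ h) {f : Y → ℝ}
    (hf : ContMDiff (𝓡 3) 𝓘(ℝ, ℝ) ∞ f) (hΦ : ∀ v y, f (Φ v y) = f y) :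
    ∃ g : Circle → ℝ, ContMDiff (𝓡 1) 𝓘(ℝ, ℝ) ∞ g ∧ ∀ y, f y = g (p y) := by
  choose s hs using hp.exists_apply_eq F
  have hg (y : Y) : f y = f (s (p y)) := by
    obtain ⟨v, hv⟩ := hp.exists_of_eq (s (p y)) y (hs _)
    rw [hv, hΦ, hp.map_Φ F, hs]
  refine ⟨fun q => f (s q), fun b => ?_, hg⟩
  obtain ⟨m⟩ := F.exists_localModel (s b)
  have h0 : m.σ ((0 : ℝ × ℝ), Circle.angleFrom b b / c) = s b := by
    rw [Circle.angleFrom_self, zero_div]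
    exact m.map_zero
  have h1 : ContMDiffAt (𝓡 1) 𝓘(ℝ, ℝ) ∞ (Circle.angleFrom b) b :=
    Circle.contMDiffAt_angleFrom (Circle.neg_ne_self b).symm
  have h2 : ContMDiff 𝓘(ℝ, ℝ) 𝓘(ℝ, (ℝ × ℝ) × ℝ) ∞ (fun t : ℝ => ((0 : ℝ × ℝ), t / c)) :=
    (contDiff_const.prodMk (contDiff_id.div_const c)).contMDiff
  have h3 : ContMDiffAt (𝓡 1) 𝓘(ℝ, (ℝ × ℝ) × ℝ) ∞
      (fun q => ((0 : ℝ × ℝ), Circle.angleFrom b q / c)) b := h2.contMDiffAt.comp b h1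
  have hmem : ((0 : ℝ × ℝ), Circle.angleFrom b b / c) ∈ m.σ.source := by
    rw [Circle.angleFrom_self, zero_div]
    exact m.zero_mem_source
  have h4 : ContMDiffAt 𝓘(ℝ, (ℝ × ℝ) × ℝ) (𝓡 3) ∞ m.σ ((0 : ℝ × ℝ), Circle.angleFrom b b / c) :=
    m.smooth.contMDiffAt (m.σ.open_source.mem_nhds hmem)
  have h5 := hf.contMDiffAt.comp b (h4.comp b h3)
  refine h5.congr_of_eventuallyEq ?_
  have hev : ∀ᶠ q in 𝓝 b, ((0 : ℝ × ℝ), Circle.angleFrom b q / c) ∈ m.σ.source :=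
    h3.continuousAt (m.σ.open_source.mem_nhds hmem)
  filter_upwards [hev] with q hq
  have e : p (m.σ ((0 : ℝ × ℝ), Circle.angleFrom b q / c)) = q := by
    rw [hp.map_σ m hq, hs, mul_div_cancel₀ _ hp.c_pos.ne', Circle.exp_angleFrom]
  have := hg (m.σ ((0 : ℝ × ℝ), Circle.angleFrom b q / c))
  rw [e] at this
  exact this.symm

end IsOrbitProjection

end Projection

/-! ### The stabilizer lattice and the integral of the structure function -/

section Lattice

variable {Y : Type*} [TopologicalSpace Y] [ChartedSpace (EuclideanSpace ℝ (Fin 3)) Y]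
  {Φ : ℝ × ℝ → Y → Y} {ψ : ℝ → Y → Y} {h : Y → ℝ} {p : Y → Circle} {c : ℝ}

/-- A discrete spanning subgroup of the plane is the image of the integer lattice. -/
lemma exists_equiv_of_lattice (L : Submodule ℤ (ℝ × ℝ)) [DiscreteTopology L] [IsZLattice ℝ L] :
    ∃ B : (ℝ × ℝ) ≃L[ℝ] (ℝ × ℝ), ∀ v, v ∈ L ↔ ∃ m n : ℤ, v = B ((m : ℝ), (n : ℝ)) := by
  have hfin : Module.Finite ℤ L := ZLattice.module_finite ℝ L
  have hfree : Module.Free ℤ L := ZLattice.module_free ℝ L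
  have hr : Module.finrank ℤ L = 2 := by rw [ZLattice.rank ℝ L]; simp
  let b := Module.finBasisOfFinrankEq ℤ L hr
  let b' := b.ofZLatticeBasis ℝ L
  let B : (ℝ × ℝ) ≃ₗ[ℝ] (ℝ × ℝ) := (Module.Basis.finTwoProd ℝ).equiv b' (Equiv.refl _)
  have hB (x y : ℝ) : B (x, y) = x • (b 0 : ℝ × ℝ) + y • (b 1 : ℝ × ℝ) := by
    have e : (x, y) = x • Module.Basis.finTwoProd ℝ 0 + y • Module.Basis.finTwoProd ℝ 1 := by simp
    rw [e, map_add, map_smul, map_smul, Module.Basis.equiv_apply, Module.Basis.equiv_apply]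
    simp [b']
  refine ⟨B.toContinuousLinearEquiv, fun v => ?_⟩
  have hB' (m n : ℤ) : B.toContinuousLinearEquiv ((m : ℝ), (n : ℝ)) =
      ((m • b 0 + n • b 1 : L) : ℝ × ℝ) := by
    rw [Submodule.coe_add, Submodule.coe_smul, Submodule.coe_smul, ← Int.cast_smul_eq_zsmul ℝ,
      ← Int.cast_smul_eq_zsmul ℝ]
    exact hB _ _
  constructor
  · intro hv
    refine ⟨b.repr ⟨v, hv⟩ 0, b.repr ⟨v, hv⟩ 1, ?_⟩
    rw [hB', ← Fin.sum_univ_two (fun i => b.repr ⟨v, hv⟩ i • b i), b.sum_repr]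
  · rintro ⟨m, n, rfl⟩
    rw [hB']
    exact Subtype.coe_prop _

variable [CompactSpace Y]

lemma FrameFlow.discreteTopology_stabilizer (F : FrameFlow Φ ψ h) (z : Y) :
    DiscreteTopology (F.stabilizer z).toIntSubmodule := by
  obtain ⟨ε, hε, free⟩ := F.exists_free
  refine discreteTopology_of_isOpen_singleton_zero ?_
  have : ({0} : Set (F.stabilizer z).toIntSubmodule) =
      (fun v : (F.stabilizer z).toIntSubmodule => (v : ℝ × ℝ)) ⁻¹' Metric.ball 0 ε := by
    ext ⟨v, hv⟩
    simp only [mem_singleton_iff, mem_preimage, mem_ball_zero_iff]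
    constructor
    · intro e
      have e' : v = 0 := Subtype.ext_iff.mp e
      simpa [e'] using hε
    · intro hn
      exact Subtype.ext (free z v 0 hn (by simpa using hε) (by rw [F.ψ_zero]; exact hv)).1
  rw [this]
  exact Metric.isOpen_ball.preimage continuous_subtype_val

/-- A nonzero linear functional killing the stabilizer would descend to a continuous, unbounded
function on the fibre through `z`, which is compact. -/
lemma IsOrbitProjection.span_stabilizer (hp : IsOrbitProjection Φ ψ p c) (F : FrameFlow Φ ψ h)
    (z : Y) : Submodule.span ℝ (F.stabilizer z : Set (ℝ × ℝ)) = ⊤ := by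
  by_contra hne
  obtain ⟨f, hf0, hf⟩ := Submodule.exists_le_ker_of_lt_top _ (lt_top_iff_ne_top.mpr hne)
  have hfS : ∀ v ∈ F.stabilizer z, f v = 0 := fun v hv => hf (Submodule.subset_span hv)
  have hcomp : IsCompact (p ⁻¹' {p z}) :=
    (isClosed_singleton.preimage (hp.contMDiff F).continuous).isCompact
  have hex : ∀ y : Y, ∃ v, p z = p y → y = Φ v z := fun y => by
    by_cases e : p z = p y
    · obtain ⟨v, hv⟩ := hp.exists_of_eq z y e
      exact ⟨v, fun _ => hv⟩
    · exact ⟨0, fun e' => (e e').elim⟩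
  choose g hg using hex
  have key (v w : ℝ × ℝ) (e : Φ v z = Φ w z) : f v = f w := by
    rw [F.Φ_eq_Φ_iff] at e
    have := hfS _ e
    rwa [map_sub, sub_eq_zero] at this
  have hfc : Continuous f := f.continuous_of_finiteDimensional
  have hcont : ContinuousOn (fun y => f (g y)) (p ⁻¹' {p z}) := by
    intro y hy
    obtain ⟨m⟩ := F.exists_localModel y
    have h1 : ContinuousWithinAt (fun y' => f (g y + (m.σ.symm y').1)) (p ⁻¹' {p z}) y :=
      (hfc.continuousAt.comp (continuousAt_const.add
        (continuousAt_fst.comp (m.σ.continuousAt_symm m.mem_target)))).continuousWithinAt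
    refine h1.congr_of_eventuallyEq ?_ ?_
    · have hc := hp.c_pos
      -- Below `π / c` the transverse coordinate turns the circle by less than half a turn, so a
      -- nearby point of the same fibre has `t = 0`.
      have hev := m.eventually_exists (δ := Real.pi / c) (by have := Real.pi_pos; positivity)
      filter_upwards [nhdsWithin_le_nhds hev, self_mem_nhdsWithin] with y' hy' hyp
      obtain ⟨w, t, -, ht, hm, rfl⟩ := hy'
      have hpe : p (m.σ (w, t)) = p z := hyp
      have hpt := hp.map_σ m hm
      rw [hpe, (hy : p y = p z), eq_comm, mul_eq_left] at hpt
      have ht0 : t = 0 := by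
        have h3 : |c * t| < Real.pi := by
          rw [abs_mul, abs_of_pos hc]
          rwa [lt_div_iff₀ hc, mul_comm] at ht
        have h4 := Circle.arg_exp (neg_lt_of_abs_lt h3) (lt_of_abs_lt h3).le
        rw [hpt, Circle.coe_one, Complex.arg_one] at h4
        exact (mul_eq_zero.mp h4.symm).resolve_left hc.ne'
      refine key _ _ ?_
      rw [← hg _ hpe.symm, m.σ.left_inv hm, m.apply_eq hm, ht0, F.ψ_zero, add_comm, F.Φ_add,
        ← hg y (hy : p y = p z).symm]
    · rw [m.symm_apply_self]
      simp
  obtain ⟨C, hC⟩ := (hcomp.image_of_continuousOn hcont).bddAbove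
  obtain ⟨v, hv⟩ : ∃ v, f v = C + 1 := f.surjective hf0 (C + 1)
  have hm : p (Φ v z) = p z := hp.map_Φ F v z
  have h1 := hC ⟨Φ v z, hm, rfl⟩
  have h2 := key _ _ (hg (Φ v z) hm.symm)
  simp only [← h2, hv] at h1
  linarith

lemma IsOrbitProjection.exists_lattice_equiv (hp : IsOrbitProjection Φ ψ p c)
    (F : FrameFlow Φ ψ h) (z : Y) : ∃ B : (ℝ × ℝ) ≃L[ℝ] (ℝ × ℝ),
      ∀ v, v ∈ F.stabilizer z ↔ ∃ m n : ℤ, v = B ((m : ℝ), (n : ℝ)) := by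
  have := F.discreteTopology_stabilizer z
  have : IsZLattice ℝ (F.stabilizer z).toIntSubmodule := ⟨hp.span_stabilizer F z⟩
  exact exists_equiv_of_lattice (F.stabilizer z).toIntSubmodule

/-! ### The integral of the structure function -/

/-- The determinant of an endomorphism of the plane. -/
def planeDet (A : (ℝ × ℝ) →L[ℝ] (ℝ × ℝ)) : ℝ :=
  (A (1, 0)).1 * (A (0, 1)).2 - (A (1, 0)).2 * (A (0, 1)).1

lemma apply_eq_smul_add (A : (ℝ × ℝ) →L[ℝ] (ℝ × ℝ)) (u : ℝ × ℝ) :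
    A u = u.1 • A (1, 0) + u.2 • A (0, 1) := by
  rw [← map_smul, ← map_smul, ← map_add]
  simp

lemma planeDet_comp (A B : (ℝ × ℝ) →L[ℝ] (ℝ × ℝ)) :
    planeDet (A.comp B) = planeDet A * planeDet B := by
  simp only [planeDet, ContinuousLinearMap.comp_apply]
  rw [apply_eq_smul_add A (B (1, 0)), apply_eq_smul_add A (B (0, 1))]
  simp only [Prod.fst_add, Prod.smul_fst, Prod.snd_add, Prod.smul_snd, smul_eq_mul]
  ring

lemma planeDet_id : planeDet (ContinuousLinearMap.id ℝ (ℝ × ℝ)) = 1 := by simp [planeDet]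

lemma FrameFlow.hasDerivAt_planeDet (F : FrameFlow Φ ψ h) (z : Y) (t : ℝ) :
    HasDerivAt (fun t => planeDet (F.monodromy z t))
      (-h (ψ t z) * planeDet (F.monodromy z t)) t := by
  have hd (u : ℝ × ℝ) : HasDerivAt (fun t => F.monodromy z t u)
      (F.monodromy z t (frameGenerator (h (ψ t z)) u)) t := by
    simpa using (F.hasDerivAt_monodromy z t).clm_apply (hasDerivAt_const t u)
  have h1 := hd (1, 0)
  have h2 := hd (0, 1)
  rw [frameGenerator_apply, apply_eq_smul_add] at h1 h2
  have := (h1.fst'.mul h2.snd').sub (h1.snd'.mul h2.fst')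
  refine this.congr_deriv ?_
  simp [planeDet]
  ring

/-- Liouville's formula; the trace of `frameGenerator i` is `-i`. -/
lemma FrameFlow.planeDet_mul_exp (F : FrameFlow Φ ψ h) (z : Y) (t : ℝ) :
    planeDet (F.monodromy z t) = Real.exp (-∫ s in (0 : ℝ)..t, h (ψ s z)) := by
  have hc : Continuous fun s => h (ψ s z) := F.smooth_h.continuous.comp (F.continuous_ψ z)
  have hd (t : ℝ) : HasDerivAt (fun t => planeDet (F.monodromy z t) *
      Real.exp (∫ s in (0 : ℝ)..t, h (ψ s z))) 0 t := by
    have h1 := (hc.integral_hasStrictDerivAt 0 t).hasDerivAt.exp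
    refine ((F.hasDerivAt_planeDet z t).mul h1).congr_deriv ?_
    ring
  have := is_const_of_deriv_eq_zero (fun t => (hd t).differentiableAt) (fun t => (hd t).deriv) t 0
  simp only [F.monodromy_zero, planeDet_id, intervalIntegral.integral_same, Real.exp_zero,
    mul_one] at this
  rw [Real.exp_neg, eq_inv_of_mul_eq_one_left this]

/-- At a return time the monodromy and its inverse preserve the stabilizer lattice, so both
determinants are integers with product `1`. Liouville's formula makes them positive, hence `1`. -/
lemma IsOrbitProjection.integral_eq_zero (hp : IsOrbitProjection Φ ψ p c) (F : FrameFlow Φ ψ h)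
    (z : Y) {t : ℝ} (ht : t ∈ F.periods z) : ∫ s in (0 : ℝ)..t, h (ψ s z) = 0 := by
  obtain ⟨B, hB⟩ := hp.exists_lattice_equiv F z
  have hint : ∀ t ∈ F.periods z, ∃ n : ℤ, planeDet (F.monodromy z t) = n := by
    intro t ht
    have hmem (m n : ℤ) : ∃ m' n' : ℤ,
        F.monodromy z t (B ((m : ℝ), (n : ℝ))) = B ((m' : ℝ), (n' : ℝ)) :=
      (hB _).mp (F.monodromy_mem_stabilizer ht ((hB _).mpr ⟨m, n, rfl⟩))
    obtain ⟨m₁, n₁, e₁⟩ := hmem 1 0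
    obtain ⟨m₂, n₂, e₂⟩ := hmem 0 1
    have e : planeDet ((B.symm : (ℝ × ℝ) →L[ℝ] (ℝ × ℝ)).comp ((F.monodromy z t).comp
        (B : (ℝ × ℝ) →L[ℝ] (ℝ × ℝ)))) = planeDet (F.monodromy z t) := by
      have h1 : planeDet ((B.symm : (ℝ × ℝ) →L[ℝ] (ℝ × ℝ)).comp
          (B : (ℝ × ℝ) →L[ℝ] (ℝ × ℝ))) = 1 := by
        rw [ContinuousLinearEquiv.coe_symm_comp_coe, planeDet_id]
      rw [planeDet_comp] at h1
      rw [planeDet_comp, planeDet_comp]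
      linear_combination planeDet (F.monodromy z t) * h1
    refine ⟨m₁ * n₂ - n₁ * m₂, ?_⟩
    rw [← e]
    simp only [Int.cast_one, Int.cast_zero] at e₁ e₂
    simp [planeDet, e₁, e₂]
  obtain ⟨m, hm⟩ := hint t ht
  obtain ⟨n, hn⟩ := hint (-t) ((F.periods z).neg_mem ht)
  have h1 : planeDet (F.monodromy z t) * planeDet (F.monodromy z (-t)) = 1 := by
    rw [← planeDet_comp, ← F.monodromy_add_of_mem ht, add_neg_cancel, F.monodromy_zero, planeDet_id]
  have hpos : 0 < planeDet (F.monodromy z t) := by rw [F.planeDet_mul_exp]; exact Real.exp_pos _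
  rw [hm] at h1 hpos
  rw [hn] at h1
  have hm1 : m = 1 := by
    have h2 : m * n = 1 := by exact_mod_cast h1
    have h3 : 0 < m := by exact_mod_cast hpos
    exact Int.eq_one_of_mul_eq_one_right h3.le h2
  rw [F.planeDet_mul_exp, hm1, Int.cast_one, Real.exp_eq_one_iff, neg_eq_zero] at hm
  exact hm

/-- Starting over `1`, the time `2π/c` is a full turn and hence a return; the substitution `θ = c s`
does the rest. -/
lemma IsOrbitProjection.integral_descend_eq_zero (hp : IsOrbitProjection Φ ψ p c)
    (F : FrameFlow Φ ψ h) [Nonempty Y] {g : Circle → ℝ} (hg : ∀ y, h y = g (p y)) :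
    ∫ θ in (0 : ℝ)..(2 * Real.pi), g (Circle.exp θ) = 0 := by
  obtain ⟨z, hz⟩ := hp.exists_apply_eq F 1
  have hc := hp.c_pos
  have hper : 2 * Real.pi / c ∈ F.periods z := by
    refine hp.exists_of_eq z _ ?_
    rw [hp.map_ψ F, mul_div_cancel₀ _ hc.ne', Circle.exp_two_pi, mul_one]
  have e (θ : ℝ) : g (Circle.exp θ) = h (ψ (θ / c) z) := by
    rw [hg, hp.map_ψ F, hz, one_mul, mul_div_cancel₀ _ hc.ne']
  simp only [e]
  rw [intervalIntegral.integral_comp_div (fun s => h (ψ s z)) hc.ne', zero_div,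
    hp.integral_eq_zero F z hper, smul_zero]

end Lattice

/-! ### The torus as a quotient of the plane -/

section Torus

/-- The covering of the torus by the plane. -/
def torusExp (v : ℝ × ℝ) : Circle × Circle :=
  (Circle.exp (2 * Real.pi * v.1), Circle.exp (2 * Real.pi * v.2))

/-- A local inverse of `torusExp` relative to the base point `r₀`. -/
def torusLog (r₀ r : Circle × Circle) : ℝ × ℝ :=
  (Circle.angleFrom r₀.1 r.1 / (2 * Real.pi), Circle.angleFrom r₀.2 r.2 / (2 * Real.pi))

lemma torusExp_add (v w : ℝ × ℝ) : torusExp (v + w) = torusExp v * torusExp w := by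
  simp [torusExp, mul_add, Circle.exp_add]

lemma mul_torusExp_torusLog (r₀ r : Circle × Circle) : r₀ * torusExp (torusLog r₀ r) = r := by
  have : 2 * Real.pi ≠ 0 := by positivity
  refine Prod.ext ?_ ?_ <;>
    simp only [torusExp, torusLog, Prod.fst_mul, Prod.snd_mul, mul_div_cancel₀ _ this,
      Circle.exp_angleFrom]

lemma torusLog_self (r : Circle × Circle) : torusLog r r = 0 := by
  simp [torusLog, Circle.angleFrom_self]

lemma torusExp_eq_iff (v w : ℝ × ℝ) :
    torusExp v = torusExp w ↔ ∃ m n : ℤ, v - w = ((m : ℝ), (n : ℝ)) := by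
  have : 2 * Real.pi ≠ 0 := by positivity
  have key (x y : ℝ) : Circle.exp (2 * Real.pi * x) = Circle.exp (2 * Real.pi * y) ↔
      ∃ m : ℤ, x - y = m := by
    rw [Circle.exp_eq_exp]
    refine exists_congr fun m => ?_
    constructor
    · intro e
      refine mul_left_cancel₀ this ?_
      linarith
    · intro e
      rw [← e]
      ring
  simp only [torusExp, key, Prod.ext_iff, Prod.fst_sub, Prod.snd_sub]
  exact ⟨fun ⟨⟨m, hm⟩, ⟨n, hn⟩⟩ => ⟨m, n, hm, hn⟩, fun ⟨m, n, hm, hn⟩ => ⟨⟨m, hm⟩, ⟨n, hn⟩⟩⟩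

lemma contMDiff_torusExp : ContMDiff 𝓘(ℝ, ℝ × ℝ) ((𝓡 1).prod (𝓡 1)) ∞ torusExp := by
  refine ContMDiff.prodMk ?_ ?_
  · exact contMDiff_circleExp.comp (contDiff_const.mul contDiff_fst).contMDiff
  · exact contMDiff_circleExp.comp (contDiff_const.mul contDiff_snd).contMDiff

lemma contMDiffAt_torusLog (r : Circle × Circle) :
    ContMDiffAt ((𝓡 1).prod (𝓡 1)) 𝓘(ℝ, ℝ × ℝ) ∞ (torusLog r) r := by
  have hdiv : ContMDiff 𝓘(ℝ, ℝ) 𝓘(ℝ, ℝ) ∞ fun x : ℝ => x / (2 * Real.pi) :=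
    (contDiff_id.div_const _).contMDiff
  have h1 : ContMDiffAt ((𝓡 1).prod (𝓡 1)) 𝓘(ℝ, ℝ) ∞ (fun r' : Circle × Circle =>
      Circle.angleFrom r.1 r'.1 / (2 * Real.pi)) r :=
    hdiv.contMDiffAt.comp r ((Circle.contMDiffAt_angleFrom (Circle.neg_ne_self r.1).symm).comp r
      contMDiffAt_fst)
  have h2 : ContMDiffAt ((𝓡 1).prod (𝓡 1)) 𝓘(ℝ, ℝ) ∞ (fun r' : Circle × Circle =>
      Circle.angleFrom r.2 r'.2 / (2 * Real.pi)) r :=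
    hdiv.contMDiffAt.comp r ((Circle.contMDiffAt_angleFrom (Circle.neg_ne_self r.2).symm).comp r
      contMDiffAt_snd)
  exact h1.prodMk_space h2

end Torus

/-! ### Local trivializations with torus fibre -/

namespace IsOrbitProjection

variable {Y : Type*} [TopologicalSpace Y] [ChartedSpace (EuclideanSpace ℝ (Fin 3)) Y]
  {Φ : ℝ × ℝ → Y → Y} {ψ : ℝ → Y → Y} {h : Y → ℝ} {p : Y → Circle} {c : ℝ} [CompactSpace Y]

omit [CompactSpace Y] in
lemma exists_coord (hp : IsOrbitProjection Φ ψ p c) (F : FrameFlow Φ ψ h) (z y : Y)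
    (B : (ℝ × ℝ) ≃L[ℝ] (ℝ × ℝ)) :
    ∃ v, y = ψ (Circle.angleFrom (p z) (p y) / c) (Φ (B v) z) := by
  obtain ⟨u, hu⟩ := hp.exists_of_eq z (ψ (-(Circle.angleFrom (p z) (p y) / c)) y) (by
    rw [hp.map_ψ F, mul_neg, mul_div_cancel₀ _ hp.c_pos.ne', Circle.exp_neg,
      eq_mul_inv_iff_mul_eq, Circle.exp_angleFrom])
  exact ⟨B.symm u, by rw [B.apply_symm_apply, ← hu, F.ψ_apply_neg]⟩

/-- Linear coordinates along the fibres of the projection. -/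
def coord (hp : IsOrbitProjection Φ ψ p c) (F : FrameFlow Φ ψ h) (z : Y)
    (B : (ℝ × ℝ) ≃L[ℝ] (ℝ × ℝ)) (y : Y) : ℝ × ℝ :=
  (hp.exists_coord F z y B).choose

omit [CompactSpace Y] in
lemma eq_coord (hp : IsOrbitProjection Φ ψ p c) (F : FrameFlow Φ ψ h) (z : Y)
    (B : (ℝ × ℝ) ≃L[ℝ] (ℝ × ℝ)) (y : Y) :
    ψ (Circle.angleFrom (p z) (p y) / c) (Φ (B (hp.coord F z B y)) z) = y :=
  (hp.exists_coord F z y B).choose_spec.symm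

/-- The stabilizer is `B(ℤ²)`, the image under `B` of the kernel of `torusExp`. This makes the
arbitrary choice in `coord` harmless after applying `torusExp`. -/
lemma ψ_Φ_eq_iff (_hp : IsOrbitProjection Φ ψ p c) (F : FrameFlow Φ ψ h) {z : Y}
    {B : (ℝ × ℝ) ≃L[ℝ] (ℝ × ℝ)}
    (hB : ∀ v, v ∈ F.stabilizer z ↔ ∃ m n : ℤ, v = B ((m : ℝ), (n : ℝ))) (t : ℝ) (v w : ℝ × ℝ) :
    ψ t (Φ (B v) z) = ψ t (Φ (B w) z) ↔ torusExp v = torusExp w := by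
  rw [(F.ψ_injective t).eq_iff, F.Φ_eq_Φ_iff, ← map_sub, hB, torusExp_eq_iff]
  simp only [B.injective.eq_iff]

/-- The coordinate on the torus fibre. -/
def toTorus (hp : IsOrbitProjection Φ ψ p c) (F : FrameFlow Φ ψ h) (z : Y)
    (B : (ℝ × ℝ) ≃L[ℝ] (ℝ × ℝ)) (y : Y) : Circle × (Circle × Circle) :=
  (p y, torusExp (hp.coord F z B y))

/-- The inverse of `toTorus`. -/
def ofTorus (_hp : IsOrbitProjection Φ ψ p c) (z : Y) (B : (ℝ × ℝ) ≃L[ℝ] (ℝ × ℝ))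
    (q : Circle × (Circle × Circle)) : Y :=
  ψ (Circle.angleFrom (p z) q.1 / c) (Φ (B (torusLog 1 q.2)) z)

omit [TopologicalSpace Y] [ChartedSpace (EuclideanSpace ℝ (Fin 3)) Y] [CompactSpace Y] in
lemma map_ofTorus (hp : IsOrbitProjection Φ ψ p c) (z : Y)
    (B : (ℝ × ℝ) ≃L[ℝ] (ℝ × ℝ)) (q : Circle × (Circle × Circle)) : p (hp.ofTorus z B q) = q.1 := by
  rw [ofTorus, hp.map_ψ_Φ, mul_div_cancel₀ _ hp.c_pos.ne', Circle.exp_angleFrom]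

variable {z : Y} {B : (ℝ × ℝ) ≃L[ℝ] (ℝ × ℝ)}

lemma ofTorus_toTorus (hp : IsOrbitProjection Φ ψ p c) (F : FrameFlow Φ ψ h)
    (hB : ∀ v, v ∈ F.stabilizer z ↔ ∃ m n : ℤ, v = B ((m : ℝ), (n : ℝ))) (y : Y) :
    hp.ofTorus z B (hp.toTorus F z B y) = y := by
  refine Eq.trans ?_ (hp.eq_coord F z B y)
  refine (hp.ψ_Φ_eq_iff F hB _ _ _).mpr ?_
  exact (one_mul _).symm.trans (mul_torusExp_torusLog 1 (torusExp (hp.coord F z B y)))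

lemma toTorus_ofTorus (hp : IsOrbitProjection Φ ψ p c) (F : FrameFlow Φ ψ h)
    (hB : ∀ v, v ∈ F.stabilizer z ↔ ∃ m n : ℤ, v = B ((m : ℝ), (n : ℝ)))
    (q : Circle × (Circle × Circle)) : hp.toTorus F z B (hp.ofTorus z B q) = q := by
  refine Prod.ext (hp.map_ofTorus z B q) ?_
  have h1 := hp.eq_coord F z B (hp.ofTorus z B q)
  rw [hp.map_ofTorus] at h1
  have h2 := (hp.ψ_Φ_eq_iff F hB _ _ _).mp h1
  refine h2.trans ?_
  simpa using mul_torusExp_torusLog 1 q.2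

/-- `coord` itself may jump, but near `y` it agrees modulo `ℤ²` with an affine function of the plane
coordinate of a model chart. Away from the antipode of `p z` the angle does not jump either. -/
lemma contMDiffAt_toTorus (hp : IsOrbitProjection Φ ψ p c) (F : FrameFlow Φ ψ h)
    (hB : ∀ v, v ∈ F.stabilizer z ↔ ∃ m n : ℤ, v = B ((m : ℝ), (n : ℝ))) {y : Y}
    (hy : p y ≠ -p z) :
    ContMDiffAt (𝓡 3) ((𝓡 1).prod ((𝓡 1).prod (𝓡 1))) ∞ (hp.toTorus F z B) y := by
  refine ContMDiffAt.prodMk (hp.contMDiff F y) ?_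
  obtain ⟨m⟩ := F.exists_localModel y
  have hc := hp.c_pos
  set t₀ := Circle.angleFrom (p z) (p y) / c with ht₀
  set v₀ := hp.coord F z B y
  have hct₀ : c * t₀ = Circle.angleFrom (p z) (p y) := mul_div_cancel₀ _ hc.ne'
  have hy₀ : ψ t₀ (Φ (B v₀) z) = y := hp.eq_coord F z B y
  have h1 : ContMDiffAt (𝓡 3) 𝓘(ℝ, (ℝ × ℝ) × ℝ) ∞ m.σ.symm y :=
    m.smooth_symm.contMDiffAt (m.σ.open_target.mem_nhds m.mem_target)
  have h2 : ContMDiff 𝓘(ℝ, (ℝ × ℝ) × ℝ) 𝓘(ℝ, ℝ × ℝ) ∞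
      (fun q : (ℝ × ℝ) × ℝ => B.symm (F.monodromy z t₀ q.1) + v₀) :=
    ((B.symm.contDiff.comp ((F.monodromy z t₀).contDiff.comp contDiff_fst)).add
      contDiff_const).contMDiff
  refine ((contMDiff_torusExp.comp h2).contMDiffAt.comp y h1).congr_of_eventuallyEq ?_
  have hopen : ∀ᶠ y' in 𝓝 y, c * (t₀ + (m.σ.symm y').2) ∈ Ioo (-Real.pi) Real.pi := by
    have hcont : ContinuousAt (fun y' => c * (t₀ + (m.σ.symm y').2)) y :=
      continuousAt_const.mul (continuousAt_const.add (continuousAt_snd.comp h1.continuousAt))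
    refine hcont (Ioo_mem_nhds ?_ ?_)
    · simp only [m.symm_apply_self, Prod.snd_zero, add_zero, hct₀]
      exact Circle.neg_pi_lt_angleFrom _ _
    · simp only [m.symm_apply_self, Prod.snd_zero, add_zero, hct₀]
      exact Circle.angleFrom_lt hy
  filter_upwards [m.eventually_exists m.ε_pos, hopen] with y' hy' hI
  obtain ⟨w, s, -, -, hm, rfl⟩ := hy'
  rw [m.σ.left_inv hm] at hI
  have e1 : Circle.angleFrom (p z) (p (m.σ (w, s))) / c = t₀ + s := by
    have e : p (m.σ (w, s)) = p z * Circle.exp (c * (t₀ + s)) := by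
      rw [hp.map_σ m hm, mul_add, Circle.exp_add, hct₀, ← mul_assoc, Circle.exp_angleFrom]
    rw [e, Circle.angleFrom_mul_exp _ hI.1 hI.2.le, mul_div_cancel_left₀ _ hc.ne']
  have e2 := hp.eq_coord F z B (m.σ (w, s))
  rw [e1] at e2
  have e3 : m.σ (w, s) =
      ψ (t₀ + s) (Φ (B (B.symm (F.monodromy z t₀ w) + v₀)) z) := by
    rw [m.apply_eq hm]
    nth_rw 1 [← hy₀]
    rw [F.Φ_ψ, F.monodromy_Φ, ← F.Φ_add, ← F.ψ_add, add_comm s, map_add, B.apply_symm_apply]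
  simp only [Function.comp_apply, m.σ.left_inv hm]
  exact (hp.ψ_Φ_eq_iff F hB _ _ _).mp (e2.trans e3)

lemma contMDiffAt_ofTorus (hp : IsOrbitProjection Φ ψ p c) (F : FrameFlow Φ ψ h)
    (hB : ∀ v, v ∈ F.stabilizer z ↔ ∃ m n : ℤ, v = B ((m : ℝ), (n : ℝ)))
    {q : Circle × (Circle × Circle)} (hq : q.1 ≠ -p z) :
    ContMDiffAt ((𝓡 1).prod ((𝓡 1).prod (𝓡 1))) (𝓡 3) ∞ (hp.ofTorus z B) q := by
  set y := hp.ofTorus z B q with hy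
  obtain ⟨m⟩ := F.exists_localModel y
  set t₀ := Circle.angleFrom (p z) q.1 / c with ht₀
  -- `ofTorus` uses the logarithm based at `1`, which is discontinuous. In the model chart it is
  -- replaced by the logarithm based at `q.2`, smooth near `q.2`; the two describe the same point of
  -- `Y`.
  set f : Circle × (Circle × Circle) → (ℝ × ℝ) × ℝ := fun q' =>
    (F.monodromyInv z t₀ (B (torusLog q.2 q'.2)), Circle.angleFrom (p z) q'.1 / c - t₀) with hf
  have hfq : f q = 0 := by simp [hf, torusLog_self, ht₀]
  have h1 : ContMDiffAt ((𝓡 1).prod ((𝓡 1).prod (𝓡 1))) 𝓘(ℝ, ℝ × ℝ) ∞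
      (fun q' : Circle × (Circle × Circle) =>
        F.monodromyInv z t₀ (B (torusLog q.2 q'.2))) q := by
    have : ContMDiff 𝓘(ℝ, ℝ × ℝ) 𝓘(ℝ, ℝ × ℝ) ∞
        (fun v : ℝ × ℝ => F.monodromyInv z t₀ (B v)) :=
      ((F.monodromyInv z t₀).contDiff.comp B.contDiff).contMDiff
    exact this.contMDiffAt.comp q ((contMDiffAt_torusLog q.2).comp q contMDiffAt_snd)
  have h2 : ContMDiffAt ((𝓡 1).prod ((𝓡 1).prod (𝓡 1))) 𝓘(ℝ, ℝ) ∞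
      (fun q' : Circle × (Circle × Circle) => Circle.angleFrom (p z) q'.1 / c - t₀) q := by
    have : ContMDiff 𝓘(ℝ, ℝ) 𝓘(ℝ, ℝ) ∞ (fun t : ℝ => t / c - t₀) :=
      ((contDiff_id.div_const c).sub contDiff_const).contMDiff
    exact this.contMDiffAt.comp q ((Circle.contMDiffAt_angleFrom hq).comp q contMDiffAt_fst)
  have h3 : ContMDiffAt ((𝓡 1).prod ((𝓡 1).prod (𝓡 1))) 𝓘(ℝ, (ℝ × ℝ) × ℝ) ∞ f q :=
    h1.prodMk_space h2
  have h4 : ContMDiffAt 𝓘(ℝ, (ℝ × ℝ) × ℝ) (𝓡 3) ∞ m.σ (f q) :=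
    m.smooth.contMDiffAt (m.σ.open_source.mem_nhds (by rw [hfq]; exact m.zero_mem_source))
  refine (h4.comp q h3).congr_of_eventuallyEq ?_
  have hev : ∀ᶠ q' in 𝓝 q, f q' ∈ m.σ.source :=
    h3.continuousAt (m.σ.open_source.mem_nhds (by rw [hfq]; exact m.zero_mem_source))
  filter_upwards [hev] with q' hq'
  have e1 := m.apply_eq hq'
  refine Eq.trans ?_ e1.symm
  have hy' : y = ψ t₀ (Φ (B (torusLog 1 q.2)) z) := rfl
  rw [hy', F.Φ_ψ, F.monodromy_Φ, F.monodromy_monodromyInv, ← F.Φ_add, ← map_add,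
    ← F.ψ_add, sub_add_cancel, ofTorus, hp.ψ_Φ_eq_iff F hB, torusExp_add]
  have e2 := mul_torusExp_torusLog 1 q'.2
  have e3 := mul_torusExp_torusLog 1 q.2
  rw [one_mul] at e2 e3
  rw [e2, e3, mul_comm, mul_torusExp_torusLog]

lemma isSmoothTorusBundle [Nonempty Y] (hp : IsOrbitProjection Φ ψ p c) (F : FrameFlow Φ ψ h) :
    IsSmoothTorusBundle p := by
  intro b
  obtain ⟨z, rfl⟩ := hp.exists_apply_eq F b
  obtain ⟨B, hB⟩ := hp.exists_lattice_equiv F z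
  -- Only the antipode is removed: it is where the angle measured from `p z` jumps.
  have hbase : IsOpen ({-p z}ᶜ : Set Circle) := isClosed_singleton.isOpen_compl
  have h1 : ContMDiffOn (𝓡 3) ((𝓡 1).prod ((𝓡 1).prod (𝓡 1))) ∞ (hp.toTorus F z B)
      (p ⁻¹' {-p z}ᶜ) := fun y hy => (hp.contMDiffAt_toTorus F hB hy).contMDiffWithinAt
  have h2 : ContMDiffOn ((𝓡 1).prod ((𝓡 1).prod (𝓡 1))) (𝓡 3) ∞ (hp.ofTorus z B)
      ({-p z}ᶜ ×ˢ univ) := fun q hq => (hp.contMDiffAt_ofTorus F hB hq.1).contMDiffWithinAt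
  let e : Trivialization (Circle × Circle) p :=
    { toFun := hp.toTorus F z B
      invFun := hp.ofTorus z B
      source := p ⁻¹' {-p z}ᶜ
      target := {-p z}ᶜ ×ˢ univ
      map_source' := fun y hy => ⟨hy, mem_univ _⟩
      map_target' := fun q hq => by
        rw [mem_preimage, hp.map_ofTorus]
        exact hq.1
      left_inv' := fun y _ => hp.ofTorus_toTorus F hB y
      right_inv' := fun q _ => hp.toTorus_ofTorus F hB q
      open_source := hbase.preimage (hp.contMDiff F).continuous
      open_target := hbase.prod isOpen_univ
      continuousOn_toFun := h1.continuousOn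
      continuousOn_invFun := h2.continuousOn
      baseSet := {-p z}ᶜ
      open_baseSet := hbase
      source_eq := rfl
      target_eq := rfl
      proj_toFun := fun _ _ => rfl }
  exact ⟨e, (Circle.neg_ne_self (p z)).symm, h1, h2⟩

end IsOrbitProjection

/-! ### Derivatives along the frame and conclusion -/

section Derivative

variable {Y : Type*} [TopologicalSpace Y] [ChartedSpace (EuclideanSpace ℝ (Fin 3)) Y]

lemma mfderiv_apply_eq_zero_of_const_on_integralCurve {p : Y → Circle} {V : VField Y} {γ : ℝ → Y}
    (hγ : IsMIntegralCurve (I := 𝓡 3) γ V) {t : ℝ} (hp : MDifferentiableAt (𝓡 3) (𝓡 1) p (γ t))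
    (hc : ∀ s, p (γ s) = p (γ t)) : mfderiv (𝓡 3) (𝓡 1) p (γ t) (V (γ t)) = 0 := by
  have h1 := (hp.hasMFDerivAt.comp t (hγ t)).mfderiv
  have h2 : p ∘ γ = fun _ => p (γ t) := funext hc
  rw [h2, mfderiv_const] at h1
  have h3 := congrArg (fun L => L (1 : ℝ)) h1
  have e : mfderiv (𝓡 3) (𝓡 1) p (γ t) ((1 : ℝ) • V (γ t))
      = mfderiv (𝓡 3) (𝓡 1) p (γ t) (V (γ t)) := by rw [one_smul]
  exact e.symm.trans h3.symm

lemma mfderiv_apply_eq_of_hasDerivAt {E : Type*} [NormedAddCommGroup E] [NormedSpace ℝ E]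
    {f : Y → E} {V : VField Y} {γ : ℝ → Y} (hγ : IsMIntegralCurve (I := 𝓡 3) γ V) {t : ℝ} {v : E}
    (hf : MDifferentiableAt (𝓡 3) 𝓘(ℝ, E) f (γ t)) (hv : HasDerivAt (f ∘ γ) v t) :
    mfderiv (𝓡 3) 𝓘(ℝ, E) f (γ t) (V (γ t)) = v := by
  have h1 := hasMFDerivAt_unique (hf.hasMFDerivAt.comp t (hγ t)) hv.hasFDerivAt.hasMFDerivAt
  have h3 := DFunLike.congr_fun h1 (1 : ℝ)
  have e : mfderiv (𝓡 3) 𝓘(ℝ, E) f (γ t) ((1 : ℝ) • V (γ t))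
      = mfderiv (𝓡 3) 𝓘(ℝ, E) f (γ t) (V (γ t)) := by rw [one_smul]
  exact e.symm.trans (h3.trans (one_smul ℝ v))

end Derivative

theorem theorem1p5 {Y : Type*} [TopologicalSpace Y] [ChartedSpace (EuclideanSpace ℝ (Fin 3)) Y]
    [IsManifold (𝓡 3) ∞ Y] [T2Space Y] [CompactSpace Y] [ConnectedSpace Y]
    (lam : OneForm Y) (R X₁ X₂ : VField Y) (I J K : Y → ℝ)
    (hframe : IsContactCanonicalFrame lam R X₁ X₂ I J K)
    (hK : ∀ y, K y = 0) :
    (∀ y, J y = 0) ∧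
    ∃ p : Y → Circle,
      ContMDiff (𝓡 3) (𝓡 1) ∞ p ∧
      IsSmoothTorusBundle p ∧
      (∀ y, mfderiv (𝓡 3) (𝓡 1) p y (R y) = 0) ∧
      (∀ y, mfderiv (𝓡 3) (𝓡 1) p y (X₁ y) = 0) ∧
      (∃ c : ℝ, 0 < c ∧ ∀ y,
        mfderiv (𝓡 3) 𝓘(ℝ, ℂ) (fun y => (p y : ℂ)) y (X₂ y) =
          (c • (Complex.I * (p y : ℂ)) : ℂ)) ∧
      ∃ I' : Circle → ℝ,
        ContMDiff (𝓡 1) 𝓘(ℝ, ℝ) ∞ I' ∧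
        (∀ y, I y = I' (p y)) ∧
        ∫ θ in (0 : ℝ)..(2 * Real.pi), I' (Circle.exp θ) = 0 := by
  obtain ⟨hJ, hf⟩ := hframe.structure_functions hK
  obtain ⟨hc, hc₃⟩ := hf.complete
  have F := hf.frameFlow hc hc₃
  obtain ⟨p, c, hp⟩ := F.exists_isOrbitProjection
  have hsm := hp.contMDiff F
  obtain ⟨g, hg, hgI⟩ := hp.exists_descend F F.smooth_h F.h_Φ
  have htan (u : ℝ × ℝ) (y : Y) : mfderiv (𝓡 3) (𝓡 1) p y (R.comb X₁ u y) = 0 := by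
    have h1 := mfderiv_apply_eq_zero_of_const_on_integralCurve ((hc u).isMIntegralCurve y) (t := 0)
      ((hsm _).mdifferentiableAt (by simp)) (fun s => by
        have h2 (s : ℝ) : p ((hc u).flow s y) = p y := by
          rw [← planeFlow_smul hc hf.smooth₁ hf.smooth₂]
          exact hp.map_Φ F _ y
        rw [h2, h2])
    rwa [(hc u).flow_zero] at h1
  have hcoe : ContMDiff (𝓡 3) 𝓘(ℝ, ℂ) ∞ fun y => (p y : ℂ) := by
    have := finrank_real_complex_fact'
    exact (contMDiff_coe_sphere (n := 1) (E := ℂ)).comp hsm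
  refine ⟨hJ, p, hsm, hp.isSmoothTorusBundle F, fun y => ?_, fun y => ?_,
    ⟨c, hp.c_pos, fun y => ?_⟩, g, hg, hgI, hp.integral_descend_eq_zero F hgI⟩
  · simpa [VField.comb] using htan (1, 0) y
  · simpa [VField.comb] using htan (0, 1) y
  · have h1 : HasDerivAt ((fun y => (p y : ℂ)) ∘ fun t => hc₃.flow t y)
        (c • (Complex.I * (p y : ℂ)) : ℂ) 0 := by
      have e : (fun y => (p y : ℂ)) ∘ (fun t => hc₃.flow t y) =
          fun t : ℝ => (p y : ℂ) * Complex.exp (((c * t : ℝ) : ℂ) * Complex.I) := by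
        funext t
        simp only [Function.comp_apply, hp.map_ψ F, Circle.coe_mul, Circle.coe_exp]
      rw [e]
      have h2 : HasDerivAt (fun t : ℝ => ((c * t : ℝ) : ℂ)) (c : ℂ) 0 := by
        simpa using ((hasDerivAt_id (0 : ℝ)).const_mul c).ofReal_comp
      refine ((h2.mul_const Complex.I).cexp.const_mul (p y : ℂ)).congr_deriv ?_
      simp
      ring
    have := mfderiv_apply_eq_of_hasDerivAt (hc₃.isMIntegralCurve y) (t := 0)
      ((hcoe _).mdifferentiableAt (by simp)) h1
    rwa [hc₃.flow_zero] at this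

end
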